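/- Notation. Let $d\in\mathbf N$. For $t,s>0$ let $\Sigma_t^s(\mathbf R^d)$ be the Beurling type Gelfand--Shilov space of all $\varphi\in C^\infty(\mathbf R^d)$ such that $$\|\varphi\|_h=\sup_{\alpha,\beta\in\mathbf N^d,\ x\in\mathbf R^d}\frac{|x^\alpha D^\beta\varphi(x)|}{h^{|\alpha+\beta|}\,\alpha!^t\,\beta!^s}<\infty\quad\text{for all }h>0,\qquad D^\beta=(-i)^{|\beta|}\partial^\beta,$$ with the Fréchet topology given by the norms $\|\cdot\|_h$, $h>0$, and let $(\Sigma_t^s)'(\mathbf R^d)$ be its topological dual, i.e. the space of continuous conjugate linear functionals $\varphi\mapsto(u,\varphi)$ (this pairing extends $(u,\varphi)=\int u\,\overline\varphi\,dx$). Put $\widehat\varphi(\xi)=(2\pi)^{-d/2}\int\varphi(x)e^{-i\langle x,\xi\rangle}dx$; for $u\in(\Sigma_t^s)'(\mathbf R^d)$ the Fourier transform $\widehat u\in(\Sigma_s^t)'(\mathbf R^d)$ is defined by $(\widehat u,\widehat\varphi)=(u,\varphi)$, $\varphi\in\Sigma_t^s(\mathbf R^d)$. For $\psi\in\Sigma_t^s(\mathbf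 R^d)\setminus 0$ put $V_\psi u(x,\xi)=(2\pi)^{-d/2}(u,M_\xi T_x\psi)$, where $M_\xi T_x\psi(y)=e^{i\langle y,\xi\rangle}\psi(y-x)$. The wave front set $\mathrm{WF}^{t,s}(u)\subseteq\mathbf R^{2d}\setminus0$ with respect to the window $\psi$ is defined as follows: $(x_0,\xi_0)\ne0$ does not belong to $\mathrm{WF}^{t,s}(u)$ if and only if there is an open set $U\subseteq\mathbf R^{2d}\setminus0$ containing $(x_0,\xi_0)$ such that $$\sup_{\lambda>0,\ (x,\xi)\in U}e^{r\lambda}|V_\psi u(\lambda^tx,\lambda^s\xi)|<\infty\quad\text{for all }r>0.$$ The set $V_s(u)\subseteq\mathbf R^d\setminus0$ is defined as follows: $\eta\ne0$ does not belong to $V_s(u)$ if and only if $\widehat u$ is a continuous function and there is an open conic set $\Gamma\subseteq\mathbf R^d\setminus0$ containing $\eta$ such that $\sup_{\xi\in\Gamma}e^{r|\xi|^{1/s}}|\widehat u(\xi)|<\infty$ for all $r>0$. **Proposition.** Let $s>1$, $t>0$, and let $c_\alpha\in\mathbf C$, $\alpha\in\mathbf N^d$, satisfy $$\sum_{\alpha\in\mathbf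 N^d}|c_\alpha|\,r^{|\alpha|}\alpha!^s<\infty\quad\text{for all }r>0.$$ Then the series $u=\sum_\alpha c_\alpha D^\alpha\delta_0$ converges (tested on every $\varphi\in\Sigma_t^s(\mathbf R^d)$, with $(D^\alpha\delta_0,\varphi)=\overline{D^\alpha\varphi(0)}$) to an element $u\in(\Sigma_t^s)'(\mathbf R^d)$. The series $f(x)=\sum_\alpha c_\alpha x^\alpha$ converges absolutely at every $x\in\mathbf R^d$; as a series of ultradistributions it converges (tested on every $\varphi\in\Sigma_s^t(\mathbf R^d)$) to an element of $(\Sigma_s^t)'(\mathbf R^d)$, namely the one given by the function $f$, $(f,\varphi)=\int f\,\overline\varphi\,dx$. Moreover $$\mathrm{WF}^{t,s}(u)=\{0\}\times V_s(u)\qquad\text{and}\qquad\mathrm{WF}^{s,t}(f)=V_s(u)\times\{0\},$$ whatever nonzero windows in $\Sigma_t^s(\mathbf R^d)$ and $\Sigma_s^t(\mathbf R^d)$, respectively, are used to define these wave front sets. Finally, $V_s(u)$ is the set of directions in which $f$ fails to decay super-exponentially: a point $x_0\in\mathbf R^d\setminus0$ is not in $V_s(u)$ if and only if there is an open set $U\subseteq\mathbf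 R^d\setminus0$ containing $x_0$ such that $$\sup_{x\in U,\ \lambda>0}e^{r\lambda}|f(\lambda^sx)|<\infty\quad\text{for all }r>0.$$ -/

import Mathlib

open scoped ContDiff

noncomputable section

namespace GelfandShilov

/-- `d`-dimensional Euclidean space. -/
abbrev E (d : ℕ) : Type := EuclideanSpace ℝ (Fin d)

/-- Multi-indices. -/
abbrev MIdx (d : ℕ) : Type := Fin d → ℕ

/-- The length `|α| = α₁ + ⋯ + α_d`. -/
def deg {d : ℕ} (α : MIdx d) : ℕ := ∑ i, α i

/-- The factorial `α! = α₁! ⋯ α_d!`, as a real number. -/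
def mfact {d : ℕ} (α : MIdx d) : ℝ := ∏ i, (Nat.factorial (α i) : ℝ)

/-- The monomial `x ^ α`. -/
def mono {d : ℕ} (x : E d) (α : MIdx d) : ℝ := ∏ i, x i ^ α i

/-- The partial derivative `∂ᵢ f`. -/
def pderiv {d : ℕ} (i : Fin d) (f : E d → ℂ) : E d → ℂ :=
  fun x => fderiv ℝ f x (EuclideanSpace.single i 1)

/-- `∂ᵢ ^ (α i)` applied successively for the indices `i` in a list. -/
def listDeriv {d : ℕ} (L : List (Fin d)) (α : MIdx d) (f : E d → ℂ) : E d → ℂ :=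
  L.foldr (fun i g => (pderiv i)^[α i] g) f

/-- The partial derivative `∂ ^ α f = ∂₁ ^ α₁ ⋯ ∂_d ^ α_d f`. -/
def mderiv {d : ℕ} (α : MIdx d) (f : E d → ℂ) : E d → ℂ :=
  listDeriv (List.finRange d) α f

/-- `D ^ α f = (-i) ^ |α| ∂ ^ α f`. -/
def Dop {d : ℕ} (α : MIdx d) (f : E d → ℂ) : E d → ℂ :=
  fun x => (-Complex.I) ^ deg α * mderiv α f x

section derivFacts

variable {d : ℕ}

theorem contDiff_pderiv (i : Fin d) {f : E d → ℂ} (hf : ContDiff ℝ ∞ f) :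
    ContDiff ℝ ∞ (pderiv i f) :=
  (hf.fderiv_right (m := ∞) (by simp)).clm_apply contDiff_const

theorem pderiv_add (i : Fin d) {f g : E d → ℂ} (hf : ContDiff ℝ ∞ f) (hg : ContDiff ℝ ∞ g) :
    pderiv i (f + g) = pderiv i f + pderiv i g := by
  funext x
  simp only [pderiv, Pi.add_apply]
  rw [fderiv_add (hf.differentiable (by simp) x) (hg.differentiable (by simp) x)]
  rfl

theorem pderiv_smul (i : Fin d) (c : ℂ) {f : E d → ℂ} (hf : ContDiff ℝ ∞ f) :
    pderiv i (c • f) = c • pderiv i f := by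
  funext x
  simp only [pderiv, Pi.smul_apply]
  rw [fderiv_const_smul (hf.differentiable (by simp) x)]
  rfl

theorem pderiv_comm (i j : Fin d) {f : E d → ℂ} (hf : ContDiff ℝ ∞ f) :
    pderiv i (pderiv j f) = pderiv j (pderiv i f) := by
  funext x
  have hd : DifferentiableAt ℝ (fderiv ℝ f) x :=
    (hf.fderiv_right (m := ∞) (by simp)).differentiable (by simp) x
  have key : ∀ v w : E d, fderiv ℝ (fun y => fderiv ℝ f y v) x w = fderiv ℝ (fderiv ℝ f) x w v := by
    intro v w
    rw [fderiv_clm_apply hd (differentiableAt_const v)]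
    simp
  change fderiv ℝ (fun y => fderiv ℝ f y _) x _ = fderiv ℝ (fun y => fderiv ℝ f y _) x _
  rw [key, key]
  exact (hf.contDiffAt.isSymmSndFDerivAt
    (by rw [minSmoothness_of_isRCLikeNormedField]; exact WithTop.coe_le_coe.2 (le_top : (2 : ℕ∞) ≤ ⊤))).eq _ _

theorem contDiff_iterate (i : Fin d) (n : ℕ) {f : E d → ℂ} (hf : ContDiff ℝ ∞ f) :
    ContDiff ℝ ∞ ((pderiv i)^[n] f) := by
  induction n with
  | zero => exact hf
  | succ n ih => rw [Function.iterate_succ_apply']; exact contDiff_pderiv i ih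

theorem iterate_add' (i : Fin d) (n : ℕ) {f g : E d → ℂ} (hf : ContDiff ℝ ∞ f)
    (hg : ContDiff ℝ ∞ g) :
    (pderiv i)^[n] (f + g) = (pderiv i)^[n] f + (pderiv i)^[n] g := by
  induction n with
  | zero => rfl
  | succ n ih =>
    rw [Function.iterate_succ_apply', ih,
      pderiv_add i (contDiff_iterate i n hf) (contDiff_iterate i n hg)]
    simp only [Function.iterate_succ_apply']

theorem iterate_smul' (i : Fin d) (n : ℕ) (c : ℂ) {f : E d → ℂ} (hf : ContDiff ℝ ∞ f) :
    (pderiv i)^[n] (c • f) = c • (pderiv i)^[n] f := by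
  induction n with
  | zero => rfl
  | succ n ih =>
    rw [Function.iterate_succ_apply', ih, pderiv_smul i c (contDiff_iterate i n hf)]
    simp only [Function.iterate_succ_apply']

theorem iterate_comm (i j : Fin d) (n : ℕ) {f : E d → ℂ} (hf : ContDiff ℝ ∞ f) :
    (pderiv i)^[n] (pderiv j f) = pderiv j ((pderiv i)^[n] f) := by
  induction n with
  | zero => rfl
  | succ n ih =>
    rw [Function.iterate_succ_apply', ih, pderiv_comm i j (contDiff_iterate i n hf),
      Function.iterate_succ_apply']

theorem contDiff_listDeriv (L : List (Fin d)) (α : MIdx d) {f : E d → ℂ}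
    (hf : ContDiff ℝ ∞ f) : ContDiff ℝ ∞ (listDeriv L α f) := by
  induction L with
  | nil => exact hf
  | cons i L ih => exact contDiff_iterate i (α i) ih

theorem listDeriv_add (L : List (Fin d)) (α : MIdx d) {f g : E d → ℂ}
    (hf : ContDiff ℝ ∞ f) (hg : ContDiff ℝ ∞ g) :
    listDeriv L α (f + g) = listDeriv L α f + listDeriv L α g := by
  induction L with
  | nil => rfl
  | cons i L ih =>
    change (pderiv i)^[α i] (listDeriv L α (f + g)) = _
    rw [ih, iterate_add' i _ (contDiff_listDeriv L α hf) (contDiff_listDeriv L α hg)]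
    rfl

theorem listDeriv_smul (L : List (Fin d)) (α : MIdx d) (c : ℂ) {f : E d → ℂ}
    (hf : ContDiff ℝ ∞ f) : listDeriv L α (c • f) = c • listDeriv L α f := by
  induction L with
  | nil => rfl
  | cons i L ih =>
    change (pderiv i)^[α i] (listDeriv L α (c • f)) = _
    rw [ih, iterate_smul' i _ c (contDiff_listDeriv L α hf)]
    rfl

theorem listDeriv_comm (L : List (Fin d)) (α : MIdx d) (j : Fin d) {f : E d → ℂ}
    (hf : ContDiff ℝ ∞ f) : listDeriv L α (pderiv j f) = pderiv j (listDeriv L α f) := by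
  induction L with
  | nil => rfl
  | cons i L ih =>
    change (pderiv i)^[α i] (listDeriv L α (pderiv j f)) = _
    rw [ih, iterate_comm i j _ (contDiff_listDeriv L α hf)]
    rfl

theorem listDeriv_single_not_mem (L : List (Fin d)) (α : MIdx d) (j : Fin d) (hj : j ∉ L)
    (f : E d → ℂ) : listDeriv L (α + Pi.single j 1) f = listDeriv L α f := by
  induction L with
  | nil => rfl
  | cons i L ih =>
    simp only [List.mem_cons, not_or] at hj
    change (pderiv i)^[(α + Pi.single j 1 : MIdx d) i] (listDeriv L (α + Pi.single j 1) f) = _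
    rw [ih hj.2]
    simp [Ne.symm hj.1, listDeriv]

theorem listDeriv_single_mem (L : List (Fin d)) (hL : L.Nodup) (α : MIdx d) (j : Fin d)
    (hj : j ∈ L) {f : E d → ℂ} (hf : ContDiff ℝ ∞ f) :
    listDeriv L (α + Pi.single j 1) f = pderiv j (listDeriv L α f) := by
  induction L with
  | nil => simp at hj
  | cons i L ih =>
    rw [List.nodup_cons] at hL
    change (pderiv i)^[(α + Pi.single j 1 : MIdx d) i] (listDeriv L (α + Pi.single j 1) f) =
      pderiv j ((pderiv i)^[α i] (listDeriv L α f))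
    by_cases hij : i = j
    · subst hij
      rw [listDeriv_single_not_mem L α i hL.1]
      simp [Function.iterate_succ_apply']
    · have hj' : j ∈ L := by
        rcases List.mem_cons.1 hj with h | h
        · exact absurd h.symm hij
        · exact h
      rw [ih hL.2 hj', iterate_comm i j _ (contDiff_listDeriv L α hf)]
      simp [hij]

theorem contDiff_mderiv (α : MIdx d) {f : E d → ℂ} (hf : ContDiff ℝ ∞ f) :
    ContDiff ℝ ∞ (mderiv α f) := contDiff_listDeriv _ α hf

theorem mderiv_add (α : MIdx d) {f g : E d → ℂ} (hf : ContDiff ℝ ∞ f) (hg : ContDiff ℝ ∞ g) :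
    mderiv α (f + g) = mderiv α f + mderiv α g := listDeriv_add _ α hf hg

theorem mderiv_smul (α : MIdx d) (c : ℂ) {f : E d → ℂ} (hf : ContDiff ℝ ∞ f) :
    mderiv α (c • f) = c • mderiv α f := listDeriv_smul _ α c hf

theorem mderiv_pderiv (α : MIdx d) (i : Fin d) {f : E d → ℂ} (hf : ContDiff ℝ ∞ f) :
    mderiv α (pderiv i f) = mderiv (α + Pi.single i 1) f := by
  rw [mderiv, listDeriv_comm _ α i hf, mderiv,
    listDeriv_single_mem _ (List.nodup_finRange d) α i (List.mem_finRange i) hf]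

/-- Translation of a function, `T_a f (y) = f (y - a)`. -/
def translate (a : E d) (f : E d → ℂ) : E d → ℂ := fun y => f (y - a)

/-- Modulation of a function, `M_ξ f (y) = exp (i ⟨y, ξ⟩) f (y)`. -/
def modulate (ξ : E d) (f : E d → ℂ) : E d → ℂ :=
  fun y => Complex.exp (Complex.I * ((inner ℝ y ξ : ℝ) : ℂ)) * f y

theorem listDeriv_translate (L : List (Fin d)) (a : E d) (α : MIdx d) (f : E d → ℂ) :
    listDeriv L α (translate a f) = translate a (listDeriv L α f) := by
  have h1 : ∀ (i : Fin d) (g : E d → ℂ), pderiv i (translate a g) = translate a (pderiv i g) := by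
    intro i g
    funext x
    change fderiv ℝ (fun y => g (y - a)) x _ = fderiv ℝ g (x - a) _
    rw [fderiv_comp_sub]
  have h2 : ∀ (i : Fin d) (n : ℕ) (g : E d → ℂ),
      (pderiv i)^[n] (translate a g) = translate a ((pderiv i)^[n] g) := by
    intro i n g
    induction n with
    | zero => rfl
    | succ n ih => simp only [Function.iterate_succ_apply']; rw [ih, h1]
  induction L with
  | nil => rfl
  | cons i L ih =>
    change (pderiv i)^[α i] (listDeriv L α (translate a f)) = _
    rw [ih, h2]
    rfl

theorem contDiff_phase (ξ : E d) :
    ContDiff ℝ ∞ (fun y : E d => Complex.exp (Complex.I * ((inner ℝ y ξ : ℝ) : ℂ))) := by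
  have h : ContDiff ℝ ∞ (fun y : E d => ((inner ℝ y ξ : ℝ) : ℂ)) :=
    Complex.ofRealCLM.contDiff.comp (contDiff_id.inner ℝ contDiff_const)
  exact (contDiff_const.mul h).cexp

theorem contDiff_modulate (ξ : E d) {f : E d → ℂ} (hf : ContDiff ℝ ∞ f) :
    ContDiff ℝ ∞ (modulate ξ f) := (contDiff_phase ξ).mul hf

/-- The operator `∂ᵢ + i ξᵢ`, the conjugate of `∂ᵢ` by a modulation. -/
def qderiv (ξ : E d) (i : Fin d) (f : E d → ℂ) : E d → ℂ :=
  pderiv i f + (Complex.I * (ξ i : ℂ)) • f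

theorem contDiff_qderiv (ξ : E d) (i : Fin d) {f : E d → ℂ} (hf : ContDiff ℝ ∞ f) :
    ContDiff ℝ ∞ (qderiv ξ i f) :=
  (contDiff_pderiv i hf).add (contDiff_const.smul hf)

theorem pderiv_modulate (ξ : E d) (i : Fin d) {f : E d → ℂ} (hf : ContDiff ℝ ∞ f) :
    pderiv i (modulate ξ f) = modulate ξ (qderiv ξ i f) := by
  funext x
  have h0 : HasFDerivAt (fun y : E d => (inner ℝ y ξ : ℝ)) (innerSL ℝ ξ) x := by
    have : (fun y : E d => (inner ℝ y ξ : ℝ)) = fun y => innerSL ℝ ξ y := by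
      funext y
      simp [real_inner_comm]
    rw [this]
    exact (innerSL ℝ ξ).hasFDerivAt
  have h1 : HasFDerivAt (fun y : E d => ((inner ℝ y ξ : ℝ) : ℂ))
      (Complex.ofRealCLM.comp (innerSL ℝ ξ)) x := Complex.ofRealCLM.hasFDerivAt.comp x h0
  have h2 := ((h1.const_mul Complex.I).cexp).mul (hf.differentiable (by simp) x).hasFDerivAt
  have h3 : fderiv ℝ (modulate ξ f) x = _ := h2.fderiv
  change fderiv ℝ (modulate ξ f) x _ = _
  rw [h3]
  simp [EuclideanSpace.inner_single_right, modulate, qderiv, pderiv]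
  ring

/-- Iterated `∂ᵢ + i ξᵢ` over a list. -/
def listQ (ξ : E d) (L : List (Fin d)) (α : MIdx d) (f : E d → ℂ) : E d → ℂ :=
  L.foldr (fun i g => (qderiv ξ i)^[α i] g) f

theorem contDiff_iterateQ (ξ : E d) (i : Fin d) (n : ℕ) {f : E d → ℂ} (hf : ContDiff ℝ ∞ f) :
    ContDiff ℝ ∞ ((qderiv ξ i)^[n] f) := by
  induction n with
  | zero => exact hf
  | succ n ih => rw [Function.iterate_succ_apply']; exact contDiff_qderiv ξ i ih

theorem contDiff_listQ (ξ : E d) (L : List (Fin d)) (α : MIdx d) {f : E d → ℂ}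
    (hf : ContDiff ℝ ∞ f) : ContDiff ℝ ∞ (listQ ξ L α f) := by
  induction L with
  | nil => exact hf
  | cons i L ih => exact contDiff_iterateQ ξ i (α i) ih

theorem listDeriv_modulate (ξ : E d) (L : List (Fin d)) (α : MIdx d) {f : E d → ℂ}
    (hf : ContDiff ℝ ∞ f) :
    listDeriv L α (modulate ξ f) = modulate ξ (listQ ξ L α f) := by
  have h2 : ∀ (i : Fin d) (n : ℕ) (g : E d → ℂ), ContDiff ℝ ∞ g →
      (pderiv i)^[n] (modulate ξ g) = modulate ξ ((qderiv ξ i)^[n] g) := by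
    intro i n g hg
    induction n with
    | zero => rfl
    | succ n ih =>
      simp only [Function.iterate_succ_apply']
      rw [ih, pderiv_modulate ξ i (contDiff_iterateQ ξ i n hg)]
  induction L with
  | nil => rfl
  | cons i L ih =>
    change (pderiv i)^[α i] (listDeriv L α (modulate ξ f)) = _
    rw [ih, h2 i _ _ (contDiff_listQ ξ L α hf)]
    rfl

theorem norm_modulate (ξ : E d) (f : E d → ℂ) (y : E d) : ‖modulate ξ f y‖ = ‖f y‖ := by
  rw [modulate, norm_mul, mul_comm Complex.I, Complex.norm_exp_ofReal_mul_I, one_mul]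

end derivFacts

/-- The denominator `h ^ |α + β| α! ^ t β! ^ s` in the Gelfand-Shilov norms. -/
def gsWeight {d : ℕ} (t s h : ℝ) (α β : MIdx d) : ℝ :=
  h ^ deg (α + β) * mfact α ^ t * mfact β ^ s

theorem mfact_pos {d : ℕ} (α : MIdx d) : 0 < mfact α :=
  Finset.prod_pos fun i _ => by exact_mod_cast Nat.factorial_pos (α i)

theorem gsWeight_pos {d : ℕ} (t s : ℝ) {h : ℝ} (hh : 0 < h) (α β : MIdx d) :
    0 < gsWeight t s h α β := by
  have h1 := Real.rpow_pos_of_pos (mfact_pos α) t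
  have h2 := Real.rpow_pos_of_pos (mfact_pos β) s
  unfold gsWeight
  positivity

/-- The functions of the Beurling type Gelfand-Shilov space: the smooth `f` such that for all
`h > 0` the quotients `|x ^ α D ^ β f (x)| / (h ^ |α + β| α! ^ t β! ^ s)` are bounded in
`α`, `β`, `x` (note that `|D ^ β f| = |∂ ^ β f|`). -/
def gsSubmodule (d : ℕ) (t s : ℝ) : Submodule ℂ (E d → ℂ) where
  carrier := {f | ContDiff ℝ ∞ f ∧ ∀ h : ℝ, 0 < h → ∃ C : ℝ, ∀ (α β : MIdx d) (x : E d),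
    |mono x α| * ‖mderiv β f x‖ ≤ C * gsWeight t s h α β}
  zero_mem' := by
    refine ⟨contDiff_const, fun h _ => ⟨0, fun α β x => ?_⟩⟩
    have h0 : mderiv β (0 : E d → ℂ) = 0 := by
      have := mderiv_smul β 0 (f := (0 : E d → ℂ)) contDiff_const
      simpa using this
    simp [h0]
  add_mem' := by
    rintro f g ⟨hf, hf'⟩ ⟨hg, hg'⟩
    refine ⟨hf.add hg, fun h hh => ?_⟩
    obtain ⟨C, hC⟩ := hf' h hh
    obtain ⟨C', hC'⟩ := hg' h hh
    refine ⟨C + C', fun α β x => ?_⟩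
    rw [mderiv_add β hf hg, Pi.add_apply]
    calc |mono x α| * ‖mderiv β f x + mderiv β g x‖
        ≤ |mono x α| * (‖mderiv β f x‖ + ‖mderiv β g x‖) := by
          gcongr
          exact norm_add_le _ _
      _ ≤ _ := by linarith [hC α β x, hC' α β x]
  smul_mem' := by
    rintro c f ⟨hf, hf'⟩
    refine ⟨contDiff_const.smul hf, fun h hh => ?_⟩
    obtain ⟨C, hC⟩ := hf' h hh
    refine ⟨‖c‖ * C, fun α β x => ?_⟩
    rw [mderiv_smul β c hf, Pi.smul_apply, norm_smul]
    calc |mono x α| * (‖c‖ * ‖mderiv β f x‖) = ‖c‖ * (|mono x α| * ‖mderiv β f x‖) := by ring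
      _ ≤ ‖c‖ * (C * gsWeight t s h α β) :=
          mul_le_mul_of_nonneg_left (hC α β x) (norm_nonneg c)
      _ = _ := by ring

/-- The Beurling type Gelfand-Shilov space `Σ_t^s(ℝ^d)`. -/
def GS (d : ℕ) (t s : ℝ) : Type := gsSubmodule d t s

instance (d : ℕ) (t s : ℝ) : AddCommGroup (GS d t s) :=
  inferInstanceAs (AddCommGroup (gsSubmodule d t s))

instance (d : ℕ) (t s : ℝ) : Module ℂ (GS d t s) :=
  inferInstanceAs (Module ℂ (gsSubmodule d t s))

/-- The function underlying an element of `Σ_t^s(ℝ^d)`. -/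
def GS.fn {d : ℕ} {t s : ℝ} (f : GS d t s) : E d → ℂ := f.1

/-- The quotients whose supremum is the Gelfand-Shilov norm with parameter `h`. -/
def gsQuot {d : ℕ} (t s h : ℝ) (f : E d → ℂ) (p : MIdx d × MIdx d × E d) : ℝ :=
  |mono p.2.2 p.1| * ‖mderiv p.2.1 f p.2.2‖ / gsWeight t s h p.1 p.2.1

theorem gsQuot_nonneg {d : ℕ} (t s : ℝ) {h : ℝ} (hh : 0 < h) (f : E d → ℂ)
    (p : MIdx d × MIdx d × E d) : 0 ≤ gsQuot t s h f p := by
  have := gsWeight_pos t s hh p.1 p.2.1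
  unfold gsQuot
  positivity

theorem GS.bddAbove {d : ℕ} {t s : ℝ} (f : GS d t s) {h : ℝ} (hh : 0 < h) :
    BddAbove (Set.range (gsQuot t s h f.fn)) := by
  obtain ⟨C, hC⟩ := f.2.2 h hh
  refine ⟨C, ?_⟩
  rintro _ ⟨p, rfl⟩
  exact (div_le_iff₀ (gsWeight_pos t s hh _ _)).2 (hC p.1 p.2.1 p.2.2)

/-- The norm `‖f‖ = sup |x ^ α D ^ β f (x)| / (h ^ |α + β| α! ^ t β! ^ s)` on `Σ_t^s(ℝ^d)`,
for `h > 0`. -/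
def gsSeminorm (d : ℕ) (t s : ℝ) (h : Set.Ioi (0 : ℝ)) : Seminorm ℂ (GS d t s) :=
  Seminorm.of (fun f => ⨆ p, gsQuot t s h f.fn p)
    (by
      intro f g
      refine ciSup_le fun p => ?_
      have h1 := le_ciSup (f.bddAbove h.2) p
      have h2 := le_ciSup (g.bddAbove h.2) p
      refine le_trans ?_ (add_le_add h1 h2)
      have hw := gsWeight_pos t s h.2 p.1 p.2.1
      have h3 : mderiv p.2.1 (f + g).fn = mderiv p.2.1 f.fn + mderiv p.2.1 g.fn :=
        mderiv_add p.2.1 f.2.1 g.2.1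
      simp only [gsQuot]
      rw [← add_div, h3, Pi.add_apply, ← mul_add]
      gcongr
      exact norm_add_le _ _)
    (by
      intro c f
      rw [Real.mul_iSup_of_nonneg (norm_nonneg c)]
      congr 1
      funext p
      have h3 : mderiv p.2.1 (c • f).fn = c • mderiv p.2.1 f.fn := mderiv_smul p.2.1 c f.2.1
      simp only [gsQuot]
      rw [h3, Pi.smul_apply, norm_smul]
      ring)

/-- The Fréchet topology of `Σ_t^s(ℝ^d)`, defined by the norms with parameters `h > 0`. -/
instance (d : ℕ) (t s : ℝ) : TopologicalSpace (GS d t s) :=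
  (SeminormFamily.moduleFilterBasis (𝕜 := ℂ) (gsSeminorm d t s)).topology

theorem gs_withSeminorms (d : ℕ) (t s : ℝ) : WithSeminorms (gsSeminorm d t s) := ⟨rfl⟩

/-- The space `(Σ_t^s)'(ℝ^d)` of Gelfand-Shilov ultradistributions: the continuous conjugate
linear functionals on `Σ_t^s(ℝ^d)`, where `u φ` is the pairing `(u, φ)` that extends the `L²`
inner product `∫ u conj(φ)`. -/
abbrev GSDual (d : ℕ) (t s : ℝ) : Type := GS d t s →SL[starRingEnd ℂ] ℂ

theorem exists_weight {s h : ℝ} (hs : 0 < s) (hh : 0 < h) (A : ℝ) :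
    ∃ (w : ℕ → ℝ) (K : ℝ), 1 ≤ K ∧ (∀ m, h ^ m * (m.factorial : ℝ) ^ s ≤ w m) ∧
      (∀ m, A * w m ≤ w (m + 1)) ∧ ∀ m, w m ≤ K * (h ^ m * (m.factorial : ℝ) ^ s) := by
  let c : ℕ → ℝ := fun j => max 1 (A / (h * ((j + 1 : ℕ) : ℝ) ^ s))
  let k : ℕ → ℝ := fun m => ∏ j ∈ Finset.range m, c j
  have hc : ∀ j, 1 ≤ c j := fun j => le_max_left _ _
  have hk1 : ∀ m, 1 ≤ k m := fun m => by
    induction m with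
    | zero => simp [k]
    | succ m ih =>
      have h1 : k (m + 1) = k m * c m := Finset.prod_range_succ _ _
      rw [h1]
      exact one_le_mul_of_one_le_of_one_le ih (hc m)
  have hks : ∀ m, k (m + 1) = k m * c m := fun m => Finset.prod_range_succ _ _
  have hpos : ∀ m : ℕ, 0 < h ^ m * (m.factorial : ℝ) ^ s := fun m =>
    mul_pos (pow_pos hh m) (Real.rpow_pos_of_pos (by exact_mod_cast m.factorial_pos) s)
  have hmono : Monotone k := monotone_nat_of_le_succ fun m => by
    rw [hks]
    exact le_mul_of_one_le_right (by linarith [hk1 m]) (hc m)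
  have hN : ∃ N : ℕ, ∀ m, N ≤ m → c m = 1 := by
    have ht : Filter.Tendsto (fun j : ℕ => h * ((j + 1 : ℕ) : ℝ) ^ s) Filter.atTop Filter.atTop :=
      (((tendsto_rpow_atTop hs).comp
        (tendsto_natCast_atTop_atTop.comp (Filter.tendsto_add_atTop_nat 1)))).const_mul_atTop hh
    obtain ⟨N, hN⟩ := Filter.eventually_atTop.1 (ht.eventually_ge_atTop A)
    refine ⟨N, fun m hm => max_eq_left ?_⟩
    have h1 : 0 < h * ((m + 1 : ℕ) : ℝ) ^ s :=
      mul_pos hh (Real.rpow_pos_of_pos (by positivity) s)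
    exact (div_le_one h1).2 (hN m hm)
  obtain ⟨N, hN⟩ := hN
  have hkN : ∀ m, k m ≤ k N := by
    intro m
    rcases le_total m N with hm | hm
    · exact hmono hm
    · induction m, hm using Nat.le_induction with
      | base => exact le_rfl
      | succ m hm ih => rw [hks, hN m hm, mul_one]; exact ih
  refine ⟨fun m => k m * (h ^ m * (m.factorial : ℝ) ^ s), k N, hk1 N, fun m => ?_, fun m => ?_,
    fun m => ?_⟩
  · exact le_mul_of_one_le_left (hpos m).le (hk1 m)
  · have h1 : 0 < h * ((m + 1 : ℕ) : ℝ) ^ s :=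
      mul_pos hh (Real.rpow_pos_of_pos (by positivity) s)
    have h2 : A ≤ c m * (h * ((m + 1 : ℕ) : ℝ) ^ s) :=
      (div_le_iff₀ h1).1 (le_max_right _ _)
    have h3 : h ^ (m + 1) * ((m + 1).factorial : ℝ) ^ s =
        (h * ((m + 1 : ℕ) : ℝ) ^ s) * (h ^ m * (m.factorial : ℝ) ^ s) := by
      rw [Nat.factorial_succ, Nat.cast_mul,
        Real.mul_rpow (Nat.cast_nonneg _) (Nat.cast_nonneg _)]
      ring
    have h4 : 0 ≤ k m * (h ^ m * (m.factorial : ℝ) ^ s) :=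
      mul_nonneg (by linarith [hk1 m]) (hpos m).le
    simp only []
    rw [h3, hks]
    calc A * (k m * (h ^ m * (m.factorial : ℝ) ^ s))
        ≤ (c m * (h * ((m + 1 : ℕ) : ℝ) ^ s)) * (k m * (h ^ m * (m.factorial : ℝ) ^ s)) :=
          mul_le_mul_of_nonneg_right h2 h4
      _ = _ := by ring
  · exact mul_le_mul_of_nonneg_right (hkN m) (hpos m).le

theorem prod_weight {d : ℕ} (s h : ℝ) (β : MIdx d) :
    ∏ i, (h ^ β i * ((β i).factorial : ℝ) ^ s) = h ^ deg β * mfact β ^ s := by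
  rw [Finset.prod_mul_distrib, Finset.prod_pow_eq_pow_sum, mfact, deg,
    Real.finsetProd_rpow _ _ (fun i _ => Nat.cast_nonneg _)]

theorem deg_add {d : ℕ} (α β : MIdx d) : deg (α + β) = deg α + deg β :=
  Finset.sum_add_distrib

theorem listQ_bound {d : ℕ} (ξ : E d) (x : E d) (a : ℝ) (ha : 0 ≤ a) (w : ℕ → ℝ)
    (hw0 : ∀ m, 0 ≤ w m) (hw : ∀ m, ‖ξ‖ * w m ≤ w (m + 1)) (B : ℝ) (f : E d → ℂ)
    (hf : ContDiff ℝ ∞ f) (hB : ∀ γ : MIdx d, a * ‖mderiv γ f x‖ ≤ B * ∏ i, w (γ i))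
    (hB0 : 0 ≤ B) (β : MIdx d) :
    a * ‖listQ ξ (List.finRange d) β f x‖ ≤ 2 ^ deg β * B * ∏ i, w (β i) := by
  let P : (E d → ℂ) → ℝ → MIdx d → Prop := fun g B δ =>
    ContDiff ℝ ∞ g ∧ 0 ≤ B ∧ ∀ γ : MIdx d, a * ‖mderiv γ g x‖ ≤ B * ∏ i, w ((γ + δ) i)
  have step : ∀ g B δ (j : Fin d), P g B δ → P (qderiv ξ j g) (2 * B) (δ + Pi.single j 1) := by
    rintro g B δ j ⟨hg, hB, hP⟩
    refine ⟨contDiff_qderiv ξ j hg, by positivity, fun γ => ?_⟩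
    have e1 : mderiv γ (qderiv ξ j g) x =
        mderiv (γ + Pi.single j 1) g x + (Complex.I * (ξ j : ℂ)) * mderiv γ g x := by
      rw [qderiv, mderiv_add γ (contDiff_pderiv j hg)
          (g := (Complex.I * (ξ j : ℂ)) • g) (contDiff_const.smul hg),
        mderiv_pderiv γ j hg, mderiv_smul γ _ hg]
      rfl
    have hξ : ‖Complex.I * (ξ j : ℂ)‖ ≤ ‖ξ‖ := by
      rw [norm_mul, Complex.norm_I, one_mul, Complex.norm_real]
      exact PiLp.norm_apply_le ξ j
    have aux : ∀ ε ζ : MIdx d, (∀ i, i ≠ j → ε i = ζ i) → ε j = ζ j + 1 →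
        ‖ξ‖ * ∏ i, w (ζ i) ≤ ∏ i, w (ε i) := by
      intro ε ζ h1 h2
      rw [← Finset.mul_prod_erase _ (fun i => w (ζ i)) (Finset.mem_univ j),
        ← Finset.mul_prod_erase _ (fun i => w (ε i)) (Finset.mem_univ j), ← mul_assoc]
      have e3 : ∏ i ∈ Finset.univ.erase j, w (ε i) = ∏ i ∈ Finset.univ.erase j, w (ζ i) :=
        Finset.prod_congr rfl fun i hi => by rw [h1 i (Finset.ne_of_mem_erase hi)]
      rw [e3, h2]
      exact mul_le_mul_of_nonneg_right (hw _) (Finset.prod_nonneg fun i _ => hw0 _)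
    have e2 : ‖ξ‖ * ∏ i, w ((γ + δ) i) ≤ ∏ i, w ((γ + (δ + Pi.single j 1) : MIdx d) i) :=
      aux _ _ (fun i hi => by simp [hi]) (by simp [add_assoc])
    have e5 := hP (γ + Pi.single j 1)
    have e6 : γ + Pi.single j 1 + δ = γ + (δ + Pi.single j 1) := by abel
    rw [e6] at e5
    have e7 : a * (‖ξ‖ * ‖mderiv γ g x‖) ≤ B * ∏ i, w ((γ + (δ + Pi.single j 1) : MIdx d) i) := by
      calc a * (‖ξ‖ * ‖mderiv γ g x‖) = ‖ξ‖ * (a * ‖mderiv γ g x‖) := by ring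
        _ ≤ ‖ξ‖ * (B * ∏ i, w ((γ + δ) i)) :=
          mul_le_mul_of_nonneg_left (hP γ) (norm_nonneg ξ)
        _ = B * (‖ξ‖ * ∏ i, w ((γ + δ) i)) := by ring
        _ ≤ _ := mul_le_mul_of_nonneg_left e2 hB
    rw [e1]
    calc a * ‖mderiv (γ + Pi.single j 1) g x + Complex.I * (ξ j : ℂ) * mderiv γ g x‖
        ≤ a * (‖mderiv (γ + Pi.single j 1) g x‖ + ‖ξ‖ * ‖mderiv γ g x‖) := by
          refine mul_le_mul_of_nonneg_left ((norm_add_le _ _).trans ?_) ha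
          rw [norm_mul]
          gcongr
      _ ≤ _ := by linarith
  have iter : ∀ (n : ℕ) g B δ (j : Fin d), P g B δ →
      P ((qderiv ξ j)^[n] g) (2 ^ n * B) (δ + Pi.single j n) := by
    intro n g B δ j hP
    induction n with
    | zero => simpa using hP
    | succ n ih =>
      have := step _ _ _ j ih
      rw [Function.iterate_succ_apply']
      convert this using 1
      · ring
      · rw [add_assoc, ← Pi.single_add]
  have main : ∀ L : List (Fin d), P (listQ ξ L β f) (2 ^ (L.map β).sum * B)
      ((L.map fun j => (Pi.single j (β j) : MIdx d)).sum) := by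
    intro L
    induction L with
    | nil => exact ⟨hf, by simpa using hB0, fun γ => by simpa [listQ] using hB γ⟩
    | cons j L ih =>
      have := iter (β j) _ _ _ j ih
      simp only [List.map_cons, List.sum_cons]
      have e1 : (2 : ℝ) ^ (β j + (L.map β).sum) * B = 2 ^ β j * (2 ^ (L.map β).sum * B) := by
        rw [pow_add]; ring
      rw [e1, add_comm (Pi.single j (β j) : MIdx d)]
      exact this
  have h1 := (main (List.finRange d)).2.2 0
  have e1 : ((List.finRange d).map β).sum = deg β := by
    rw [deg, ← List.sum_ofFn, List.ofFn_eq_map]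
  have e2 : ((List.finRange d).map fun j => (Pi.single j (β j) : MIdx d)).sum = β := by
    rw [← List.ofFn_eq_map, List.sum_ofFn]
    exact Finset.univ_sum_single β
  rw [e1, e2, zero_add] at h1
  have e3 : mderiv 0 (listQ ξ (List.finRange d) β f) = listQ ξ (List.finRange d) β f := by
    have : ∀ (L : List (Fin d)) (g : E d → ℂ), listDeriv L 0 g = g := by
      intro L g
      induction L with
      | nil => rfl
      | cons i L ih => exact ih
    exact this _ _
  rw [e3] at h1
  exact h1

theorem modulate_mem {d : ℕ} {t s : ℝ} (hs : 0 < s) (ξ : E d) {f : E d → ℂ}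
    (hf : f ∈ gsSubmodule d t s) : modulate ξ f ∈ gsSubmodule d t s := by
  refine ⟨contDiff_modulate ξ hf.1, fun h hh => ?_⟩
  have hh2 : 0 < h / 2 := by positivity
  obtain ⟨C, hC⟩ := hf.2 (h / 2) hh2
  obtain ⟨w, K, hK, hw1, hw2, hw3⟩ := exists_weight hs hh2 ‖ξ‖
  have hpos : ∀ m : ℕ, 0 < (h / 2) ^ m * (m.factorial : ℝ) ^ s := fun m =>
    mul_pos (pow_pos hh2 m) (Real.rpow_pos_of_pos (by exact_mod_cast m.factorial_pos) s)
  have hw0 : ∀ m, 0 ≤ w m := fun m => (hpos m).le.trans (hw1 m)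
  refine ⟨|C| * K ^ d, fun α β x => ?_⟩
  have e1 : mderiv β (modulate ξ f) = modulate ξ (listQ ξ (List.finRange d) β f) :=
    listDeriv_modulate ξ _ β hf.1
  rw [e1, norm_modulate]
  have hα : 0 ≤ (h / 2) ^ deg α * mfact α ^ t :=
    mul_nonneg (by positivity) (Real.rpow_nonneg (mfact_pos α).le t)
  have h1 := listQ_bound ξ x |mono x α| (abs_nonneg _) w hw0 hw2
    (|C| * ((h / 2) ^ deg α * mfact α ^ t)) f hf.1 (fun γ => by
      refine (hC α γ x).trans ?_
      have e2 : gsWeight t s (h / 2) α γ =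
          ((h / 2) ^ deg α * mfact α ^ t) * ∏ i, ((h / 2) ^ γ i * ((γ i).factorial : ℝ) ^ s) := by
        rw [prod_weight, gsWeight, deg_add, pow_add]
        ring
      rw [e2, mul_assoc |C|]
      have e4 : ∏ i, ((h / 2) ^ γ i * ((γ i).factorial : ℝ) ^ s) ≤ ∏ i, w (γ i) :=
        Finset.prod_le_prod (fun i _ => (hpos _).le) fun i _ => hw1 _
      have e5 : 0 ≤ ∏ i, ((h / 2) ^ γ i * ((γ i).factorial : ℝ) ^ s) :=
        Finset.prod_nonneg fun i _ => (hpos _).le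
      exact mul_le_mul (le_abs_self C) (mul_le_mul_of_nonneg_left e4 hα)
        (mul_nonneg hα e5) (abs_nonneg C))
    (mul_nonneg (abs_nonneg C) hα) β
  refine h1.trans ?_
  have e6 : ∏ i, w (β i) ≤ K ^ d * ((h / 2) ^ deg β * mfact β ^ s) := by
    rw [← prod_weight]
    calc ∏ i, w (β i) ≤ ∏ i, (K * ((h / 2) ^ β i * ((β i).factorial : ℝ) ^ s)) :=
          Finset.prod_le_prod (fun i _ => hw0 _) fun i _ => hw3 _
      _ = _ := by rw [Finset.prod_mul_distrib]; simp
  calc 2 ^ deg β * (|C| * ((h / 2) ^ deg α * mfact α ^ t)) * ∏ i, w (β i)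
      ≤ 2 ^ deg β * (|C| * ((h / 2) ^ deg α * mfact α ^ t)) *
          (K ^ d * ((h / 2) ^ deg β * mfact β ^ s)) := by
        refine mul_le_mul_of_nonneg_left e6 ?_
        exact mul_nonneg (by positivity) (mul_nonneg (abs_nonneg C) hα)
    _ = |C| * K ^ d * ((h / 2) ^ deg α * (2 * (h / 2)) ^ deg β * mfact α ^ t * mfact β ^ s) := by
        rw [mul_pow 2 (h / 2)]; ring
    _ ≤ |C| * K ^ d * gsWeight t s h α β := by
        have e7 : 2 * (h / 2) = h := by ring
        rw [e7, gsWeight, deg_add, pow_add]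
        have e8 : (h / 2) ^ deg α ≤ h ^ deg α := by
          gcongr
          linarith
        have := Real.rpow_nonneg (mfact_pos α).le t
        have := Real.rpow_nonneg (mfact_pos β).le s
        gcongr

theorem translate_mem {d : ℕ} {t s : ℝ} (ht : 0 < t) (a : E d) {f : E d → ℂ}
    (hf : f ∈ gsSubmodule d t s) : translate a f ∈ gsSubmodule d t s := by
  refine ⟨hf.1.comp (contDiff_id.sub contDiff_const), fun h hh => ?_⟩
  have hh2 : 0 < h / 2 := by positivity
  obtain ⟨C, hC⟩ := hf.2 (h / 2) hh2
  obtain ⟨w, K, hK, hw1, hw2, hw3⟩ := exists_weight ht hh2 ‖a‖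
  have hA : ∀ m : ℕ, ‖a‖ ^ m ≤ K * ((h / 2) ^ m * (m.factorial : ℝ) ^ t) := by
    intro m
    refine le_trans ?_ (hw3 m)
    induction m with
    | zero => simpa using hw1 0
    | succ m ih =>
      rw [pow_succ']
      exact (mul_le_mul_of_nonneg_left ih (norm_nonneg a)).trans (hw2 m)
  have hpos : ∀ m : ℕ, 0 < (h / 2) ^ m * (m.factorial : ℝ) ^ t := fun m =>
    mul_pos (pow_pos hh2 m) (Real.rpow_pos_of_pos (by exact_mod_cast m.factorial_pos) t)
  refine ⟨|C| * K ^ d, fun α β x => ?_⟩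
  have e1 : mderiv β (translate a f) x = mderiv β f (x - a) := by
    rw [mderiv, listDeriv_translate]
    rfl
  rw [e1]
  let y : E d := x - a
  let α' : MIdx d := fun i => if ‖a‖ ≤ |y i| then α i else 0
  have hb : |mono x α| ≤ 2 ^ deg α * (|mono y α'| * ∏ i, ‖a‖ ^ (α i - α' i)) := by
    simp only [mono, Finset.abs_prod, abs_pow, deg]
    rw [← Finset.prod_pow_eq_pow_sum, ← Finset.prod_mul_distrib, ← Finset.prod_mul_distrib]
    refine Finset.prod_le_prod (fun i _ => by positivity) fun i _ => ?_
    have hx : |x i| ≤ |y i| + ‖a‖ := by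
      have h1 : x i = y i + a i := by simp [y]
      have h2 : |a i| ≤ ‖a‖ := PiLp.norm_apply_le a i
      rw [h1]
      exact (abs_add_le _ _).trans (by linarith)
    by_cases hi : ‖a‖ ≤ |y i|
    · simp only [α', hi, if_true, Nat.sub_self, pow_zero, mul_one]
      rw [← mul_pow]
      exact pow_le_pow_left₀ (abs_nonneg _) (by linarith) _
    · simp only [α', hi, if_false, Nat.sub_zero, pow_zero, one_mul]
      rw [← mul_pow]
      push Not at hi
      exact pow_le_pow_left₀ (abs_nonneg _) (by linarith) _
  have hc : (∏ i, ‖a‖ ^ (α i - α' i)) * ((h / 2) ^ deg α' * mfact α' ^ t) ≤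
      K ^ d * ((h / 2) ^ deg α * mfact α ^ t) := by
    rw [← prod_weight, ← prod_weight, ← Finset.prod_mul_distrib]
    calc ∏ i, (‖a‖ ^ (α i - α' i) * ((h / 2) ^ α' i * ((α' i).factorial : ℝ) ^ t))
        ≤ ∏ i, (K * ((h / 2) ^ α i * ((α i).factorial : ℝ) ^ t)) := by
          refine Finset.prod_le_prod
            (fun i _ => mul_nonneg (by positivity) (hpos _).le) fun i _ => ?_
          by_cases hi : ‖a‖ ≤ |y i|
          · simp only [α', hi, if_true, Nat.sub_self, pow_zero, one_mul]
            exact le_mul_of_one_le_left (hpos _).le hK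
          · simpa [α', hi] using hA (α i)
      _ = _ := by rw [Finset.prod_mul_distrib]; simp
  have hβ : 0 ≤ (h / 2) ^ deg β * mfact β ^ s :=
    mul_nonneg (by positivity) (Real.rpow_nonneg (mfact_pos β).le s)
  have hp : 0 ≤ ∏ i, ‖a‖ ^ (α i - α' i) := Finset.prod_nonneg fun i _ => by positivity
  have hw' : |mono y α'| * ‖mderiv β f y‖ ≤ |C| * gsWeight t s (h / 2) α' β :=
    (hC α' β y).trans (mul_le_mul_of_nonneg_right (le_abs_self C) (gsWeight_pos t s hh2 _ _).le)
  calc |mono x α| * ‖mderiv β f (x - a)‖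
      ≤ (2 ^ deg α * (|mono y α'| * ∏ i, ‖a‖ ^ (α i - α' i))) * ‖mderiv β f y‖ :=
        mul_le_mul_of_nonneg_right hb (norm_nonneg _)
    _ = (2 ^ deg α * ∏ i, ‖a‖ ^ (α i - α' i)) * (|mono y α'| * ‖mderiv β f y‖) := by ring
    _ ≤ (2 ^ deg α * ∏ i, ‖a‖ ^ (α i - α' i)) * (|C| * gsWeight t s (h / 2) α' β) :=
        mul_le_mul_of_nonneg_left hw' (mul_nonneg (by positivity) hp)
    _ = 2 ^ deg α * |C| * ((h / 2) ^ deg β * mfact β ^ s) *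
          ((∏ i, ‖a‖ ^ (α i - α' i)) * ((h / 2) ^ deg α' * mfact α' ^ t)) := by
        rw [gsWeight, deg_add, pow_add]; ring
    _ ≤ 2 ^ deg α * |C| * ((h / 2) ^ deg β * mfact β ^ s) *
          (K ^ d * ((h / 2) ^ deg α * mfact α ^ t)) :=
        mul_le_mul_of_nonneg_left hc (mul_nonneg (by positivity) hβ)
    _ = |C| * K ^ d * ((2 * (h / 2)) ^ deg α * (h / 2) ^ deg β * mfact α ^ t * mfact β ^ s) := by
        rw [mul_pow 2 (h / 2)]; ring
    _ ≤ |C| * K ^ d * gsWeight t s h α β := by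
        have e7 : 2 * (h / 2) = h := by ring
        rw [e7, gsWeight, deg_add, pow_add]
        have e8 : (h / 2) ^ deg β ≤ h ^ deg β := by
          gcongr
          linarith
        have := Real.rpow_nonneg (mfact_pos α).le t
        have := Real.rpow_nonneg (mfact_pos β).le s
        gcongr

/-- The time-frequency shift `M_ξ T_x` on `Σ_t^s(ℝ^d)`. -/
def tfShift {d : ℕ} {t s : ℝ} (ht : 0 < t) (hs : 0 < s) (x ξ : E d) (ψ : GS d t s) : GS d t s :=
  ⟨modulate ξ (translate x ψ.fn), modulate_mem hs ξ (translate_mem ht x ψ.2)⟩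

/-- The short-time Fourier transform
`V_ψ u (x, ξ) = (2π) ^ (-d/2) (u, M_ξ T_x ψ)` of `u ∈ (Σ_t^s)'(ℝ^d)` with window `ψ`. -/
def stft {d : ℕ} {t s : ℝ} (ht : 0 < t) (hs : 0 < s) (ψ : GS d t s) (u : GSDual d t s)
    (x ξ : E d) : ℂ :=
  (((2 * Real.pi) ^ (-(d : ℝ) / 2) : ℝ) : ℂ) * u (tfShift ht hs x ξ ψ)

/-- The `t,s`-Gelfand-Shilov wave front set `WF^{t,s}(u)` of `u ∈ (Σ_t^s)'(ℝ^d)`, computed with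
the window `ψ`: a point `z ≠ 0` of phase space is outside it if `z` has an open neighbourhood
`U ⊆ T^*ℝ^d ∖ 0` such that
`sup_{λ > 0, (x, ξ) ∈ U} exp (r λ) |V_ψ u (λ ^ t x, λ ^ s ξ)| < ∞` for all `r > 0`. -/
def WF {d : ℕ} {t s : ℝ} (ht : 0 < t) (hs : 0 < s) (ψ : GS d t s) (u : GSDual d t s) :
    Set (E d × E d) :=
  {z | z ≠ 0 ∧ ¬ ∃ U : Set (E d × E d), IsOpen U ∧ U ⊆ {0}ᶜ ∧ z ∈ U ∧
    ∀ r : ℝ, 0 < r → ∃ C : ℝ, ∀ l : ℝ, 0 < l → ∀ p ∈ U,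
      Real.exp (r * l) * ‖stft ht hs ψ u (l ^ t • p.1) (l ^ s • p.2)‖ ≤ C}

/-- The Fourier transform `(2π) ^ (-d/2) ∫ φ(x) exp (-i ⟨x, ξ⟩) dx`. -/
def fourier {d : ℕ} (φ : E d → ℂ) (ξ : E d) : ℂ :=
  (((2 * Real.pi) ^ (-(d : ℝ) / 2) : ℝ) : ℂ) *
    ∫ x, φ x * Complex.exp (-Complex.I * ((inner ℝ x ξ : ℝ) : ℂ))

/-- The Fourier transform of the ultradistribution `u ∈ (Σ_t^s)'(ℝ^d)`, that is the
ultradistribution acting by `(û, φ̂) = (u, φ)`, is the continuous function `g`. -/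
def HasFourier {d : ℕ} {t s : ℝ} (u : GSDual d t s) (g : E d → ℂ) : Prop :=
  Continuous g ∧ ∀ φ : GS d t s,
    MeasureTheory.Integrable (fun ξ => g ξ * starRingEnd ℂ (fourier φ.fn ξ)) ∧
    u φ = ∫ ξ, g ξ * starRingEnd ℂ (fourier φ.fn ξ)

/-- The set `V_s(u) ⊆ ℝ^d ∖ 0`: a point `η ≠ 0` is outside it if `û` is a continuous function
such that `sup_{ξ ∈ Γ} exp (r |ξ| ^ (1/s)) |û(ξ)| < ∞` for all `r > 0`, for some open conic
set `Γ ⊆ ℝ^d ∖ 0` containing `η`. -/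
def V {d : ℕ} {t s : ℝ} (u : GSDual d t s) : Set (E d) :=
  {η | η ≠ 0 ∧ ¬ ∃ g : E d → ℂ, HasFourier u g ∧
    ∃ Γ : Set (E d), IsOpen Γ ∧ Γ ⊆ {0}ᶜ ∧ (∀ x ∈ Γ, ∀ l : ℝ, 0 < l → l • x ∈ Γ) ∧ η ∈ Γ ∧
      ∀ r : ℝ, 0 < r → ∃ C : ℝ, ∀ ξ ∈ Γ, Real.exp (r * ‖ξ‖ ^ (1 / s)) * ‖g ξ‖ ≤ C}

/-- `u = ∑ c_α D ^ α δ₀` in `(Σ_t^s)'(ℝ^d)`: the series converges to `u` (unconditionally) on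
every test function, where `(D ^ α δ₀, φ) = (δ₀, D ^ α φ) = conj (D ^ α φ (0))`. -/
def IsDiracSeries {d : ℕ} {t s : ℝ} (c : MIdx d → ℂ) (u : GSDual d t s) : Prop :=
  ∀ φ : GS d t s, HasSum (fun α => c α * starRingEnd ℂ (Dop α φ.fn 0)) (u φ)

/-- `F = ∑ c_α x ^ α` in `(Σ_t^s)'(ℝ^d)`: the series converges to `F` (unconditionally) on
every test function, where `(x ^ α, φ) = ∫ x ^ α conj (φ(x)) dx`. -/
def IsPowerSeries {d : ℕ} {t s : ℝ} (c : MIdx d → ℂ) (F : GSDual d t s) : Prop :=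
  ∀ φ : GS d t s, HasSum (fun α => c α * ∫ x, (mono x α : ℂ) * starRingEnd ℂ (φ.fn x)) (F φ)

/-- The ultradistribution `F` is the function `f`: `(F, φ) = ∫ f conj(φ)`. -/
def IsFunction {d : ℕ} {t s : ℝ} (F : GSDual d t s) (f : E d → ℂ) : Prop :=
  ∀ φ : GS d t s, MeasureTheory.Integrable (fun x => f x * starRingEnd ℂ (φ.fn x)) ∧
    F φ = ∫ x, f x * starRingEnd ℂ (φ.fn x)


/-- The sum `f (x) = ∑ c_α x ^ α` of the power series with coefficients `c`. -/
def powerSeriesSum {d : ℕ} (c : MIdx d → ℂ) (x : E d) : ℂ := ∑' α : MIdx d, c α * (mono x α : ℂ)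

/-- The set of directions in `ℝ^d ∖ 0` in which the function `f` fails to decay like
`exp (-r |x| ^ (1/s))` for all `r > 0`: a point `x₀ ≠ 0` is outside it if there is an open set
`U ⊆ ℝ^d ∖ 0` containing `x₀` such that
`sup_{x ∈ U, λ > 0} exp (r λ) |f (λ ^ s x)| < ∞` for all `r > 0`. -/
def nonDecay {d : ℕ} (s : ℝ) (f : E d → ℂ) : Set (E d) :=
  {x₀ | x₀ ≠ 0 ∧ ¬ ∃ U : Set (E d), IsOpen U ∧ U ⊆ {0}ᶜ ∧ x₀ ∈ U ∧
    ∀ r : ℝ, 0 < r → ∃ C : ℝ, ∀ x ∈ U, ∀ l : ℝ, 0 < l →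
      Real.exp (r * l) * ‖f (l ^ s • x)‖ ≤ C}

end GelfandShilov

end

open scoped ContDiff

noncomputable section

namespace GelfandShilov

variable {d : ℕ}

/-! The Fourier transform sends `D ^ α δ₀` to `(2π) ^ (-d/2) ξ ^ α`, so û is the function `(2π) ^
(-d/2) f`. Up to a phase, the short-time Fourier transform of `u` at `(x, ξ)` is therefore that of
û, with window ψ̂, at `(ξ, -x)` (`pairing_tfShift`). Both wave front sets thus reduce to one
question: where does `W(x, ξ)`, the Fourier transform of `f · conj ρ(· - x)`, decay along the curves
`(λ ^ s x, λ ^ t ξ)`?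

The coefficient condition makes `f` very tame. For every `ε > 0` it is `O(exp (ε |x| ^ (1/s)))`, and
since `s > 1` each derivative costs only a factor `1/r`, with `r` as large as desired and no
factorial. Consequently `W(x, ξ)` is `O(exp (-r |ξ| ^ (1/t) + ε |x| ^ (1/s)))` for all `r, ε > 0`
(`exists_windowedFourier_le`, and `exists_stft_diracSeries_le` on the Dirac side), which rules out
every point with `ξ ≠ 0` (`LocDecay.of_ne_zero`).

At points `(x₀, 0)` with `x₀ ≠ 0`, decay of `W` is equivalent to decay of `f` near the direction
`x₀`. Decay of `f` passes to `W` because the window is concentrated and `|·| ^ (1/s)` is subadditive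
(`LocDecay.of_decay`). Conversely, Fourier inversion in `ξ`, evaluated where the shifted window does
not vanish, recovers `f` from `W` (`LocDecay.decay`). The criterion does not mention the window,
whence the independence of the window.

It remains to identify this decay set with `V u`: decay in a cone is matched with decay along
dilations of an open set (`exists_cone_decay_iff`), and the function representing û is shown to be
unique. Uniqueness needs a nonzero test function, built from `exp (-x ^ N)`. -/

/-! ### Factorial moment bounds and stretched exponentials -/

/-- This is `q ^ n ≤ n! exp q` for `q = (y / h) ^ (1/s)`, raised to the power `s`. -/
theorem pow_le_factorial_rpow_mul_exp {s h y : ℝ} (hs : 0 < s) (hh : 0 < h) (hy : 0 ≤ y) (n : ℕ) :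
    y ^ n ≤ h ^ n * (n.factorial : ℝ) ^ s * Real.exp (s * (y / h) ^ (1 / s)) := by
  have hyh : 0 ≤ y / h := div_nonneg hy hh.le
  set q : ℝ := (y / h) ^ (1 / s) with hq
  have hq0 : 0 ≤ q := Real.rpow_nonneg hyh _
  have hqs : q ^ s = y / h := by
    rw [hq, ← Real.rpow_mul hyh, one_div_mul_cancel hs.ne', Real.rpow_one]
  have hf : (0 : ℝ) < n.factorial := by exact_mod_cast n.factorial_pos
  have h1 : q ^ n ≤ n.factorial * Real.exp q :=
    (div_le_iff₀' hf).1 (Real.pow_div_factorial_le_exp q hq0 n)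
  have h2 : (q ^ n) ^ s ≤ (n.factorial * Real.exp q) ^ s :=
    Real.rpow_le_rpow (by positivity) h1 hs.le
  rw [Real.mul_rpow hf.le (Real.exp_pos q).le, ← Real.exp_mul, ← Real.rpow_natCast, ← Real.rpow_mul hq0,
    mul_comm (n : ℝ), Real.rpow_mul hq0, hqs, Real.rpow_natCast, div_pow, div_le_iff₀' (pow_pos hh n),
    mul_comm q] at h2
  linarith

theorem abs_mono_le {s h : ℝ} (hs : 0 < s) (hh : 0 < h) (x : E d) (α : MIdx d) :
    |mono x α| ≤ h ^ deg α * mfact α ^ s * Real.exp (d * (s * (‖x‖ / h) ^ (1 / s))) := by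
  have h1 : |mono x α| ≤ ∏ i, (h ^ α i * ((α i).factorial : ℝ) ^ s *
      Real.exp (s * (‖x‖ / h) ^ (1 / s))) := by
    rw [mono, Finset.abs_prod]
    refine Finset.prod_le_prod (fun i _ => abs_nonneg _) fun i _ => ?_
    rw [abs_pow]
    exact (pow_le_pow_left₀ (abs_nonneg _) (PiLp.norm_apply_le x i) _).trans
      (pow_le_factorial_rpow_mul_exp hs hh (norm_nonneg x) _)
  rw [Finset.prod_mul_distrib, prod_weight] at h1
  simpa [← Real.exp_nat_mul] using h1

theorem exists_norm_le_card_mul_abs [NeZero d] (x : E d) : ∃ i, ‖x‖ ≤ d * |x i| := by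
  obtain ⟨i, -, hi⟩ := Finset.exists_max_image (Finset.univ : Finset (Fin d)) (fun i => |x i|)
    ⟨0, Finset.mem_univ _⟩
  refine ⟨i, ?_⟩
  have h1 : ‖x‖ ≤ ∑ j, |x j| := by
    conv_lhs => rw [← (EuclideanSpace.basisFun (Fin d) ℝ).sum_repr x]
    refine (norm_sum_le _ _).trans (Finset.sum_le_sum fun j _ => ?_)
    simp [norm_smul]
  refine h1.trans ((Finset.sum_le_sum fun j hj => hi j hj).trans ?_)
  simp

theorem mono_single (x : E d) (i : Fin d) (n : ℕ) : mono x (Pi.single i n) = x i ^ n := by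
  rw [mono, Finset.prod_eq_single i]
  · simp
  · intro j _ hj; simp [hj]
  · simp

theorem mfact_single (i : Fin d) (n : ℕ) : mfact (Pi.single i n : MIdx d) = n.factorial := by
  rw [mfact, Finset.prod_eq_single i]
  · simp
  · intro j _ hj; simp [hj]
  · simp

theorem deg_single (i : Fin d) (n : ℕ) : deg (Pi.single i n : MIdx d) = n := by
  simp [deg]

/-- Taking `s`-th roots turns the hypothesis into `q ^ n w ≤ D n!`. Summing the exponential series
at `q / 2` against a geometric series then bounds `exp (q / 2) w`; raising to the power `s` gives
back `v`. -/
theorem le_exp_of_pow_bound {s h y v C : ℝ} (hs : 0 < s) (hh : 0 < h) (hy : 0 ≤ y) (hv : 0 ≤ v)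
    (hC : 0 ≤ C) (H : ∀ n : ℕ, y ^ n * v ≤ C * (h ^ n * (n.factorial : ℝ) ^ s)) :
    v ≤ 2 ^ s * C * Real.exp (-(s / 2) * (y / h) ^ (1 / s)) := by
  have hyh : 0 ≤ y / h := div_nonneg hy hh.le
  set q : ℝ := (y / h) ^ (1 / s) with hq
  have hq0 : 0 ≤ q := Real.rpow_nonneg hyh _
  have hqs : q ^ s = y / h := by
    rw [hq, ← Real.rpow_mul hyh, one_div_mul_cancel hs.ne', Real.rpow_one]
  set w : ℝ := v ^ (1 / s) with hw
  set D : ℝ := C ^ (1 / s) with hD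
  have hw0 : 0 ≤ w := Real.rpow_nonneg hv _
  have hD0 : 0 ≤ D := Real.rpow_nonneg hC _
  have hws : w ^ s = v := by rw [hw, ← Real.rpow_mul hv, one_div_mul_cancel hs.ne', Real.rpow_one]
  have hDs : D ^ s = C := by rw [hD, ← Real.rpow_mul hC, one_div_mul_cancel hs.ne', Real.rpow_one]
  have h1 : ∀ n : ℕ, q ^ n * w ≤ D * n.factorial := by
    intro n
    have hf : (0 : ℝ) ≤ n.factorial := Nat.cast_nonneg _
    rw [← Real.rpow_le_rpow_iff (by positivity) (by positivity) hs,
      Real.mul_rpow (by positivity) hw0, Real.mul_rpow hD0 hf, hws, hDs, ← Real.rpow_natCast q,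
      ← Real.rpow_mul hq0, mul_comm (n : ℝ), Real.rpow_mul hq0, hqs, Real.rpow_natCast, div_pow,
      div_mul_eq_mul_div, div_le_iff₀ (pow_pos hh n)]
    linarith [H n]
  have h2 : ∀ n : ℕ, (q / 2) ^ n / n.factorial * w ≤ D * (1 / 2) ^ n := by
    intro n
    have hf : (0 : ℝ) < n.factorial := by exact_mod_cast n.factorial_pos
    have := h1 n
    have e : (q / 2) ^ n / n.factorial * w = (q ^ n * w) / n.factorial * (1 / 2) ^ n := by
      rw [div_pow, one_div, inv_pow]; field_simp
    rw [e]
    gcongr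
    rwa [div_le_iff₀ hf]
  have h3 : Real.exp (q / 2) * w ≤ D * 2 := by
    have s1 : HasSum (fun n : ℕ => (q / 2) ^ n / n.factorial * w) (Real.exp (q / 2) * w) := by
      rw [Real.exp_eq_exp_ℝ]
      exact (NormedSpace.expSeries_div_hasSum_exp (q / 2)).mul_right w
    have s2 : HasSum (fun n : ℕ => D * (1 / 2 : ℝ) ^ n) (D * 2) := hasSum_geometric_two.mul_left D
    exact hasSum_le h2 s1 s2
  have h4 : (Real.exp (q / 2) * w) ^ s ≤ (D * 2) ^ s :=
    Real.rpow_le_rpow (by positivity) h3 hs.le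
  rw [Real.mul_rpow (Real.exp_pos _).le hw0, Real.mul_rpow hD0 (by norm_num), hws, hDs,
    ← Real.exp_mul] at h4
  have e2 : -(s / 2) * q = -(q / 2 * s) := by ring
  rw [e2, Real.exp_neg, ← div_eq_mul_inv, le_div_iff₀ (Real.exp_pos _)]
  linarith

/-- Powers of the largest coordinate alone already control the norm. The parameter `h` depends only
on `d`, `s`, `r`, so the conclusion is uniform in `x`, `v` and `C`. -/
theorem exists_le_exp_of_mono_bound (d : ℕ) {s r : ℝ} (hs : 0 < s) (hr : 0 < r) :
    ∃ h > 0, ∃ K > 0, ∀ (x : E d) (v C : ℝ), 0 ≤ v → 0 ≤ C →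
      (∀ α, |mono x α| * v ≤ C * (h ^ deg α * mfact α ^ s)) →
      v ≤ K * C * Real.exp (-r * ‖x‖ ^ (1 / s)) := by
  rcases Nat.eq_zero_or_pos d with rfl | hd
  -- In dimension zero the space is a point, the exponential is 1, and the bound for `α = 0`
  -- suffices.
  · refine ⟨1, one_pos, 1, one_pos, fun x v C _ _ H => ?_⟩
    have hx : x = 0 := Subsingleton.elim _ _
    have := H 0
    simpa [hx, mono, mfact, deg, Real.zero_rpow (inv_ne_zero hs.ne')] using this
  · have : NeZero d := ⟨hd.ne'⟩
    have hd' : (0 : ℝ) < d := by exact_mod_cast hd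
    set b : ℝ := (2 * r / s) ^ s
    have hb : 0 < b := Real.rpow_pos_of_pos (by positivity) _
    -- With this `h`, the exponent `(s / 2) (|x i| / h) ^ (1/s)` equals `r (d |x i|) ^ (1/s)`, and
    -- `d |x i|` dominates the norm of `x`.
    refine ⟨1 / (d * b), by positivity, 2 ^ s, by positivity, fun x v C hv hC H => ?_⟩
    obtain ⟨i, hi⟩ := exists_norm_le_card_mul_abs x
    have h1 := le_exp_of_pow_bound hs (h := 1 / (d * b)) (by positivity) (abs_nonneg (x i)) hv hC
      (fun n => by
        have := H (Pi.single i n)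
        rwa [mono_single, mfact_single, deg_single, abs_pow] at this)
    refine h1.trans (mul_le_mul_of_nonneg_left (Real.exp_le_exp.2 ?_) (by positivity))
    have e1 : b ^ (1 / s) = 2 * r / s := by
      rw [← Real.rpow_mul (by positivity), mul_one_div_cancel hs.ne', Real.rpow_one]
    have e2 : |x i| / (1 / (d * b)) = (d * |x i|) * b := by field_simp
    have e3 : ‖x‖ ^ (1 / s) ≤ (d * |x i|) ^ (1 / s) :=
      Real.rpow_le_rpow (norm_nonneg _) hi (by positivity)
    rw [e2, Real.mul_rpow (by positivity) hb.le, e1]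
    have e4 : -(s / 2) * ((d * |x i|) ^ (1 / s) * (2 * r / s)) = -r * (d * |x i|) ^ (1 / s) := by
      field_simp
    rw [e4]
    nlinarith

/-! ### Classes of functions with stretched exponential decay or growth -/

theorem integrable_exp_neg_rpow {p r : ℝ} (hp : 0 < p) (hr : 0 < r) :
    MeasureTheory.Integrable (fun x : E d => Real.exp (-r * ‖x‖ ^ p)) := by
  have h0 : Filter.Tendsto (fun y : ℝ => (1 + y) ^ ((d : ℝ) + 1) * Real.exp (-r * y ^ p))
      Filter.atTop (nhds 0) := by
    have h1 := tendsto_rpow_mul_exp_neg_mul_atTop_nhds_zero (((d : ℝ) + 1) / p) r hr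
    have h2 : Filter.Tendsto (fun y : ℝ => 2 ^ ((d : ℝ) + 1) *
        ((y ^ p) ^ (((d : ℝ) + 1) / p) * Real.exp (-r * y ^ p))) Filter.atTop (nhds 0) := by
      simpa using (h1.comp (tendsto_rpow_atTop hp)).const_mul (2 ^ ((d : ℝ) + 1))
    refine squeeze_zero' ?_ ?_ h2
    · filter_upwards [Filter.eventually_ge_atTop 0] with y hy
      have : 0 ≤ (1 + y) ^ ((d : ℝ) + 1) := Real.rpow_nonneg (by linarith) _
      positivity
    · filter_upwards [Filter.eventually_ge_atTop 1] with y hy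
      have hy0 : 0 ≤ y := by linarith
      rw [← Real.rpow_mul hy0, mul_div_cancel₀ _ hp.ne', ← mul_assoc,
        ← Real.mul_rpow (by norm_num) hy0]
      gcongr
      linarith
  obtain ⟨R, hR⟩ := Filter.eventually_atTop.1 (h0.eventually (ge_mem_nhds one_pos))
  have hcont : Continuous fun x : E d => Real.exp (-r * ‖x‖ ^ p) :=
    Real.continuous_exp.comp (continuous_const.mul (continuous_norm.rpow_const fun _ => Or.inr hp.le))
  have hI : MeasureTheory.Integrable (fun x : E d => (1 + ‖x‖) ^ (-((d : ℝ) + 1))) :=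
    integrable_one_add_norm (by simp)
  refine (hI.const_mul (max 1 ((1 + |R|) ^ ((d : ℝ) + 1)))).mono' hcont.aestronglyMeasurable
    (Filter.Eventually.of_forall fun x => ?_)
  have hx : 0 < (1 + ‖x‖) ^ ((d : ℝ) + 1) := Real.rpow_pos_of_pos (by positivity) _
  rw [Real.norm_of_nonneg (Real.exp_pos _).le, Real.rpow_neg (by positivity), ← div_eq_mul_inv,
    le_div_iff₀ hx, mul_comm]
  rcases le_total R ‖x‖ with h | h
  · exact (hR _ h).trans (le_max_left _ _)
  · refine le_trans ?_ (le_max_right _ _)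
    have h1 : Real.exp (-r * ‖x‖ ^ p) ≤ 1 := by
      rw [Real.exp_le_one_iff]
      have := Real.rpow_nonneg (norm_nonneg x) p
      nlinarith
    refine (mul_le_of_le_one_right hx.le h1).trans ?_
    have := le_abs_self R
    gcongr
    linarith

/-- Functions that are continuous and `O(exp (-r ‖x‖ ^ (1/s)))` for all `r > 0`. -/
structure SuperExpDecay (s : ℝ) (ρ : E d → ℂ) : Prop where
  continuous : Continuous ρ
  bound : ∀ r : ℝ, 0 < r → ∃ C : ℝ, 0 ≤ C ∧ ∀ x, ‖ρ x‖ ≤ C * Real.exp (-r * ‖x‖ ^ (1 / s))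

theorem SuperExpDecay.integrable {s : ℝ} (hs : 0 < s) {ρ : E d → ℂ} (hρ : SuperExpDecay s ρ) :
    MeasureTheory.Integrable ρ := by
  obtain ⟨C, -, hC⟩ := hρ.bound 1 one_pos
  exact ((integrable_exp_neg_rpow (by positivity : 0 < 1 / s) one_pos).const_mul C).mono'
    hρ.continuous.aestronglyMeasurable (Filter.Eventually.of_forall hC)

theorem SuperExpDecay.conj {s : ℝ} {ρ : E d → ℂ} (hρ : SuperExpDecay s ρ) :
    SuperExpDecay s (fun x => starRingEnd ℂ (ρ x)) where
  continuous := Complex.continuous_conj.comp hρ.continuous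
  bound r hr := by simpa using hρ.bound r hr

/-- Functions that are continuous and `O(exp (ε ‖x‖ ^ (1/s)))` for all `ε > 0`. -/
structure SubExpGrowth (s : ℝ) (f : E d → ℂ) : Prop where
  continuous : Continuous f
  bound : ∀ ε : ℝ, 0 < ε → ∃ C : ℝ, 0 ≤ C ∧ ∀ x, ‖f x‖ ≤ C * Real.exp (ε * ‖x‖ ^ (1 / s))

theorem SubExpGrowth.mul_decay {s : ℝ} {f ρ : E d → ℂ} (hf : SubExpGrowth s f)
    (hρ : SuperExpDecay s ρ) : SuperExpDecay s (fun x => f x * ρ x) where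
  continuous := hf.continuous.mul hρ.continuous
  bound r hr := by
    obtain ⟨A, hA, hA'⟩ := hf.bound 1 one_pos
    obtain ⟨B, hB, hB'⟩ := hρ.bound (r + 1) (by positivity)
    refine ⟨A * B, by positivity, fun x => ?_⟩
    rw [norm_mul]
    refine (mul_le_mul (hA' x) (hB' x) (norm_nonneg _) (by positivity)).trans (le_of_eq ?_)
    rw [mul_mul_mul_comm, ← Real.exp_add]
    ring_nf

/-- Subadditivity holds because `1 / s ≤ 1`. It lets growth or decay be moved between a point and a
translate of it. -/
theorem norm_rpow_le_add {s : ℝ} (hs : 1 < s) (x y : E d) :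
    ‖x‖ ^ (1 / s) ≤ ‖y‖ ^ (1 / s) + ‖x - y‖ ^ (1 / s) := by
  have h1 : ‖x‖ ≤ ‖y‖ + ‖x - y‖ := by
    have := norm_add_le y (x - y); simpa using this
  refine (Real.rpow_le_rpow (norm_nonneg _) h1 (by positivity)).trans ?_
  exact Real.rpow_add_le_add_rpow (norm_nonneg _) (norm_nonneg _) (by positivity)
    ((div_le_one (by linarith)).2 hs.le)

/-! ### Multi-index bookkeeping -/

theorem MIdx.induction {P : MIdx d → Prop} (h0 : P 0)
    (h1 : ∀ γ j, P γ → P (γ + Pi.single j 1)) (γ : MIdx d) : P γ := by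
  have key : ∀ n (γ : MIdx d), deg γ = n → P γ := by
    intro n
    induction n with
    | zero =>
      intro γ hγ
      have : γ = 0 := by
        funext i
        exact Finset.sum_eq_zero_iff.1 hγ i (Finset.mem_univ i)
      rwa [this]
    | succ n ih =>
      intro γ hγ
      obtain ⟨j, -, hj⟩ := Finset.exists_ne_zero_of_sum_ne_zero
        (show ∑ i, γ i ≠ 0 by change deg γ ≠ 0; omega)
      have e : γ = (γ - Pi.single j 1) + Pi.single j 1 := by
        funext i
        by_cases hi : i = j
        · subst hi; simp; omega
        · simp [hi]
      rw [e]
      refine h1 _ j (ih _ ?_)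
      have := congrArg deg e
      rw [deg_add, deg_single] at this
      omega
  exact key _ γ rfl

theorem mderiv_zero (f : E d → ℂ) : mderiv 0 f = f := by
  have : ∀ (L : List (Fin d)) (g : E d → ℂ), listDeriv L 0 g = g := by
    intro L g
    induction L with
    | nil => rfl
    | cons i L ih => exact ih
  exact this _ _

theorem mono_zero (x : E d) : mono x 0 = 1 := by simp [mono]

theorem mono_add (x : E d) (α β : MIdx d) : mono x (α + β) = mono x α * mono x β := by
  simp [mono, pow_add, Finset.prod_mul_distrib]

theorem mfact_zero : mfact (0 : MIdx d) = 1 := by simp [mfact]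

theorem deg_zero : deg (0 : MIdx d) = 0 := by simp [deg]

theorem mfact_add_single (α : MIdx d) (j : Fin d) :
    mfact (α + Pi.single j 1) = (α j + 1) * mfact α := by
  rw [mfact, mfact, ← Finset.mul_prod_erase _ _ (Finset.mem_univ j),
    ← Finset.mul_prod_erase _ (fun i => ((α i).factorial : ℝ)) (Finset.mem_univ j), ← mul_assoc]
  congr 1
  · simp [Nat.factorial_succ]
  · exact Finset.prod_congr rfl fun i hi => by simp [Finset.ne_of_mem_erase hi]

theorem mfact_le_mfact_add (γ δ : MIdx d) : mfact δ ≤ mfact (γ + δ) := by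
  refine Finset.prod_le_prod (fun i _ => Nat.cast_nonneg _) fun i _ => ?_
  exact_mod_cast Nat.factorial_le (Nat.le_add_left _ _)

/-! ### Power series with small coefficients -/

/-- Coefficients satisfying `∑ |c_α| r ^ |α| α! ^ s < ∞` for all `r > 0`. -/
def SmallCoeff (s : ℝ) (c : MIdx d → ℂ) : Prop :=
  ∀ r : ℝ, 0 < r → Summable fun α => ‖c α‖ * r ^ deg α * mfact α ^ s

/-- The norm `∑ |c_α| r ^ |α| α! ^ s`. -/
def coeffNorm (s r : ℝ) (c : MIdx d → ℂ) : ℝ := ∑' α, ‖c α‖ * r ^ deg α * mfact α ^ s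

theorem coeff_term_nonneg (s : ℝ) {r : ℝ} (hr : 0 < r) (c : MIdx d → ℂ) (α : MIdx d) :
    0 ≤ ‖c α‖ * r ^ deg α * mfact α ^ s := by
  have := Real.rpow_nonneg (mfact_pos α).le s
  positivity

theorem coeffNorm_nonneg (s : ℝ) {r : ℝ} (hr : 0 < r) (c : MIdx d → ℂ) : 0 ≤ coeffNorm s r c :=
  tsum_nonneg (coeff_term_nonneg s hr c)

/-- The coefficients of the partial derivative of a power series. -/
def shiftCoeff (j : Fin d) (c : MIdx d → ℂ) : MIdx d → ℂ :=
  fun α => (α j + 1 : ℂ) * c (α + Pi.single j 1)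

/-- Since `s > 1`, the factor `α j + 1` produced by differentiation is at most the factor `(α j + 1)
^ s` gained by the factorial weight; only the change of degree remains, which is the factor `1/r`.
-/
theorem shiftCoeff_term_le {s r : ℝ} (hs : 1 < s) (hr : 0 < r) (j : Fin d) (c : MIdx d → ℂ)
    (α : MIdx d) : ‖shiftCoeff j c α‖ * r ^ deg α * mfact α ^ s ≤
      r⁻¹ * (‖c (α + Pi.single j 1)‖ * r ^ deg (α + Pi.single j 1) *
        mfact (α + Pi.single j 1) ^ s) := by
  have h0 : (1 : ℝ) ≤ α j + 1 := by
    have : (0 : ℝ) ≤ α j := Nat.cast_nonneg _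
    linarith
  have h1 : ((α j : ℝ) + 1) ≤ ((α j : ℝ) + 1) ^ s := by
    conv_lhs => rw [← Real.rpow_one ((α j : ℝ) + 1)]
    exact Real.rpow_le_rpow_of_exponent_le h0 hs.le
  have h2 : ‖(α j + 1 : ℂ)‖ = α j + 1 := by
    have : (α j + 1 : ℂ) = ((α j + 1 : ℝ) : ℂ) := by push_cast; rfl
    rw [this, Complex.norm_real, Real.norm_of_nonneg (by linarith)]
  rw [shiftCoeff, norm_mul, h2, mfact_add_single, Real.mul_rpow (by linarith) (mfact_pos α).le,
    deg_add, deg_single, pow_add, pow_one]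
  have e : r⁻¹ * (‖c (α + Pi.single j 1)‖ * (r ^ deg α * r) *
      (((α j : ℝ) + 1) ^ s * mfact α ^ s)) =
      ((α j : ℝ) + 1) ^ s * (‖c (α + Pi.single j 1)‖ * r ^ deg α * mfact α ^ s) := by
    field_simp
  rw [e]
  have := Real.rpow_nonneg (mfact_pos α).le s
  calc _ = ((α j : ℝ) + 1) * (‖c (α + Pi.single j 1)‖ * r ^ deg α * mfact α ^ s) := by ring
    _ ≤ _ := mul_le_mul_of_nonneg_right h1 (by positivity)

theorem add_single_injective (j : Fin d) :
    Function.Injective fun α : MIdx d => α + Pi.single j 1 :=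
  fun _ _ h => add_right_cancel h

theorem SmallCoeff.shift {s : ℝ} (hs : 1 < s) {c : MIdx d → ℂ} (hc : SmallCoeff s c) (j : Fin d) :
    SmallCoeff s (shiftCoeff j c) := fun r hr =>
  Summable.of_nonneg_of_le (coeff_term_nonneg s hr _) (shiftCoeff_term_le hs hr j c)
    (((hc r hr).comp_injective (add_single_injective j)).mul_left _)

theorem coeffNorm_shift_le {s r : ℝ} (hs : 1 < s) (hr : 0 < r) {c : MIdx d → ℂ}
    (hc : SmallCoeff s c) (j : Fin d) :
    coeffNorm s r (shiftCoeff j c) ≤ r⁻¹ * coeffNorm s r c := by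
  have h1 := (hc r hr).comp_injective (add_single_injective j)
  refine ((hc.shift hs j r hr).tsum_le_tsum (shiftCoeff_term_le hs hr j c) (h1.mul_left _)).trans ?_
  rw [tsum_mul_left]
  refine mul_le_mul_of_nonneg_left ?_ (by positivity)
  exact tsum_comp_le_tsum_of_inj (hc r hr) (coeff_term_nonneg s hr c) (add_single_injective j)

theorem norm_term_le {s r : ℝ} (hs : 0 < s) (hr : 0 < r) (c : MIdx d → ℂ) (x : E d) (α : MIdx d) :
    ‖c α * (mono x α : ℂ)‖ ≤ ‖c α‖ * r ^ deg α * mfact α ^ s *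
      Real.exp (d * (s * (‖x‖ / r) ^ (1 / s))) := by
  rw [norm_mul, Complex.norm_real, Real.norm_eq_abs, mul_assoc, mul_assoc, ← mul_assoc (r ^ deg α)]
  exact mul_le_mul_of_nonneg_left (abs_mono_le hs hr x α) (norm_nonneg _)

theorem SmallCoeff.summable {s : ℝ} (hs : 0 < s) {c : MIdx d → ℂ} (hc : SmallCoeff s c) (x : E d) :
    Summable fun α => c α * (mono x α : ℂ) :=
  Summable.of_norm_bounded ((hc 1 one_pos).mul_right _) (norm_term_le hs one_pos c x)

theorem norm_powerSeriesSum_le {s r : ℝ} (hs : 0 < s) (hr : 0 < r) {c : MIdx d → ℂ}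
    (hc : SmallCoeff s c) (x : E d) :
    ‖powerSeriesSum c x‖ ≤ coeffNorm s r c * Real.exp (d * (s * (‖x‖ / r) ^ (1 / s))) := by
  rw [coeffNorm, ← tsum_mul_right]
  exact tsum_of_norm_bounded ((hc r hr).mul_right _).hasSum (norm_term_le hs hr c x)

theorem hasFDerivAt_mono (α : MIdx d) (x : E d) :
    HasFDerivAt (fun y : E d => (mono y α : ℂ))
      (∑ j, ((α j * mono x (α - Pi.single j 1) : ℝ) : ℂ) •
        (Complex.ofRealCLM.comp (EuclideanSpace.proj j : E d →L[ℝ] ℝ))) x := by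
  have h1 : HasFDerivAt (fun y : E d => mono y α)
      (∑ j, (α j * mono x (α - Pi.single j 1)) • (EuclideanSpace.proj j : E d →L[ℝ] ℝ)) x := by
    have h2 : ∀ i ∈ (Finset.univ : Finset (Fin d)), HasFDerivAt (fun y : E d => y i ^ α i)
        ((α i * x i ^ (α i - 1)) • (EuclideanSpace.proj i : E d →L[ℝ] ℝ)) x := by
      intro i _
      simpa using ((EuclideanSpace.proj i : E d →L[ℝ] ℝ).hasFDerivAt (x := x)).pow (α i)
    refine (HasFDerivAt.finsetProd h2).congr_fderiv ?_
    refine Finset.sum_congr rfl fun j _ => ?_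
    rw [smul_smul, mono, ← Finset.mul_prod_erase _ _ (Finset.mem_univ j)]
    have : ∏ i ∈ Finset.univ.erase j, x i ^ (α - Pi.single j 1 : MIdx d) i =
        ∏ i ∈ Finset.univ.erase j, x i ^ α i :=
      Finset.prod_congr rfl fun i hi => by simp [Finset.ne_of_mem_erase hi]
    rw [this]
    congr 1
    simp
    ring
  refine ((Complex.ofRealCLM.hasFDerivAt (x := mono x α)).comp x h1).congr_fderiv ?_
  ext v
  simp

/-- Termwise differentiation is justified by the summability of the shifted coefficients, which
gives a summable majorant for the derivative terms on a ball around the origin containing `x`. -/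
theorem hasFDerivAt_powerSeriesSum {s : ℝ} (hs : 1 < s) {c : MIdx d → ℂ} (hc : SmallCoeff s c)
    (x : E d) : HasFDerivAt (powerSeriesSum c)
      (∑ j, powerSeriesSum (shiftCoeff j c) x •
        (Complex.ofRealCLM.comp (EuclideanSpace.proj j : E d →L[ℝ] ℝ))) x := by
  have hs0 : 0 < s := by linarith
  set T : Fin d → (E d →L[ℝ] ℂ) := fun j =>
    Complex.ofRealCLM.comp (EuclideanSpace.proj j : E d →L[ℝ] ℝ) with hT
  have hTn : ∀ j, ‖T j‖ ≤ 1 := fun j => by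
    refine ContinuousLinearMap.opNorm_le_bound _ zero_le_one fun v => ?_
    simp only [hT, ContinuousLinearMap.comp_apply, Complex.ofRealCLM_apply, Complex.norm_real,
      one_mul]
    exact PiLp.norm_apply_le v j
  set a : Fin d → MIdx d → E d → ℂ := fun j α y =>
    c α * ((α j * mono y (α - Pi.single j 1) : ℝ) : ℂ) with ha
  have ha1 : ∀ j y α, a j (α + Pi.single j 1) y = shiftCoeff j c α * (mono y α : ℂ) := by
    intro j y α
    simp only [ha, shiftCoeff]
    have : α + Pi.single j 1 - Pi.single j 1 = α := by
      funext i; simp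
    rw [this]
    simp
    ring
  have ha0 : ∀ j y α, α ∉ Set.range (fun α : MIdx d => α + Pi.single j 1) → a j α y = 0 := by
    intro j y α hα
    have : α j = 0 := by
      by_contra hne
      refine hα ⟨α - Pi.single j 1, ?_⟩
      funext i
      by_cases hi : i = j
      · subst hi; simp; omega
      · simp [hi]
    simp [ha, this]
  have hasum : ∀ j y, HasSum (fun α => a j α y) (powerSeriesSum (shiftCoeff j c) y) := by
    intro j y
    have h1 : HasSum _ (powerSeriesSum (shiftCoeff j c) y) :=
      ((hc.shift hs j).summable hs0 y).hasSum
    -- The `j`-th derivative of a monomial vanishes unless the multi-index contains `j`, so the sum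
    -- may be reindexed along `α ↦ α + e_j`.
    rw [← (add_single_injective j).hasSum_iff (ha0 j y)]
    convert h1 using 1
    funext α
    exact ha1 j y α
  set R : ℝ := ‖x‖ + 1
  set M : ℝ := Real.exp (d * (s * (R / 1) ^ (1 / s)))
  have hb : ∀ j, ∃ b : MIdx d → ℝ, Summable b ∧ ∀ α, ∀ y ∈ Metric.ball (0 : E d) R,
      ‖a j α y‖ ≤ b α := by
    intro j
    -- The majorant is transported along the same shift and extended by zero to the multi-indices
    -- whose term vanishes.
    refine ⟨Function.extend (fun α : MIdx d => α + Pi.single j 1)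
      (fun α => ‖shiftCoeff j c α‖ * 1 ^ deg α * mfact α ^ s * M) 0, ?_, ?_⟩
    · rw [← (add_single_injective j).summable_iff]
      · refine ((hc.shift hs j 1 one_pos).mul_right M).congr fun α => ?_
        rw [Function.comp_apply, (add_single_injective j).extend_apply]
      · intro α hα
        exact Function.extend_apply' _ _ _ hα
    · intro α y hy
      by_cases hα : α ∈ Set.range (fun α : MIdx d => α + Pi.single j 1)
      · obtain ⟨α, rfl⟩ := hα
        rw [ha1, (add_single_injective j).extend_apply]
        refine (norm_term_le hs0 one_pos _ y α).trans ?_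
        refine mul_le_mul_of_nonneg_left ?_ (coeff_term_nonneg s one_pos _ α)
        have : ‖y‖ ≤ R := by simpa using (Metric.mem_ball.1 hy).le
        simp only [M]
        gcongr
      · rw [ha0 j y α hα, norm_zero, Function.extend_apply' _ _ _ hα]
        rfl
  choose b hbs hb using hb
  have hx : x ∈ Metric.ball (0 : E d) R := by simp [R]
  have main := hasFDerivAt_tsum_of_isPreconnected (𝕜 := ℝ) (u := fun α => ∑ j, b j α)
    (f := fun α y => c α * (mono y α : ℂ))
    (f' := fun α y => ∑ j, a j α y • T j) (x₀ := x) (x := x) (summable_sum fun j _ => hbs j)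
    Metric.isOpen_ball (convex_ball (0 : E d) R).isPreconnected
    (fun α y _ => by
      refine ((hasFDerivAt_mono α y).const_mul (c α)).congr_fderiv ?_
      rw [Finset.smul_sum]
      refine Finset.sum_congr rfl fun j _ => ?_
      rw [smul_smul])
    (fun α y hy => by
      refine (norm_sum_le _ _).trans (Finset.sum_le_sum fun j _ => ?_)
      rw [norm_smul]
      exact (mul_le_of_le_one_right (norm_nonneg _) (hTn j)).trans (hb j α y hy))
    hx (hc.summable hs0 x) hx
  refine main.congr_fderiv ?_
  exact (hasSum_sum fun j _ => (hasum j x).smul_const (T j)).tsum_eq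

theorem pderiv_powerSeriesSum {s : ℝ} (hs : 1 < s) {c : MIdx d → ℂ} (hc : SmallCoeff s c)
    (j : Fin d) : pderiv j (powerSeriesSum c) = powerSeriesSum (shiftCoeff j c) := by
  funext x
  rw [pderiv, (hasFDerivAt_powerSeriesSum hs hc x).fderiv, sum_apply,
    Finset.sum_eq_single j]
  · simp
  · intro i _ hi; simp [hi]
  · simp

theorem contDiff_powerSeriesSum {s : ℝ} (hs : 1 < s) {c : MIdx d → ℂ} (hc : SmallCoeff s c) :
    ContDiff ℝ ∞ (powerSeriesSum c) := by
  rw [contDiff_infty]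
  intro n
  induction n generalizing c with
  | zero =>
    exact contDiff_zero.2 (continuous_iff_continuousAt.2 fun x =>
      (hasFDerivAt_powerSeriesSum hs hc x).continuousAt)
  | succ n ih =>
    rw [Nat.cast_add, Nat.cast_one, contDiff_succ_iff_fderiv]
    refine ⟨fun x => (hasFDerivAt_powerSeriesSum hs hc x).differentiableAt, by simp, ?_⟩
    have : fderiv ℝ (powerSeriesSum c) = fun x => ∑ j, powerSeriesSum (shiftCoeff j c) x •
        (Complex.ofRealCLM.comp (EuclideanSpace.proj j : E d →L[ℝ] ℝ)) :=
      funext fun x => (hasFDerivAt_powerSeriesSum hs hc x).fderiv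
    rw [this]
    exact ContDiff.sum fun j _ => (ih (hc.shift hs j)).smul contDiff_const

/-- Every derivative divides the coefficient norm by `r`, and `r` is arbitrary: the derivatives grow
geometrically with any prescribed small ratio and without factorials. This is why no lower bound on
`t` is needed later. -/
theorem norm_mderiv_powerSeriesSum_le {s r : ℝ} (hs : 1 < s) (hr : 0 < r) (γ : MIdx d)
    {c : MIdx d → ℂ} (hc : SmallCoeff s c) (x : E d) :
    ‖mderiv γ (powerSeriesSum c) x‖ ≤
      r⁻¹ ^ deg γ * (coeffNorm s r c * Real.exp (d * (s * (‖x‖ / r) ^ (1 / s)))) := by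
  induction γ using MIdx.induction generalizing c with
  | h0 => simpa [mderiv_zero, deg_zero] using norm_powerSeriesSum_le (by linarith) hr hc x
  | h1 γ j ih =>
    rw [← mderiv_pderiv γ j (contDiff_powerSeriesSum hs hc), pderiv_powerSeriesSum hs hc,
      deg_add, deg_single, pow_add, pow_one]
    refine (ih (hc.shift hs j)).trans ?_
    rw [mul_assoc, ← mul_assoc r⁻¹]
    gcongr
    exact coeffNorm_shift_le hs hr hc j

/-- A large radius in the coefficient norm makes the exponential growth rate as small as desired. -/
theorem exists_radius (d : ℕ) {s ε : ℝ} (hs : 0 < s) (hε : 0 < ε) : ∃ R : ℝ, 1 ≤ R ∧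
    ∀ r, R ≤ r → ∀ y : ℝ, 0 ≤ y → d * (s * (y / r) ^ (1 / s)) ≤ ε * y ^ (1 / s) := by
  refine ⟨max 1 ((d * s / ε) ^ s), le_max_left _ _, fun r hr y hy => ?_⟩
  have h1 : 1 ≤ r := (le_max_left _ _).trans hr
  have h2 : (d * s / ε) ^ s ≤ r := (le_max_right _ _).trans hr
  have h3 : d * s / ε ≤ r ^ (1 / s) := by
    have := Real.rpow_le_rpow (by positivity) h2 (by positivity : 0 ≤ 1 / s)
    rwa [← Real.rpow_mul (by positivity), mul_one_div_cancel hs.ne', Real.rpow_one] at this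
  have h4 : 0 < r ^ (1 / s) := Real.rpow_pos_of_pos (by linarith) _
  rw [Real.div_rpow hy (by linarith)]
  have h5 : d * s ≤ ε * r ^ (1 / s) := by rwa [div_le_iff₀' hε] at h3
  have h6 : 0 ≤ y ^ (1 / s) := Real.rpow_nonneg hy _
  have e : d * (s * (y ^ (1 / s) / r ^ (1 / s))) = d * s * y ^ (1 / s) / r ^ (1 / s) := by ring
  rw [e, div_le_iff₀ h4]
  nlinarith

theorem SmallCoeff.subExpGrowth {s : ℝ} (hs : 1 < s) {c : MIdx d → ℂ} (hc : SmallCoeff s c) :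
    SubExpGrowth s (powerSeriesSum c) where
  continuous := (contDiff_powerSeriesSum hs hc).continuous
  bound ε hε := by
    have hs0 : 0 < s := by linarith
    obtain ⟨R, hR, h⟩ := exists_radius d hs0 hε
    have hR0 : 0 < R := by linarith
    refine ⟨coeffNorm s R c, coeffNorm_nonneg s hR0 c, fun x => ?_⟩
    refine (norm_powerSeriesSum_le hs0 hR0 hc x).trans ?_
    have := coeffNorm_nonneg s hR0 c
    have := h R le_rfl ‖x‖ (norm_nonneg x)
    gcongr

/-- Sum and integral are interchanged by absolute convergence: the terms grow at rate at most 1 for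
a suitable radius, while `ρ` decays at rate 2. -/
theorem hasSum_integral_powerSeriesSum {s : ℝ} (hs : 1 < s) {c : MIdx d → ℂ}
    (hc : SmallCoeff s c) {ρ : E d → ℂ} (hρ : SuperExpDecay s ρ) :
    HasSum (fun α => c α * ∫ x, (mono x α : ℂ) * ρ x) (∫ x, powerSeriesSum c x * ρ x) := by
  have hs0 : 0 < s := by linarith
  obtain ⟨R, hR, hR'⟩ := exists_radius d hs0 one_pos
  have hR0 : 0 < R := by linarith
  obtain ⟨C, hC0, hC⟩ := hρ.bound 2 (by norm_num)
  have hmono : ∀ α : MIdx d, Continuous fun x : E d => (mono x α : ℂ) := fun α => by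
    unfold mono; fun_prop
  have hbound : ∀ (α : MIdx d) x, ‖c α * (mono x α : ℂ) * ρ x‖ ≤
      ‖c α‖ * R ^ deg α * mfact α ^ s * (C * Real.exp (-1 * ‖x‖ ^ (1 / s))) := by
    intro α x
    rw [norm_mul]
    have h0 := coeff_term_nonneg s hR0 c α
    refine (mul_le_mul (norm_term_le hs0 hR0 c x α) (hC x) (norm_nonneg _) (by positivity)).trans ?_
    have h1 := hR' R le_rfl ‖x‖ (norm_nonneg x)
    rw [mul_assoc]
    refine mul_le_mul_of_nonneg_left ?_ h0
    rw [mul_left_comm, ← Real.exp_add]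
    gcongr
    linarith
  have hint : MeasureTheory.Integrable fun x : E d => C * Real.exp (-1 * ‖x‖ ^ (1 / s)) :=
    (integrable_exp_neg_rpow (by positivity) one_pos).const_mul C
  have hmeas : ∀ α, Continuous fun x => c α * (mono x α : ℂ) * ρ x := fun α =>
    (continuous_const.mul (hmono α)).mul hρ.continuous
  have key := MeasureTheory.hasSum_integral_of_summable_integral_norm
    (F := fun α x => c α * (mono x α : ℂ) * ρ x) (μ := MeasureTheory.volume)
    (fun α => (hint.const_mul (‖c α‖ * R ^ deg α * mfact α ^ s)).mono'
      (hmeas α).aestronglyMeasurable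
      (Filter.Eventually.of_forall (hbound α)))
    (by
      refine Summable.of_nonneg_of_le (fun α => MeasureTheory.integral_nonneg fun x => norm_nonneg _)
        (fun α => ?_) ((hc R hR0).mul_right (∫ x : E d, C * Real.exp (-1 * ‖x‖ ^ (1 / s))))
      rw [← MeasureTheory.integral_const_mul]
      exact MeasureTheory.integral_mono_of_nonneg
        (Filter.Eventually.of_forall fun x => norm_nonneg _)
        (hint.const_mul _) (Filter.Eventually.of_forall (hbound α)))
  simp_rw [tsum_mul_right, mul_assoc, MeasureTheory.integral_const_mul] at key
  simpa [powerSeriesSum, mul_assoc] using key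

/-! ### The Fourier transform with symmetric normalization -/

open MeasureTheory FourierTransform

/-- The normalizing constant `(2π) ^ (-d/2)`. -/
def fourierConst (d : ℕ) : ℝ := (2 * Real.pi) ^ (-(d : ℝ) / 2)

theorem fourierConst_pos (d : ℕ) : 0 < fourierConst d :=
  Real.rpow_pos_of_pos (by positivity) _

theorem fourierConst_le_one (d : ℕ) : fourierConst d ≤ 1 := by
  refine Real.rpow_le_one_of_one_le_of_nonpos ?_ ?_
  · linarith [Real.pi_gt_three]
  · have : (0 : ℝ) ≤ d := Nat.cast_nonneg _
    linarith

theorem fourierConst_mul_self (d : ℕ) :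
    fourierConst d * fourierConst d = ((2 * Real.pi) ^ d)⁻¹ := by
  rw [fourierConst, ← Real.rpow_add (by positivity), ← Real.rpow_natCast,
    ← Real.rpow_neg (by positivity)]
  congr 1
  ring

theorem fourier_def (φ : E d → ℂ) (ξ : E d) : fourier φ ξ =
    (fourierConst d : ℂ) * ∫ x, φ x * Complex.exp (-Complex.I * ((inner ℝ x ξ : ℝ) : ℂ)) := rfl

theorem fourier_eq_scaled (φ : E d → ℂ) (ξ : E d) :
    fourier φ ξ = (fourierConst d : ℂ) * 𝓕 φ ((2 * Real.pi)⁻¹ • ξ) := by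
  rw [fourier_def, Real.fourier_eq']
  congr 2
  funext x
  rw [smul_eq_mul, mul_comm, inner_smul_right]
  congr 2
  have : (Real.pi : ℂ) ≠ 0 := by exact_mod_cast Real.pi_ne_zero
  push_cast
  field_simp

theorem continuous_fourier {φ : E d → ℂ} (hφ : Integrable φ) : Continuous (fourier φ) := by
  have h : Continuous (𝓕 φ) :=
    VectorFourier.fourierIntegral_continuous Real.continuous_fourierChar
      (L := innerₗ (E d)) continuous_inner hφ
  have e : fourier φ = fun ξ => (fourierConst d : ℂ) * 𝓕 φ ((2 * Real.pi)⁻¹ • ξ) :=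
    funext (fourier_eq_scaled φ)
  rw [e]
  exact continuous_const.mul (h.comp (continuous_const_smul _))

theorem norm_exp_neg_I_mul (a : ℝ) : ‖Complex.exp (-Complex.I * (a : ℂ))‖ = 1 := by
  rw [show -Complex.I * (a : ℂ) = ((-a : ℝ) : ℂ) * Complex.I by push_cast; ring,
    Complex.norm_exp_ofReal_mul_I]

theorem norm_exp_I_mul (a : ℝ) : ‖Complex.exp (Complex.I * (a : ℂ))‖ = 1 := by
  rw [mul_comm, Complex.norm_exp_ofReal_mul_I]

theorem norm_fourier_le_integral (φ : E d → ℂ) (ξ : E d) : ‖fourier φ ξ‖ ≤ ∫ x, ‖φ x‖ := by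
  rw [fourier_def, norm_mul, Complex.norm_real, Real.norm_of_nonneg (fourierConst_pos d).le]
  have h1 : ‖∫ x, φ x * Complex.exp (-Complex.I * ((inner ℝ x ξ : ℝ) : ℂ))‖ ≤ ∫ x, ‖φ x‖ := by
    refine (norm_integral_le_integral_norm _).trans (le_of_eq ?_)
    congr 1
    funext x
    rw [norm_mul, norm_exp_neg_I_mul, mul_one]
  exact (mul_le_of_le_one_left (norm_nonneg _) (fourierConst_le_one d)).trans h1

theorem fourier_inversion {φ : E d → ℂ} (hc : Continuous φ) (hφ : Integrable φ)
    (hF : Integrable (fourier φ)) (y : E d) :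
    φ y = (fourierConst d : ℂ) *
      ∫ ξ, fourier φ ξ * Complex.exp (Complex.I * ((inner ℝ ξ y : ℝ) : ℂ)) := by
  have hκ : (fourierConst d : ℂ) ≠ 0 := by exact_mod_cast (fourierConst_pos d).ne'
  have h2π : (2 * Real.pi) ≠ 0 := by positivity
  have e : fourier φ = fun ξ => (fourierConst d : ℂ) * 𝓕 φ ((2 * Real.pi)⁻¹ • ξ) :=
    funext (fourier_eq_scaled φ)
  have hF' : Integrable (𝓕 φ) := by
    rw [e] at hF
    have h1 : Integrable (fun ξ => 𝓕 φ ((2 * Real.pi)⁻¹ • ξ)) := by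
      refine (hF.const_mul (fourierConst d : ℂ)⁻¹).congr (Filter.Eventually.of_forall fun ξ => ?_)
      simp only []
      rw [inv_mul_cancel_left₀ hκ]
    exact (integrable_comp_smul_iff volume (𝓕 φ) (inv_ne_zero h2π)).1 h1
  have h1 : 𝓕⁻ (𝓕 φ) y = φ y := congrFun (hc.fourierInv_fourier_eq hφ hF') y
  rw [Real.fourierInv_eq'] at h1
  set g : E d → ℂ := fun ξ => 𝓕 φ ((2 * Real.pi)⁻¹ • ξ) *
    Complex.exp (Complex.I * ((inner ℝ ξ y : ℝ) : ℂ)) with hg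
  have h2 : ∫ w, g ((2 * Real.pi) • w) = φ y := by
    rw [← h1]
    congr 1
    funext w
    simp only [hg]
    rw [smul_smul, inv_mul_cancel₀ h2π, one_smul, smul_eq_mul, mul_comm, inner_smul_left]
    congr 2
    push_cast
    simp
    ring
  -- The dilation by `2π` contributes `(2π) ^ (-d)`, which is the square of the normalizing
  -- constant: one factor belongs to the inversion formula and one to `fourier φ`.
  rw [Measure.integral_comp_smul_of_nonneg _ _ _ (hR := by positivity), finrank_euclideanSpace,
    Fintype.card_fin, ← fourierConst_mul_self] at h2
  rw [← h2, e, Complex.real_smul, Complex.ofReal_mul, mul_assoc, ← integral_const_mul]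
  congr 2
  funext ξ
  simp only [hg]
  ring

/-- Fourier inversion as a pointwise estimate. With `N = 0` it also gives injectivity of the Fourier
transform. -/
theorem norm_le_integral_of_fourier_le {φ : E d → ℂ} (hc : Continuous φ) (hφ : Integrable φ)
    {N : E d → ℝ} (hN : Integrable N) (h : ∀ ξ, ‖fourier φ ξ‖ ≤ N ξ) (y : E d) :
    ‖φ y‖ ≤ ∫ ξ, N ξ := by
  have hF : Integrable (fourier φ) :=
    hN.mono' (continuous_fourier hφ).aestronglyMeasurable (Filter.Eventually.of_forall h)
  rw [fourier_inversion hc hφ hF y, norm_mul, Complex.norm_real,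
    Real.norm_of_nonneg (fourierConst_pos d).le]
  refine (mul_le_of_le_one_left (norm_nonneg _) (fourierConst_le_one d)).trans ?_
  refine norm_integral_le_of_norm_le hN (Filter.Eventually.of_forall fun ξ => ?_)
  rw [norm_mul, norm_exp_I_mul, mul_one]
  exact h ξ

theorem pderiv_exp_neg (ξ : E d) (j : Fin d) (x : E d) :
    DifferentiableAt ℝ (fun y : E d => Complex.exp (-Complex.I * ((inner ℝ y ξ : ℝ) : ℂ))) x ∧
    fderiv ℝ (fun y : E d => Complex.exp (-Complex.I * ((inner ℝ y ξ : ℝ) : ℂ))) x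
      (EuclideanSpace.single j 1) =
      -Complex.I * (ξ j : ℂ) * Complex.exp (-Complex.I * ((inner ℝ x ξ : ℝ) : ℂ)) := by
  have h0 : HasFDerivAt (fun y : E d => (inner ℝ y ξ : ℝ)) (innerSL ℝ ξ) x := by
    have : (fun y : E d => (inner ℝ y ξ : ℝ)) = fun y => innerSL ℝ ξ y := by
      funext y
      simp [real_inner_comm]
    rw [this]
    exact (innerSL ℝ ξ).hasFDerivAt
  have h1 : HasFDerivAt (fun y : E d => ((inner ℝ y ξ : ℝ) : ℂ))
      (Complex.ofRealCLM.comp (innerSL ℝ ξ)) x := Complex.ofRealCLM.hasFDerivAt.comp x h0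
  have h2 := (h1.const_mul (-Complex.I)).cexp
  refine ⟨h2.differentiableAt, ?_⟩
  rw [h2.fderiv]
  simp [EuclideanSpace.inner_single_right]
  ring

theorem integrable_mul_exp_neg {f : E d → ℂ} (hf : Integrable f) (ξ : E d) :
    Integrable fun x => f x * Complex.exp (-Complex.I * ((inner ℝ x ξ : ℝ) : ℂ)) := by
  refine hf.mul_bdd (c := 1) ?_ (Filter.Eventually.of_forall fun x => (norm_exp_neg_I_mul _).le)
  have : Continuous fun x : E d => Complex.exp (-Complex.I * ((inner ℝ x ξ : ℝ) : ℂ)) := by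
    fun_prop
  exact this.aestronglyMeasurable

theorem fourier_pderiv (j : Fin d) {f : E d → ℂ} (hf : ContDiff ℝ ∞ f) (h0 : Integrable f)
    (h1 : Integrable (pderiv j f)) (ξ : E d) :
    fourier (pderiv j f) ξ = Complex.I * (ξ j : ℂ) * fourier f ξ := by
  have key := integral_mul_fderiv_eq_neg_fderiv_mul_of_integrable (μ := (volume : Measure (E d)))
    (f := f) (g := fun y : E d => Complex.exp (-Complex.I * ((inner ℝ y ξ : ℝ) : ℂ)))
    (v := EuclideanSpace.single j 1) (integrable_mul_exp_neg h1 ξ)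
    (by
      simp_rw [(pderiv_exp_neg ξ j _).2]
      convert (integrable_mul_exp_neg h0 ξ).const_mul (-Complex.I * (ξ j : ℂ)) using 2
      ring)
    (integrable_mul_exp_neg h0 ξ)
    (fun x _ => hf.differentiable (by simp) x) (fun x _ => (pderiv_exp_neg ξ j x).1)
  simp_rw [(pderiv_exp_neg ξ j _).2] at key
  rw [fourier_def, fourier_def]
  have e1 : ∫ x, pderiv j f x * Complex.exp (-Complex.I * ((inner ℝ x ξ : ℝ) : ℂ)) =
      -∫ x, f x * (-Complex.I * (ξ j : ℂ) * Complex.exp (-Complex.I * ((inner ℝ x ξ : ℝ) : ℂ))) := by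
    rw [key, neg_neg]
    rfl
  rw [e1]
  have e2 : ∀ x, f x * (-Complex.I * (ξ j : ℂ) *
      Complex.exp (-Complex.I * ((inner ℝ x ξ : ℝ) : ℂ))) = (-Complex.I * (ξ j : ℂ)) *
      (f x * Complex.exp (-Complex.I * ((inner ℝ x ξ : ℝ) : ℂ))) := fun x => by ring
  simp_rw [e2, integral_const_mul]
  ring

theorem fourier_mderiv (β : MIdx d) {f : E d → ℂ} (hf : ContDiff ℝ ∞ f)
    (hi : ∀ γ, Integrable (mderiv γ f)) (ξ : E d) :
    fourier (mderiv β f) ξ = Complex.I ^ deg β * (mono ξ β : ℂ) * fourier f ξ := by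
  induction β using MIdx.induction generalizing f with
  | h0 => simp [mderiv_zero, deg_zero, mono_zero]
  | h1 γ j ih =>
    rw [← mderiv_pderiv γ j hf, ih (contDiff_pderiv j hf) fun δ => by
      rw [mderiv_pderiv δ j hf]; exact hi _]
    have h0 := hi 0
    have h1 := hi (0 + Pi.single j 1)
    rw [← mderiv_pderiv 0 j hf, mderiv_zero] at h1
    rw [mderiv_zero] at h0
    rw [fourier_pderiv j hf h0 h1, deg_add, deg_single, mono_add, mono_single]
    push_cast
    ring

/-- Bounds for all derivatives of a function give decay of its Fourier transform. -/
theorem exists_norm_fourier_le (d : ℕ) {s r : ℝ} (hs : 0 < s) (hr : 0 < r) :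
    ∃ h > 0, ∃ K > 0, ∀ (g : E d → ℂ) (A : ℝ) (w : E d → ℝ), ContDiff ℝ ∞ g → 0 ≤ A →
      Integrable w → (∀ x, 0 ≤ w x) →
      (∀ β x, ‖mderiv β g x‖ ≤ A * (h ^ deg β * mfact β ^ s) * w x) →
      ∀ ξ, ‖fourier g ξ‖ ≤ K * (A * ∫ x, w x) * Real.exp (-r * ‖ξ‖ ^ (1 / s)) := by
  obtain ⟨h, hh, K, hK, H⟩ := exists_le_exp_of_mono_bound d hs hr
  refine ⟨h, hh, K, hK, fun g A w hg hA hw hw0 hb ξ => ?_⟩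
  have hi : ∀ γ, Integrable (mderiv γ g) := fun γ =>
    (hw.const_mul (A * (h ^ deg γ * mfact γ ^ s))).mono'
      (contDiff_mderiv γ hg).continuous.aestronglyMeasurable (Filter.Eventually.of_forall (hb γ))
  refine H ξ _ _ (norm_nonneg _) (mul_nonneg hA (integral_nonneg hw0)) fun α => ?_
  -- Monomials times the transform are transforms of derivatives, so the bounds on the derivatives
  -- become the moment bounds required by `H`.
  have e : |mono ξ α| * ‖fourier g ξ‖ = ‖fourier (mderiv α g) ξ‖ := by
    rw [fourier_mderiv α hg hi, norm_mul, norm_mul, norm_pow, Complex.norm_I, one_pow, one_mul,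
      Complex.norm_real, Real.norm_eq_abs]
  rw [e]
  refine (norm_fourier_le_integral _ ξ).trans ?_
  have : A * (∫ x, w x) * (h ^ deg α * mfact α ^ s) =
      ∫ x, A * (h ^ deg α * mfact α ^ s) * w x := by
    rw [integral_const_mul]; ring
  rw [this]
  exact integral_mono (hi α).norm (hw.const_mul _) (hb α)

/-! ### Decay of test functions and of their Fourier transforms -/

theorem GS.contDiff {t s : ℝ} (φ : GS d t s) : ContDiff ℝ ∞ φ.fn := φ.2.1

/-- The scale `h` for the derivatives and the decay rate `r` can be chosen independently: `r`
dictates a scale for the monomials, and the defining estimate is applied at the smaller of the two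
scales. -/
theorem GS.mderiv_decay {t s : ℝ} (ht : 0 < t) (φ : GS d t s) {h r : ℝ} (hh : 0 < h)
    (hr : 0 < r) : ∃ C, 0 ≤ C ∧ ∀ β x, ‖mderiv β φ.fn x‖ ≤
      C * (h ^ deg β * mfact β ^ s) * Real.exp (-r * ‖x‖ ^ (1 / t)) := by
  obtain ⟨h₀, hh₀, K, hK, H⟩ := exists_le_exp_of_mono_bound d ht hr
  have hm : 0 < min h h₀ := lt_min hh hh₀
  obtain ⟨C, hC⟩ := φ.2.2 (min h h₀) hm
  refine ⟨K * |C|, by positivity, fun β x => ?_⟩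
  have hβ := Real.rpow_nonneg (mfact_pos β).le s
  have := H x (‖mderiv β φ.fn x‖) (|C| * (h ^ deg β * mfact β ^ s)) (norm_nonneg _)
    (by positivity) fun α => by
      have hα := Real.rpow_nonneg (mfact_pos α).le t
      refine (hC α β x).trans ?_
      rw [gsWeight, deg_add, pow_add]
      calc C * (min h h₀ ^ deg α * min h h₀ ^ deg β * mfact α ^ t * mfact β ^ s)
          ≤ |C| * (h₀ ^ deg α * h ^ deg β * mfact α ^ t * mfact β ^ s) := by
            gcongr
            · exact le_abs_self C
            · exact min_le_right _ _
            · exact min_le_left _ _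
        _ = _ := by ring
  refine this.trans (le_of_eq ?_)
  ring

theorem GS.superExpDecay {t s : ℝ} (ht : 0 < t) (φ : GS d t s) : SuperExpDecay t φ.fn where
  continuous := φ.contDiff.continuous
  bound r hr := by
    obtain ⟨C, hC, h⟩ := φ.mderiv_decay ht one_pos hr
    refine ⟨C, hC, fun x => ?_⟩
    simpa [mderiv_zero, deg_zero, mfact_zero] using h 0 x

theorem GS.integrable_mderiv {t s : ℝ} (ht : 0 < t) (φ : GS d t s) (β : MIdx d) :
    Integrable (mderiv β φ.fn) := by
  obtain ⟨C, hC, h⟩ := φ.mderiv_decay ht one_pos one_pos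
  exact ((integrable_exp_neg_rpow (by positivity) one_pos).const_mul _).mono'
    (contDiff_mderiv β φ.contDiff).continuous.aestronglyMeasurable
    (Filter.Eventually.of_forall (h β))

theorem GS.superExpDecay_fourier {t s : ℝ} (ht : 0 < t) (hs : 0 < s) (φ : GS d t s) :
    SuperExpDecay s (fourier φ.fn) where
  continuous := continuous_fourier ((φ.superExpDecay ht).integrable ht)
  bound r hr := by
    obtain ⟨h, hh, K, hK, H⟩ := exists_norm_fourier_le d hs hr
    obtain ⟨C, hC, hb⟩ := φ.mderiv_decay ht hh one_pos
    have hw := integrable_exp_neg_rpow (d := d) (by positivity : 0 < 1 / t) one_pos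
    refine ⟨_, ?_, H φ.fn C _ φ.contDiff hC hw (fun x => (Real.exp_pos _).le) hb⟩
    have : 0 ≤ ∫ x : E d, Real.exp (-1 * ‖x‖ ^ (1 / t)) :=
      integral_nonneg fun x => (Real.exp_pos _).le
    positivity

theorem fourier_modulate_translate (x ξ η : E d) (φ : E d → ℂ) :
    fourier (modulate ξ (translate x φ)) η =
      Complex.exp (-Complex.I * ((inner ℝ x (η - ξ) : ℝ) : ℂ)) * fourier φ (η - ξ) := by
  rw [fourier_def, fourier_def, mul_left_comm]
  congr 1
  rw [← integral_const_mul, ← integral_add_right_eq_self _ x]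
  congr 1
  funext y
  simp only [modulate, translate, add_sub_cancel_right]
  rw [mul_right_comm, ← Complex.exp_add, mul_comm (φ y), ← mul_assoc, ← Complex.exp_add]
  congr 2
  simp only [inner_add_left, inner_sub_right]
  push_cast
  ring

/-! ### The Dirac series and the function as ultradistributions -/

theorem GS.le_seminorm {t s : ℝ} (φ : GS d t s) (h : Set.Ioi (0 : ℝ)) (α β : MIdx d) (x : E d) :
    |mono x α| * ‖mderiv β φ.fn x‖ ≤ gsSeminorm d t s h φ * gsWeight t s h α β := by
  have h1 : gsQuot t s h φ.fn (α, β, x) ≤ gsSeminorm d t s h φ := le_ciSup (φ.bddAbove h.2) _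
  exact (div_le_iff₀ (gsWeight_pos t s h.2 _ _)).1 h1

theorem GS.ext_fn {t s : ℝ} {φ ψ : GS d t s} (h : φ.fn = ψ.fn) : φ = ψ := Subtype.ext h

/-- A conjugate linear functional bounded by one of the Gelfand-Shilov norms is an
ultradistribution. -/
def dualOfBound {t s : ℝ} (L : GS d t s →ₛₗ[starRingEnd ℂ] ℂ)
    (hL : ∃ (h : Set.Ioi (0 : ℝ)) (C : ℝ), 0 ≤ C ∧ ∀ φ, ‖L φ‖ ≤ C * gsSeminorm d t s h φ) :
    GSDual d t s where
  toLinearMap := L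
  cont := by
    obtain ⟨h, C, hC, H⟩ := hL
    refine WithSeminorms.continuous_normedSpace_rng ℂ (gs_withSeminorms d t s) L
      ⟨{h}, ⟨C, hC⟩, fun φ => ?_⟩
    rw [Finset.sup_singleton]
    exact H φ

theorem norm_Dop (α : MIdx d) (f : E d → ℂ) (x : E d) : ‖Dop α f x‖ = ‖mderiv α f x‖ := by
  simp [Dop]

theorem norm_dirac_term_le {t s : ℝ} (c : MIdx d → ℂ) (φ : GS d t s) (α : MIdx d) :
    ‖c α * starRingEnd ℂ (Dop α φ.fn 0)‖ ≤
      ‖c α‖ * 1 ^ deg α * mfact α ^ s * gsSeminorm d t s ⟨1, Set.mem_Ioi.2 one_pos⟩ φ := by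
  rw [norm_mul, RCLike.norm_conj, norm_Dop]
  have h1 := φ.le_seminorm ⟨1, Set.mem_Ioi.2 one_pos⟩ 0 α 0
  rw [mono_zero, abs_one, one_mul] at h1
  have e : gsWeight t s 1 (0 : MIdx d) α = mfact α ^ s := by
    simp [gsWeight, mfact_zero]
  rw [e] at h1
  rw [one_pow, mul_one, mul_assoc, mul_comm (mfact α ^ s)]
  exact mul_le_mul_of_nonneg_left h1 (norm_nonneg _)

theorem summable_dirac {t s : ℝ} {c : MIdx d → ℂ} (hc : SmallCoeff s c) (φ : GS d t s) :
    Summable fun α => c α * starRingEnd ℂ (Dop α φ.fn 0) :=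
  Summable.of_norm_bounded ((hc 1 one_pos).mul_right _) (norm_dirac_term_le c φ)

/-- The ultradistribution `∑ c_α D ^ α δ₀`. -/
def diracSeries {s : ℝ} (t : ℝ) {c : MIdx d → ℂ} (hc : SmallCoeff s c) : GSDual d t s :=
  dualOfBound
    { toFun := fun φ => ∑' α, c α * starRingEnd ℂ (Dop α φ.fn 0)
      map_add' := fun φ ψ => by
        rw [← (summable_dirac hc φ).tsum_add (summable_dirac hc ψ)]
        congr 1
        funext α
        have : mderiv α (φ + ψ).fn = mderiv α φ.fn + mderiv α ψ.fn :=
          mderiv_add α φ.2.1 ψ.2.1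
        simp only [Dop, this, Pi.add_apply, mul_add, map_add]
      map_smul' := fun a φ => by
        rw [smul_eq_mul, ← tsum_mul_left]
        congr 1
        funext α
        have : mderiv α (a • φ).fn = a • mderiv α φ.fn := mderiv_smul α a φ.2.1
        simp only [Dop, this, Pi.smul_apply, smul_eq_mul, map_mul]
        ring }
    ⟨⟨1, Set.mem_Ioi.2 one_pos⟩, coeffNorm s 1 c, coeffNorm_nonneg s one_pos c, fun φ => by
      rw [coeffNorm, ← tsum_mul_right]
      exact tsum_of_norm_bounded ((hc 1 one_pos).mul_right _).hasSum (norm_dirac_term_le c φ)⟩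

theorem isDiracSeries_diracSeries {s : ℝ} (t : ℝ) {c : MIdx d → ℂ} (hc : SmallCoeff s c) :
    IsDiracSeries c (diracSeries t hc) := fun φ => (summable_dirac hc φ).hasSum

theorem exists_norm_fn_le (d : ℕ) {s r : ℝ} (t : ℝ) (hs : 0 < s) (hr : 0 < r) :
    ∃ (h : Set.Ioi (0 : ℝ)) (K : ℝ), 0 ≤ K ∧ ∀ (φ : GS d s t) (x : E d),
      ‖φ.fn x‖ ≤ K * gsSeminorm d s t h φ * Real.exp (-r * ‖x‖ ^ (1 / s)) := by
  obtain ⟨h, hh, K, hK, H⟩ := exists_le_exp_of_mono_bound d hs hr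
  refine ⟨⟨h, hh⟩, K, hK.le, fun φ x => H x _ _ (norm_nonneg _) (apply_nonneg _ _) fun α => ?_⟩
  have h1 := φ.le_seminorm ⟨h, hh⟩ α 0 x
  rw [mderiv_zero] at h1
  simpa [gsWeight, mfact_zero] using h1

theorem integrable_mul_conj {s t : ℝ} (hs : 0 < s) {f : E d → ℂ} (hf : SubExpGrowth s f)
    (φ : GS d s t) : Integrable fun x => f x * starRingEnd ℂ (φ.fn x) :=
  (hf.mul_decay (φ.superExpDecay hs).conj).integrable hs

/-- The ultradistribution given by a function of subexponential growth. -/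
def functionDual {s : ℝ} (t : ℝ) (hs : 0 < s) {f : E d → ℂ} (hf : SubExpGrowth s f) :
    GSDual d s t :=
  dualOfBound
    { toFun := fun φ => ∫ x, f x * starRingEnd ℂ (φ.fn x)
      map_add' := fun φ ψ => by
        rw [← integral_add (integrable_mul_conj hs hf φ) (integrable_mul_conj hs hf ψ)]
        congr 1
        funext x
        change f x * starRingEnd ℂ (φ.fn x + ψ.fn x) = _
        rw [map_add, mul_add]
      map_smul' := fun a φ => by
        rw [smul_eq_mul, ← integral_const_mul]
        congr 1
        funext x
        change f x * starRingEnd ℂ (a * φ.fn x) = _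
        rw [map_mul]
        ring }
    (by
      obtain ⟨h, K, hK, H⟩ := exists_norm_fn_le d t hs (r := 2) (by norm_num)
      obtain ⟨A, hA, hA'⟩ := hf.bound 1 one_pos
      have hI : Integrable fun x : E d => Real.exp (-1 * ‖x‖ ^ (1 / s)) :=
        integrable_exp_neg_rpow (by positivity) one_pos
      have hI0 : 0 ≤ ∫ x : E d, Real.exp (-1 * ‖x‖ ^ (1 / s)) :=
        integral_nonneg fun x => (Real.exp_pos _).le
      refine ⟨h, A * K * ∫ x : E d, Real.exp (-1 * ‖x‖ ^ (1 / s)), by positivity, fun φ => ?_⟩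
      have e : A * K * (∫ x : E d, Real.exp (-1 * ‖x‖ ^ (1 / s))) * gsSeminorm d s t h φ =
          ∫ x : E d, A * K * gsSeminorm d s t h φ * Real.exp (-1 * ‖x‖ ^ (1 / s)) := by
        rw [integral_const_mul]; ring
      rw [e]
      refine norm_integral_le_of_norm_le (hI.const_mul _) (Filter.Eventually.of_forall fun x => ?_)
      rw [norm_mul, RCLike.norm_conj]
      refine (mul_le_mul (hA' x) (H φ x) (norm_nonneg _) (by positivity)).trans (le_of_eq ?_)
      have : Real.exp (-1 * ‖x‖ ^ (1 / s)) =
          Real.exp (1 * ‖x‖ ^ (1 / s)) * Real.exp (-2 * ‖x‖ ^ (1 / s)) := by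
        rw [← Real.exp_add]; ring_nf
      rw [this]
      ring)

theorem isFunction_functionDual {s : ℝ} (t : ℝ) (hs : 0 < s) {f : E d → ℂ}
    (hf : SubExpGrowth s f) : IsFunction (functionDual t hs hf) f :=
  fun φ => ⟨integrable_mul_conj hs hf φ, rfl⟩

theorem isPowerSeries_of_isFunction {s t : ℝ} (hs : 1 < s) {c : MIdx d → ℂ} (hc : SmallCoeff s c)
    {F : GSDual d s t} (hF : IsFunction F (powerSeriesSum c)) : IsPowerSeries c F := fun φ => by
  rw [(hF φ).2]
  exact hasSum_integral_powerSeriesSum hs hc (φ.superExpDecay (by linarith)).conj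

/-! ### The Fourier transform of the Dirac series -/

theorem SuperExpDecay.mono_mul {s : ℝ} (hs : 0 < s) {ρ : E d → ℂ} (hρ : SuperExpDecay s ρ)
    (α : MIdx d) : SuperExpDecay s fun x => (mono x α : ℂ) * ρ x := by
  have hc : Continuous fun x : E d => (mono x α : ℂ) := by unfold mono; fun_prop
  have hm : SubExpGrowth s fun x : E d => (mono x α : ℂ) := by
    refine ⟨hc, fun ε hε => ?_⟩
    obtain ⟨R, hR, h⟩ := exists_radius d hs hε
    have hR0 : 0 < R := by linarith
    have := Real.rpow_nonneg (mfact_pos α).le s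
    refine ⟨R ^ deg α * mfact α ^ s, by positivity, fun x => ?_⟩
    rw [Complex.norm_real, Real.norm_eq_abs]
    refine (abs_mono_le hs hR0 x α).trans ?_
    have := h R le_rfl ‖x‖ (norm_nonneg x)
    gcongr
  exact hm.mul_decay hρ

/-- Fourier inversion at the origin for the derivative of `φ`; the powers of `i` and `-i` cancel. -/
theorem GS.Dop_zero_eq_integral {t s : ℝ} (ht : 0 < t) (hs : 0 < s) (φ : GS d t s) (α : MIdx d) :
    Dop α φ.fn 0 = (fourierConst d : ℂ) * ∫ ξ, (mono ξ α : ℂ) * fourier φ.fn ξ := by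
  have hF : ∀ ξ, fourier (mderiv α φ.fn) ξ =
      Complex.I ^ deg α * ((mono ξ α : ℂ) * fourier φ.fn ξ) := fun ξ => by
    rw [fourier_mderiv α φ.contDiff (φ.integrable_mderiv ht), mul_assoc]
  have hI : Integrable (fourier (mderiv α φ.fn)) := by
    rw [show fourier (mderiv α φ.fn) = _ from funext hF]
    exact (((φ.superExpDecay_fourier ht hs).mono_mul hs α).integrable hs).const_mul _
  rw [Dop, fourier_inversion (contDiff_mderiv α φ.contDiff).continuous
    (φ.integrable_mderiv ht α) hI]
  simp_rw [hF, inner_zero_right, Complex.ofReal_zero, mul_zero, Complex.exp_zero, mul_one,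
    integral_const_mul]
  rw [mul_left_comm, ← mul_assoc ((-Complex.I) ^ deg α), ← mul_pow]
  simp

/-- The Fourier transform of `∑ c_α D ^ α δ₀` is `(2π) ^ (-d/2) ∑ c_α ξ ^ α`. -/
theorem hasFourier_of_isDiracSeries {t s : ℝ} (ht : 0 < t) (hs : 1 < s) {c : MIdx d → ℂ}
    (hc : SmallCoeff s c) {u : GSDual d t s} (hu : IsDiracSeries c u) :
    HasFourier u (fun ξ => (fourierConst d : ℂ) * powerSeriesSum c ξ) := by
  have hs0 : 0 < s := by linarith
  have hf := hc.subExpGrowth hs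
  refine ⟨continuous_const.mul hf.continuous, fun φ => ?_⟩
  have hφ := (φ.superExpDecay_fourier ht hs0).conj
  simp_rw [mul_assoc]
  refine ⟨((hf.mul_decay hφ).integrable hs0).const_mul _, (hu φ).unique ?_⟩
  have h1 := (hasSum_integral_powerSeriesSum hs hc hφ).mul_left (fourierConst d : ℂ)
  rw [integral_const_mul]
  have e : ∀ α, c α * starRingEnd ℂ (Dop α φ.fn 0) = (fourierConst d : ℂ) *
      (c α * ∫ ξ, (mono ξ α : ℂ) * starRingEnd ℂ (fourier φ.fn ξ)) := fun α => by
    rw [φ.Dop_zero_eq_integral ht hs0, map_mul, Complex.conj_ofReal, ← integral_conj]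
    simp only [map_mul, Complex.conj_ofReal]
    ring
  simp_rw [e]
  exact h1

/-- The transform of a time-frequency shift is a translate of the transform times a character.
Integrating `g` against it gives a windowed Fourier transform of `g` in which position and frequency
have changed places. -/
theorem pairing_tfShift (g φ : E d → ℂ) (x ξ : E d) :
    (fourierConst d : ℂ) * ∫ η, g η * starRingEnd ℂ (fourier (modulate ξ (translate x φ)) η) =
      Complex.exp (-Complex.I * ((inner ℝ x ξ : ℝ) : ℂ)) *
        fourier (fun η => g η * starRingEnd ℂ (fourier φ (η - ξ))) (-x) := by
  rw [fourier_def, mul_left_comm]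
  congr 1
  rw [← integral_const_mul]
  congr 1
  funext η
  rw [fourier_modulate_translate, map_mul, ← Complex.exp_conj]
  have e : starRingEnd ℂ (-Complex.I * ((inner ℝ x (η - ξ) : ℝ) : ℂ)) =
      -Complex.I * ((inner ℝ x ξ : ℝ) : ℂ) + -Complex.I * ((inner ℝ η (-x) : ℝ) : ℂ) := by
    simp [inner_sub_right, real_inner_comm]
    ring
  rw [e, Complex.exp_add]
  ring

/-! ### Uniqueness of the function representing û -/

theorem GS.fourier_ne_zero {t s : ℝ} (ht : 0 < t) {ψ : GS d t s} (hψ : ψ ≠ 0) :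
    ∃ η, fourier ψ.fn η ≠ 0 := by
  by_contra! H
  refine hψ (GS.ext_fn (funext fun y => ?_))
  have h1 := norm_le_integral_of_fourier_le (N := 0) ψ.contDiff.continuous
    ((ψ.superExpDecay ht).integrable ht) (integrable_zero _ _ _) (fun ξ => by simp [H ξ]) y
  have : ψ.fn y = 0 := norm_le_zero_iff.1 (by simpa using h1)
  exact this

/-- Pairing with all time-frequency shifts of one nonzero test function shows that `g₁ - g₂`,
multiplied by any translate of the transformed window, has vanishing Fourier transform. -/
theorem HasFourier.unique_of_ne_zero {t s : ℝ} (ht : 0 < t) (hs : 0 < s) {ψ : GS d t s}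
    (hψ : ψ ≠ 0) {u : GSDual d t s} {g₁ g₂ : E d → ℂ} (h₁ : HasFourier u g₁)
    (h₂ : HasFourier u g₂) : g₁ = g₂ := by
  obtain ⟨η₀, hη₀⟩ := ψ.fourier_ne_zero ht hψ
  have hcF := continuous_fourier ((ψ.superExpDecay ht).integrable ht)
  funext η
  -- This translate moves a point where the transformed window is nonzero to the given `η`.
  set ξ := η - η₀ with hξ
  set k : E d → ℂ := fun ζ => (g₁ ζ - g₂ ζ) * starRingEnd ℂ (fourier ψ.fn (ζ - ξ)) with hk
  have hkc : Continuous k :=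
    (h₁.1.sub h₂.1).mul (Complex.continuous_conj.comp (hcF.comp (continuous_id.sub continuous_const)))
  have hki : Integrable k := by
    have e1 := (h₁.2 (tfShift ht hs 0 ξ ψ)).1.sub (h₂.2 (tfShift ht hs 0 ξ ψ)).1
    refine e1.congr (Filter.Eventually.of_forall fun ζ => ?_)
    have : (tfShift ht hs 0 ξ ψ).fn = modulate ξ (translate 0 ψ.fn) := rfl
    simp only [Pi.sub_apply, this, fourier_modulate_translate, hk]
    simp
    ring
  have hk0 : ∀ x, fourier k x = 0 := by
    intro x
    have e1 := h₁.2 (tfShift ht hs (-x) ξ ψ)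
    have e2 := h₂.2 (tfShift ht hs (-x) ξ ψ)
    have e3 : ∫ ζ, (g₁ ζ - g₂ ζ) * starRingEnd ℂ (fourier (tfShift ht hs (-x) ξ ψ).fn ζ) = 0 := by
      simp_rw [sub_mul]
      rw [integral_sub e1.1 e2.1, ← e1.2, ← e2.2, sub_self]
    have e4 := pairing_tfShift (fun ζ => g₁ ζ - g₂ ζ) ψ.fn (-x) ξ
    have e5 : (tfShift ht hs (-x) ξ ψ).fn = modulate ξ (translate (-x) ψ.fn) := rfl
    rw [← e5, e3, mul_zero, neg_neg] at e4
    exact (mul_eq_zero.1 e4.symm).resolve_left (Complex.exp_ne_zero _)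
  have h1 := norm_le_integral_of_fourier_le (N := 0) hkc hki (integrable_zero _ _ _)
    (fun ξ => by simp [hk0 ξ]) η
  have h2 : k η = 0 := norm_le_zero_iff.1 (by simpa using h1)
  have h3 : fourier ψ.fn (η - ξ) ≠ 0 := by simpa [hξ] using hη₀
  simp only [hk, mul_eq_zero, map_eq_zero, h3, or_false] at h2
  exact sub_eq_zero.1 h2

/-! ### Existence of a nonzero test function -/

/-- Products of functions of one variable: `g i n` is the `n`-th derivative of `g i 0`. -/
theorem mderiv_prod (β : MIdx d) {g : Fin d → ℕ → ℝ → ℂ}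
    (hg : ∀ i n x, HasDerivAt (g i n) (g i (n + 1) x) x) (hc : ∀ i n, ContDiff ℝ ∞ (g i n)) :
    mderiv β (fun x : E d => ∏ i, g i 0 (x i)) = fun x => ∏ i, g i (β i) (x i) := by
  induction β using MIdx.induction generalizing g with
  | h0 => simp [mderiv_zero]
  | h1 γ j ih =>
    have hprod : ContDiff ℝ ∞ fun x : E d => ∏ i, g i 0 (x i) :=
      contDiff_prod fun i _ => (hc i 0).comp (EuclideanSpace.proj i : E d →L[ℝ] ℝ).contDiff
    -- Differentiating in direction `j` shifts the `j`-th tower of derivatives by one, so the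
    -- induction hypothesis applies to the shifted family.
    set g' : Fin d → ℕ → ℝ → ℂ := fun i n => if i = j then g i (n + 1) else g i n with hg'
    have e : pderiv j (fun x : E d => ∏ i, g i 0 (x i)) = fun x => ∏ i, g' i 0 (x i) := by
      funext x
      have h2 : ∀ i ∈ (Finset.univ : Finset (Fin d)), HasFDerivAt (fun y : E d => g i 0 (y i))
          ((EuclideanSpace.proj i : E d →L[ℝ] ℝ).smulRight (g i 1 (x i))) x := by
        intro i _
        have := (hg i 0 (x i)).hasFDerivAt.comp x
          ((EuclideanSpace.proj i : E d →L[ℝ] ℝ).hasFDerivAt (x := x))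
        refine this.congr_fderiv ?_
        ext v
        simp
      have h3 : HasFDerivAt (fun x : E d => ∏ i, g i 0 (x i)) _ x := HasFDerivAt.finsetProd h2
      rw [pderiv, h3.fderiv, sum_apply, Finset.sum_eq_single j]
      · rw [← Finset.mul_prod_erase _ (fun i => g' i 0 (x i)) (Finset.mem_univ j)]
        have : ∏ i ∈ Finset.univ.erase j, g' i 0 (x i) =
            ∏ i ∈ Finset.univ.erase j, g i 0 (x i) :=
          Finset.prod_congr rfl fun i hi => by simp [hg', Finset.ne_of_mem_erase hi]
        rw [this]
        simp [hg']
        ring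
      · intro i _ hi
        simp [hi]
      · simp
    rw [← mderiv_pderiv γ j hprod, e, ih (g := g')]
    · funext x
      refine Finset.prod_congr rfl fun i _ => ?_
      by_cases hi : i = j
      · subst hi; simp [hg']
      · simp [hg', hi]
    · intro i n x
      by_cases hi : i = j
      · simpa [hg', hi] using hg j (n + 1) x
      · simpa [hg', hi] using hg i n x
    · intro i n
      by_cases hi : i = j
      · simpa [hg', hi] using hc j (n + 1)
      · simpa [hg', hi] using hc i n

theorem norm_pow_sub_pow_le (a b : ℂ) (M : ℝ) (ha : ‖a‖ ≤ M) (hb : ‖b‖ ≤ M) (N : ℕ) :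
    ‖a ^ N - b ^ N‖ ≤ ‖a - b‖ * (N * M ^ (N - 1)) := by
  rw [← (Commute.all a b).mul_geom_sum₂, norm_mul]
  gcongr
  refine (norm_sum_le _ _).trans ?_
  have : ∀ i ∈ Finset.range N, ‖a ^ i * b ^ (N - 1 - i)‖ ≤ M ^ (N - 1) := by
    intro i hi
    have hi' : i < N := Finset.mem_range.1 hi
    have hM : 0 ≤ M := (norm_nonneg a).trans ha
    rw [norm_mul, norm_pow, norm_pow]
    calc ‖a‖ ^ i * ‖b‖ ^ (N - 1 - i) ≤ M ^ i * M ^ (N - 1 - i) := by gcongr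
      _ = M ^ (N - 1) := by rw [← pow_add]; congr 1; omega
  simpa using Finset.sum_le_sum this

/-- The entire function `exp (-z ^ N)`. -/
def expNegPow (N : ℕ) (z : ℂ) : ℂ := Complex.exp (-z ^ N)

theorem contDiff_expNegPow (N : ℕ) : ContDiff ℂ ∞ (expNegPow N) := by
  unfold expNegPow; fun_prop

/-- On a circle of fixed radius around a real `x`, `z ^ N` differs from `x ^ N` by a term of order
`|x| ^ (N - 1)`, which half of `|x| ^ N` absorbs up to a constant. Evenness makes `x ^ N = |x| ^ N`.
-/
theorem exists_norm_expNegPow_le {N : ℕ} (hN : 2 ≤ N) (hev : Even N) {R : ℝ} (hR : 0 < R) :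
    ∃ C : ℝ, 0 < C ∧ ∀ (x : ℝ) (z : ℂ), ‖z - x‖ = R →
      ‖expNegPow N z‖ ≤ C * Real.exp (-(|x| ^ N / 2)) := by
  -- This threshold is at least `R`, and for `|x| ≥ A` the error is at most `(A / 2) |x| ^ (N - 1) ≤
  -- |x| ^ N / 2`.
  set A : ℝ := N * R * 2 ^ N with hA
  have hN1 : (1 : ℝ) ≤ N := by exact_mod_cast (by omega : 1 ≤ N)
  have hA0 : 0 ≤ A := by positivity
  have hAR : R ≤ A := by
    have : (1 : ℝ) ≤ 2 ^ N := one_le_pow₀ (by norm_num)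
    calc R = 1 * R * 1 := by ring
      _ ≤ N * R * 2 ^ N := by gcongr
  refine ⟨Real.exp (R * (N * (A + R) ^ (N - 1))), Real.exp_pos _, fun x z hz => ?_⟩
  have hx : ‖(x : ℂ)‖ = |x| := by simp
  have hz' : ‖z‖ ≤ |x| + R := by
    have := norm_add_le (x : ℂ) (z - x)
    rw [add_sub_cancel, hx, hz] at this
    exact this
  have h1 := norm_pow_sub_pow_le z x (|x| + R) hz' (by rw [hx]; linarith) N
  rw [hz] at h1
  have h2 : |x| ^ N - R * (N * (|x| + R) ^ (N - 1)) ≤ (z ^ N).re := by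
    have e1 : ((x : ℂ) ^ N).re = |x| ^ N := by
      rw [← Complex.ofReal_pow, Complex.ofReal_re, hev.pow_abs]
    have e2 : (z ^ N).re = |x| ^ N + (z ^ N - (x : ℂ) ^ N).re := by
      rw [Complex.sub_re, e1]; ring
    have e3 := (abs_le.1 (Complex.abs_re_le_norm (z ^ N - (x : ℂ) ^ N))).1
    linarith
  have h3 : R * (N * (|x| + R) ^ (N - 1)) ≤ |x| ^ N / 2 + R * (N * (A + R) ^ (N - 1)) := by
    rcases le_total |x| A with h | h
    · have : R * (N * (|x| + R) ^ (N - 1)) ≤ R * (N * (A + R) ^ (N - 1)) := by gcongr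
      have : 0 ≤ |x| ^ N / 2 := by positivity
      linarith
    · have e1 : (|x| + R) ^ (N - 1) ≤ (2 * |x|) ^ (N - 1) := by
        gcongr
        linarith
      have e2 : (2 : ℝ) ^ N = 2 * 2 ^ (N - 1) := by
        rw [← pow_succ']; congr 1; omega
      have e3 : |x| ^ N = |x| * |x| ^ (N - 1) := by
        rw [← pow_succ']; congr 1; omega
      have e4 : R * (N * (2 * |x|) ^ (N - 1)) = A / 2 * |x| ^ (N - 1) := by
        rw [mul_pow, hA, e2]; ring
      have e5 : A / 2 * |x| ^ (N - 1) ≤ |x| ^ N / 2 := by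
        rw [e3]
        have : 0 ≤ |x| ^ (N - 1) := by positivity
        nlinarith
      have e6 : R * (N * (|x| + R) ^ (N - 1)) ≤ R * (N * (2 * |x|) ^ (N - 1)) := by gcongr
      have e7 : 0 ≤ R * (N * (A + R) ^ (N - 1)) := by positivity
      linarith
  rw [expNegPow, Complex.norm_exp, ← Real.exp_add, Complex.neg_re]
  refine Real.exp_le_exp.2 ?_
  linarith

/-- Cauchy estimates on circles of radius `1 / h`. As the function is entire, every `h` is allowed,
which is what the Beurling condition asks for. -/
theorem exists_iteratedDeriv_expNegPow_le {N : ℕ} (hN : 2 ≤ N) (hev : Even N) {h : ℝ}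
    (hh : 0 < h) : ∃ C : ℝ, 0 < C ∧ ∀ (n : ℕ) (x : ℝ),
      ‖iteratedDeriv n (expNegPow N) (x : ℂ)‖ ≤
        C * (h ^ n * n.factorial) * Real.exp (-(|x| ^ N / 2)) := by
  obtain ⟨C, hC, H⟩ := exists_norm_expNegPow_le hN hev (R := 1 / h) (by positivity)
  refine ⟨C, hC, fun n x => ?_⟩
  have h1 := Complex.norm_iteratedDeriv_le_of_forall_mem_sphere_norm_le (n := n) (c := (x : ℂ))
    (R := 1 / h) (f := expNegPow N) (C := C * Real.exp (-(|x| ^ N / 2))) (by positivity)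
    ((contDiff_expNegPow N).differentiable (by simp)).diffContOnCl
    (fun z hz => H x z (by simpa [dist_eq_norm] using hz))
  refine h1.trans (le_of_eq ?_)
  rw [one_div, inv_pow, div_inv_eq_mul]
  ring

theorem exists_abs_pow_mul_iteratedDeriv_le {t s : ℝ} (ht : 0 < t) (hs : 1 ≤ s) {N : ℕ}
    (hN : 2 ≤ N) (hev : Even N) (hNt : 1 / t + 1 ≤ N) {h : ℝ} (hh : 0 < h) :
    ∃ C : ℝ, 0 ≤ C ∧ ∀ (m n : ℕ) (x : ℝ), |x| ^ m * ‖iteratedDeriv n (expNegPow N) (x : ℂ)‖ ≤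
      C * ((h ^ m * (m.factorial : ℝ) ^ t) * (h ^ n * (n.factorial : ℝ) ^ s)) := by
  obtain ⟨C, hC, H⟩ := exists_iteratedDeriv_expNegPow_le hN hev hh
  set B : ℝ := t / h ^ (1 / t) with hB
  have hB0 : 0 ≤ B := by positivity
  set Y : ℝ := max 1 (2 * B) with hY
  have hY1 : 1 ≤ Y := le_max_left _ _
  -- The exponential cost of the monomials has order `y ^ (1/t)`, hence is beaten by `y ^ N / 2`
  -- when `N ≥ 1/t + 1`; the additive constant covers `y ≤ Y`.
  have key : ∀ y : ℝ, 0 ≤ y → t * (y / h) ^ (1 / t) ≤ y ^ N / 2 + B * Y ^ (1 / t) := by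
    intro y hy
    have e : t * (y / h) ^ (1 / t) = B * y ^ (1 / t) := by
      rw [Real.div_rpow hy hh.le, hB]; ring
    rw [e]
    have hY0 : 0 ≤ B * Y ^ (1 / t) := by positivity
    rcases le_total y Y with h1 | h1
    · have : B * y ^ (1 / t) ≤ B * Y ^ (1 / t) := by gcongr
      have : 0 ≤ y ^ N / 2 := by positivity
      linarith
    · have hy1 : 1 ≤ y := hY1.trans h1
      have hyB : 2 * B ≤ y := (le_max_right _ _).trans h1
      have e1 : y ^ (1 / t) * y ≤ y ^ N := by
        rw [← Real.rpow_natCast y N]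
        refine le_trans (le_of_eq ?_) (Real.rpow_le_rpow_of_exponent_le hy1 hNt)
        rw [Real.rpow_add (by linarith), Real.rpow_one]
      have e2 : 0 ≤ y ^ (1 / t) := Real.rpow_nonneg hy _
      nlinarith
  refine ⟨C * Real.exp (B * Y ^ (1 / t)), by positivity, fun m n x => ?_⟩
  have h1 := pow_le_factorial_rpow_mul_exp ht hh (abs_nonneg x) m
  have h2 := H n x
  have h3 : (n.factorial : ℝ) ≤ (n.factorial : ℝ) ^ s := by
    conv_lhs => rw [← Real.rpow_one (n.factorial : ℝ)]
    exact Real.rpow_le_rpow_of_exponent_le (by exact_mod_cast n.factorial_pos) hs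
  have h4 : Real.exp (t * (|x| / h) ^ (1 / t)) * Real.exp (-(|x| ^ N / 2)) ≤
      Real.exp (B * Y ^ (1 / t)) := by
    rw [← Real.exp_add]
    refine Real.exp_le_exp.2 ?_
    linarith [key |x| (abs_nonneg x)]
  calc |x| ^ m * ‖iteratedDeriv n (expNegPow N) (x : ℂ)‖
      ≤ (h ^ m * (m.factorial : ℝ) ^ t * Real.exp (t * (|x| / h) ^ (1 / t))) *
        (C * (h ^ n * n.factorial) * Real.exp (-(|x| ^ N / 2))) :=
        mul_le_mul h1 h2 (norm_nonneg _) (by positivity)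
    _ = C * ((h ^ m * (m.factorial : ℝ) ^ t) * (h ^ n * n.factorial)) *
        (Real.exp (t * (|x| / h) ^ (1 / t)) * Real.exp (-(|x| ^ N / 2))) := by ring
    _ ≤ C * ((h ^ m * (m.factorial : ℝ) ^ t) * (h ^ n * (n.factorial : ℝ) ^ s)) *
        Real.exp (B * Y ^ (1 / t)) := by gcongr
    _ = _ := by ring

/-- The example is the product of the functions `exp (-x_i ^ N)` for an even `N` large compared with
`1/t`. The derivatives satisfy bounds with `n!`, which suffices for `s ≥ 1`. -/
theorem GS.exists_ne_zero (d : ℕ) {t s : ℝ} (ht : 0 < t) (hs : 1 ≤ s) : ∃ ψ : GS d t s, ψ ≠ 0 := by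
  obtain ⟨m, hm⟩ := exists_nat_ge (1 / t + 1)
  set N : ℕ := 2 * m + 2
  have hNt : 1 / t + 1 ≤ (N : ℝ) := by
    have h1 : (0 : ℝ) ≤ m := Nat.cast_nonneg _
    have h2 : (N : ℝ) = 2 * m + 2 := by simp [N]
    rw [h2]; linarith
  have hev : Even N := ⟨m + 1, by simp only [N]; ring⟩
  set g : Fin d → ℕ → ℝ → ℂ := fun _ n x => iteratedDeriv n (expNegPow N) (x : ℂ) with hg
  have hcd : ∀ n, ContDiff ℂ ∞ (iteratedDeriv n (expNegPow N)) := fun n =>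
    by
    rw [iteratedDeriv_eq_iterate]
    exact (contDiff_expNegPow N).iterate_deriv n
  have hcg : ∀ i n, ContDiff ℝ ∞ (g i n) := fun i n =>
    ((hcd n).restrict_scalars ℝ).comp
      Complex.ofRealCLM.contDiff
  have hdg : ∀ i n x, HasDerivAt (g i n) (g i (n + 1) x) x := fun i n x => by
    have h1 := ((hcd n).differentiable (by simp) (x : ℂ)).hasDerivAt
    rw [← iteratedDeriv_succ] at h1
    exact h1.comp_ofReal
  have hmd := fun β => mderiv_prod (d := d) β hdg hcg
  refine ⟨⟨fun x => ∏ i, g i 0 (x i), contDiff_prod fun i _ =>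
    (hcg i 0).comp (EuclideanSpace.proj i : E d →L[ℝ] ℝ).contDiff, fun h hh => ?_⟩, fun h0 => ?_⟩
  · obtain ⟨C, hC, H⟩ := exists_abs_pow_mul_iteratedDeriv_le ht hs (by omega : 2 ≤ N) hev hNt hh
    refine ⟨C ^ d, fun α β x => ?_⟩
    rw [hmd, mono, Finset.abs_prod, norm_prod, ← Finset.prod_mul_distrib]
    refine (Finset.prod_le_prod (fun i _ => by positivity) fun i _ => ?_).trans
      (b := ∏ i, C * ((h ^ α i * ((α i).factorial : ℝ) ^ t) *
        (h ^ β i * ((β i).factorial : ℝ) ^ s))) (le_of_eq ?_)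
    · rw [abs_pow]
      exact H _ _ _
    · rw [Finset.prod_mul_distrib, Finset.prod_mul_distrib, prod_weight, prod_weight, gsWeight,
        deg_add, pow_add, Finset.prod_const, Finset.card_univ, Fintype.card_fin]
      ring
  · have h1 : (∏ i : Fin d, g i 0 ((0 : E d) i)) = 0 := congrFun (congrArg GS.fn h0) 0
    refine Finset.prod_ne_zero_iff.2 (fun i _ => ?_) h1
    simp [hg, expNegPow]

theorem HasFourier.unique {t s : ℝ} (ht : 0 < t) (hs : 1 ≤ s) {u : GSDual d t s}
    {g₁ g₂ : E d → ℂ} (h₁ : HasFourier u g₁) (h₂ : HasFourier u g₂) : g₁ = g₂ := by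
  obtain ⟨ψ, hψ⟩ := GS.exists_ne_zero d ht hs
  exact HasFourier.unique_of_ne_zero ht (by linarith) hψ h₁ h₂

/-! ### Conic decay, dilation decay and the set `V u` -/

theorem norm_rpow_smul_rpow {s l : ℝ} (hs : 0 < s) (hl : 0 < l) (x : E d) :
    ‖l ^ s • x‖ ^ (1 / s) = l * ‖x‖ ^ (1 / s) := by
  rw [norm_smul, Real.norm_of_nonneg (Real.rpow_nonneg hl.le _),
    Real.mul_rpow (Real.rpow_nonneg hl.le _) (norm_nonneg _), ← Real.rpow_mul hl.le,
    mul_one_div_cancel hs.ne', Real.rpow_one]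

/-- Decay in an open cone is the same as decay along the anisotropic rays through an open set. -/
theorem exists_cone_decay_iff {s : ℝ} (hs : 0 < s) (f : E d → ℂ) {η : E d} (hη : η ≠ 0) :
    (∃ Γ : Set (E d), IsOpen Γ ∧ Γ ⊆ {0}ᶜ ∧ (∀ x ∈ Γ, ∀ l : ℝ, 0 < l → l • x ∈ Γ) ∧ η ∈ Γ ∧
      ∀ r : ℝ, 0 < r → ∃ C : ℝ, ∀ ξ ∈ Γ, Real.exp (r * ‖ξ‖ ^ (1 / s)) * ‖f ξ‖ ≤ C) ↔
    ∃ U : Set (E d), IsOpen U ∧ U ⊆ {0}ᶜ ∧ η ∈ U ∧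
      ∀ r : ℝ, 0 < r → ∃ C : ℝ, ∀ x ∈ U, ∀ l : ℝ, 0 < l →
        Real.exp (r * l) * ‖f (l ^ s • x)‖ ≤ C := by
  have hη0 : 0 < ‖η‖ := norm_pos_iff.2 hη
  constructor
  · rintro ⟨Γ, hΓ, hΓ0, hcone, hηΓ, H⟩
    -- Staying away from the origin bounds `λ` by a multiple of `|λ ^ s x| ^ (1/s)`.
    refine ⟨Γ ∩ {x | ‖η‖ / 2 < ‖x‖}, hΓ.inter (isOpen_lt continuous_const continuous_norm),
      fun x hx => hΓ0 hx.1, ⟨hηΓ, by change ‖η‖ / 2 < ‖η‖; linarith⟩, fun r hr => ?_⟩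
    set a : ℝ := (‖η‖ / 2) ^ (1 / s)
    have ha : 0 < a := Real.rpow_pos_of_pos (by linarith) _
    obtain ⟨C, hC⟩ := H (r / a) (by positivity)
    refine ⟨C, fun x hx l hl => ?_⟩
    refine le_trans ?_ (hC (l ^ s • x) (hcone x hx.1 _ (Real.rpow_pos_of_pos hl _)))
    rw [norm_rpow_smul_rpow hs hl]
    have h1 : a ≤ ‖x‖ ^ (1 / s) :=
      Real.rpow_le_rpow (by positivity) (le_of_lt hx.2) (by positivity)
    have h2 : r * l ≤ r / a * (l * ‖x‖ ^ (1 / s)) := by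
      calc r * l = r / a * (l * a) := by field_simp
        _ ≤ _ := by gcongr
    gcongr
  · rintro ⟨U, hU, hU0, hηU, H⟩
    -- The cone is generated by a bounded piece of `U`, so that `|λ ^ s x| ^ (1/s)` is in turn
    -- bounded by a multiple of `λ`.
    set U' : Set (E d) := U ∩ {x | ‖x‖ < ‖η‖ + 1}
    have hU' : IsOpen U' := hU.inter (isOpen_lt continuous_norm continuous_const)
    refine ⟨{x | ∃ l : ℝ, 0 < l ∧ l • x ∈ U'}, ?_, ?_, ?_, ?_, fun r hr => ?_⟩
    · have : {x | ∃ l : ℝ, 0 < l ∧ l • x ∈ U'} =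
          ⋃ (l : ℝ) (_ : 0 < l), (fun x : E d => l • x) ⁻¹' U' := by
        ext x; simp
      rw [this]
      exact isOpen_iUnion fun l => isOpen_iUnion fun _ => hU'.preimage (continuous_const_smul l)
    · rintro x ⟨l, -, hx⟩ h0
      refine hU0 hx.1 ?_
      rw [Set.mem_singleton_iff.1 h0, smul_zero]
      rfl
    · rintro x ⟨l, hl, hx⟩ m hm
      refine ⟨l / m, by positivity, ?_⟩
      rwa [smul_smul, div_mul_cancel₀ _ hm.ne']
    · exact ⟨1, one_pos, by rw [one_smul]; exact ⟨hηU, by simp⟩⟩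
    · set M : ℝ := (‖η‖ + 1) ^ (1 / s)
      have hM : 0 < M := Real.rpow_pos_of_pos (by positivity) _
      obtain ⟨C, hC⟩ := H (r * M) (by positivity)
      refine ⟨C, ?_⟩
      rintro ξ ⟨l, hl, hx⟩
      set m : ℝ := (l⁻¹) ^ (1 / s)
      have hm : 0 < m := Real.rpow_pos_of_pos (by positivity) _
      have e1 : m ^ s = l⁻¹ := by
        rw [← Real.rpow_mul (by positivity), one_div_mul_cancel hs.ne', Real.rpow_one]
      have e2 : ξ = m ^ s • (l • ξ) := by
        rw [e1, smul_smul, inv_mul_cancel₀ hl.ne', one_smul]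
      have h1 := hC (l • ξ) hx.1 m hm
      rw [← e2] at h1
      refine le_trans ?_ h1
      have e3 : ‖ξ‖ ^ (1 / s) = m * ‖l • ξ‖ ^ (1 / s) := by
        conv_lhs => rw [e2]
        exact norm_rpow_smul_rpow hs hm _
      have h2 : ‖l • ξ‖ ^ (1 / s) ≤ M :=
        Real.rpow_le_rpow (norm_nonneg _) (le_of_lt hx.2) (by positivity)
      have h3 : r * ‖ξ‖ ^ (1 / s) ≤ r * M * m := by
        rw [e3]
        calc r * (m * ‖l • ξ‖ ^ (1 / s)) ≤ r * (m * M) := by gcongr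
          _ = _ := by ring
      gcongr

theorem V_eq_nonDecay {t s : ℝ} (ht : 0 < t) (hs : 1 ≤ s) {u : GSDual d t s} {g : E d → ℂ}
    (hg : HasFourier u g) : V u = nonDecay s g := by
  ext η
  refine and_congr_right fun hη => not_congr ?_
  rw [← exists_cone_decay_iff (by linarith) g hη]
  constructor
  · rintro ⟨g', hg', H⟩
    -- The definition of `V u` only provides some representing function; uniqueness identifies it
    -- with `g`.
    rwa [hg'.unique ht hs hg] at H
  · exact fun H => ⟨g, hg, H⟩

theorem nonDecay_const_mul {s : ℝ} {a : ℂ} (ha : a ≠ 0) (f : E d → ℂ) :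
    nonDecay s (fun x => a * f x) = nonDecay s f := by
  have key : ∀ {b : ℂ} (f : E d → ℂ) (U : Set (E d)), (∀ r : ℝ, 0 < r → ∃ C : ℝ, ∀ x ∈ U,
      ∀ l : ℝ, 0 < l → Real.exp (r * l) * ‖f (l ^ s • x)‖ ≤ C) →
      ∀ r : ℝ, 0 < r → ∃ C : ℝ, ∀ x ∈ U,
      ∀ l : ℝ, 0 < l → Real.exp (r * l) * ‖b * f (l ^ s • x)‖ ≤ C := by
    intro b f U H r hr
    obtain ⟨C, hC⟩ := H r hr
    refine ⟨‖b‖ * C, fun x hx l hl => ?_⟩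
    rw [norm_mul, mul_left_comm]
    exact mul_le_mul_of_nonneg_left (hC x hx l hl) (norm_nonneg _)
  ext x
  refine and_congr_right fun _ => not_congr (exists_congr fun U => and_congr_right fun _ =>
    and_congr_right fun _ => and_congr_right fun _ => ⟨fun H => ?_, fun H => key f U H⟩)
  have := key (b := a⁻¹) (fun x => a * f x) U H
  simpa only [inv_mul_cancel_left₀ ha] using this

/-! ### Frequency decay of the short-time Fourier transforms -/

/-- A form of the Leibniz rule: submultiplicative bounds for the derivatives of two functions
give bounds for the derivatives of the product. -/
theorem norm_mderiv_mul_le (β : MIdx d) {f g : E d → ℂ} (hf : ContDiff ℝ ∞ f)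
    (hg : ContDiff ℝ ∞ g) (x : E d) {W : MIdx d → ℝ}
    (H : ∀ γ δ, ‖mderiv γ f x‖ * ‖mderiv δ g x‖ ≤ W (γ + δ)) :
    ‖mderiv β (f * g) x‖ ≤ 2 ^ deg β * W β := by
  induction β using MIdx.induction generalizing f g W with
  | h0 => simpa [mderiv_zero, deg_zero] using H 0 0
  | h1 γ j ih =>
    have e : pderiv j (f * g) = pderiv j f * g + f * pderiv j g := by
      funext y
      simp only [pderiv, Pi.add_apply, Pi.mul_apply]
      rw [fderiv_mul (hf.differentiable (by simp) y) (hg.differentiable (by simp) y)]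
      simp
      ring
    have hf' := contDiff_pderiv j hf
    have hg' := contDiff_pderiv j hg
    rw [← mderiv_pderiv γ j (f := f * g) (hf.mul hg), e, mderiv_add γ (f := pderiv j f * g)
      (g := f * pderiv j g) (hf'.mul hg) (hf.mul hg'), Pi.add_apply]
    -- Shifting the weight by `e_j` lets both terms of the product rule use the same induction
    -- hypothesis; each derivative doubles the bound, so no binomial coefficients appear.
    have h1 := ih hf' hg (W := fun β => W (β + Pi.single j 1)) fun γ δ => by
      rw [mderiv_pderiv γ j hf]
      refine (H _ _).trans (le_of_eq ?_)
      congr 1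
      abel
    have h2 := ih hf hg' (W := fun β => W (β + Pi.single j 1)) fun γ δ => by
      rw [mderiv_pderiv δ j hg]
      refine (H _ _).trans (le_of_eq ?_)
      congr 1
      abel
    refine (norm_add_le _ _).trans ((add_le_add h1 h2).trans (le_of_eq ?_))
    rw [deg_add, deg_single]
    ring

theorem mderiv_conj (β : MIdx d) {f : E d → ℂ} (hf : ContDiff ℝ ∞ f) :
    mderiv β (fun x => starRingEnd ℂ (f x)) = fun x => starRingEnd ℂ (mderiv β f x) := by
  have hconj : ∀ {g : E d → ℂ}, ContDiff ℝ ∞ g → ContDiff ℝ ∞ fun x => starRingEnd ℂ (g x) :=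
    fun hg => Complex.conjCLE.contDiff.comp hg
  induction β using MIdx.induction generalizing f with
  | h0 => simp [mderiv_zero]
  | h1 γ j ih =>
    have e : pderiv j (fun x => starRingEnd ℂ (f x)) = fun x => starRingEnd ℂ (pderiv j f x) := by
      funext x
      have h1 := (Complex.conjCLE : ℂ →L[ℝ] ℂ).hasFDerivAt.comp x
        (hf.differentiable (by simp) x).hasFDerivAt
      have h2 : fderiv ℝ (fun x => starRingEnd ℂ (f x)) x = _ := h1.fderiv
      rw [pderiv, h2]
      simp [pderiv]
    rw [← mderiv_pderiv γ j (hconj hf), e, ih (contDiff_pderiv j hf), mderiv_pderiv γ j hf]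

/-- The short-time Fourier transform of the function `f` with window `ρ`. -/
def windowedFourier (f ρ : E d → ℂ) (x ξ : E d) : ℂ :=
  fourier (fun y => f y * starRingEnd ℂ (ρ (y - x))) ξ

/-- The product of `f` with a translated window inherits the derivative bounds of the window,
because derivatives of `f` cost no factorials. Derivative bounds give decay in `ξ`, and
subadditivity replaces the growth of `f` at `y` by growth at `x`. -/
theorem exists_windowedFourier_le {s t : ℝ} (hs : 1 < s) (ht : 0 < t) {c : MIdx d → ℂ}
    (hc : SmallCoeff s c) (ψ : GS d s t) {r ε : ℝ} (hr : 0 < r) (hε : 0 < ε) :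
    ∃ C, 0 ≤ C ∧ ∀ x ξ, ‖windowedFourier (powerSeriesSum c) ψ.fn x ξ‖ ≤
      C * Real.exp (-r * ‖ξ‖ ^ (1 / t) + ε * ‖x‖ ^ (1 / s)) := by
  have hs0 : 0 < s := by linarith
  obtain ⟨h, hh, K, hK, H⟩ := exists_norm_fourier_le d ht hr
  obtain ⟨R₀, hR₀, hR⟩ := exists_radius d hs0 hε
  -- `R ≥ R₀` keeps the growth rate of `f` below `ε`; `R ≥ 2 / h` makes its derivatives cost at most
  -- `h / 2` each. The other half compensates the factor `2 ^ |β|` of the Leibniz rule.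
  set R : ℝ := max R₀ (2 / h)
  have hRpos : 0 < R := lt_max_of_lt_left (by linarith)
  have hRh : R⁻¹ ≤ h / 2 := by
    rw [inv_le_comm₀ hRpos (by positivity), inv_div]
    exact le_max_right _ _
  -- Of the decay rate `ε + 1`, the part `ε` pays for moving the growth from `y` to `x`, and the
  -- rest leaves an integrable function.
  obtain ⟨B, hB, hψ⟩ := ψ.mderiv_decay hs0 (half_pos hh) (r := ε + 1) (by linarith)
  set A : ℝ := coeffNorm s R c with hA
  have hA0 : 0 ≤ A := coeffNorm_nonneg s hRpos c
  have hf := contDiff_powerSeriesSum hs hc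
  set I : ℝ := ∫ y : E d, Real.exp (-1 * ‖y‖ ^ (1 / s)) with hI
  have hI0 : 0 ≤ I := integral_nonneg fun x => (Real.exp_pos _).le
  have hint : Integrable fun y : E d => Real.exp (-1 * ‖y‖ ^ (1 / s)) :=
    integrable_exp_neg_rpow (by positivity) one_pos
  refine ⟨K * (A * B * I), by positivity, fun x ξ => ?_⟩
  set g : E d → ℂ := fun y => starRingEnd ℂ (translate x ψ.fn y) with hg
  have htr : ContDiff ℝ ∞ (translate x ψ.fn) :=
    ψ.contDiff.comp (contDiff_id.sub contDiff_const)
  have hgc : ContDiff ℝ ∞ g := Complex.conjCLE.contDiff.comp htr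
  have hgb : ∀ δ y, ‖mderiv δ g y‖ ≤
      B * ((h / 2) ^ deg δ * mfact δ ^ t) * Real.exp (-(ε + 1) * ‖y - x‖ ^ (1 / s)) := by
    intro δ y
    rw [hg, mderiv_conj δ htr, RCLike.norm_conj]
    have : mderiv δ (translate x ψ.fn) y = mderiv δ ψ.fn (y - x) :=
      congrFun (listDeriv_translate _ x δ ψ.fn) y
    rw [this]
    exact hψ δ (y - x)
  have hbound : ∀ β y, ‖mderiv β (powerSeriesSum c * g) y‖ ≤
      A * B * Real.exp (ε * ‖x‖ ^ (1 / s)) * (h ^ deg β * mfact β ^ t) *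
        Real.exp (-1 * ‖y - x‖ ^ (1 / s)) := by
    intro β y
    refine (norm_mderiv_mul_le β hf hgc y (W := fun β => A * B * Real.exp (ε * ‖x‖ ^ (1 / s)) *
      ((h / 2) ^ deg β * mfact β ^ t) * Real.exp (-1 * ‖y - x‖ ^ (1 / s))) fun γ δ => ?_).trans
      (le_of_eq ?_)
    · have h1 : ‖mderiv γ (powerSeriesSum c) y‖ ≤
          (h / 2) ^ deg γ * (A * Real.exp (ε * ‖y‖ ^ (1 / s))) := by
        refine (norm_mderiv_powerSeriesSum_le hs hRpos γ hc y).trans ?_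
        have := hR R (le_max_left _ _) ‖y‖ (norm_nonneg y)
        gcongr
      have h2 : mfact δ ^ t ≤ mfact (γ + δ) ^ t :=
        Real.rpow_le_rpow (mfact_pos δ).le (mfact_le_mfact_add γ δ) ht.le
      have h3 : Real.exp (ε * ‖y‖ ^ (1 / s)) * Real.exp (-(ε + 1) * ‖y - x‖ ^ (1 / s)) ≤
          Real.exp (ε * ‖x‖ ^ (1 / s)) * Real.exp (-1 * ‖y - x‖ ^ (1 / s)) := by
        rw [← Real.exp_add, ← Real.exp_add]
        have := norm_rpow_le_add hs y x
        refine Real.exp_le_exp.2 ?_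
        nlinarith
      have h4 := Real.rpow_nonneg (mfact_pos δ).le t
      have h5 := Real.rpow_nonneg (mfact_pos (γ + δ)).le t
      calc _ ≤ (h / 2) ^ deg γ * (A * Real.exp (ε * ‖y‖ ^ (1 / s))) *
            (B * ((h / 2) ^ deg δ * mfact δ ^ t) * Real.exp (-(ε + 1) * ‖y - x‖ ^ (1 / s))) :=
            mul_le_mul h1 (hgb δ y) (norm_nonneg _) (by positivity)
        _ = A * B * ((h / 2) ^ deg (γ + δ) * mfact δ ^ t) * (Real.exp (ε * ‖y‖ ^ (1 / s)) *
            Real.exp (-(ε + 1) * ‖y - x‖ ^ (1 / s))) := by rw [deg_add, pow_add]; ring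
        _ ≤ A * B * ((h / 2) ^ deg (γ + δ) * mfact (γ + δ) ^ t) * (Real.exp (ε * ‖x‖ ^ (1 / s)) *
            Real.exp (-1 * ‖y - x‖ ^ (1 / s))) := by gcongr
        _ = _ := by ring
    · have : h ^ deg β = 2 ^ deg β * (h / 2) ^ deg β := by
        rw [← mul_pow]; congr 1; ring
      rw [this]
      ring
  have key := H (powerSeriesSum c * g) (A * B * Real.exp (ε * ‖x‖ ^ (1 / s)))
    (fun y => Real.exp (-1 * ‖y - x‖ ^ (1 / s))) (hf.mul hgc) (by positivity)
    (hint.comp_sub_right x) (fun y => (Real.exp_pos _).le) hbound ξ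
  rw [integral_sub_right_eq_self (fun y : E d => Real.exp (-1 * ‖y‖ ^ (1 / s))) x] at key
  refine (le_of_eq rfl).trans (key.trans (le_of_eq ?_))
  rw [Real.exp_add, hI]
  ring

/-- Here the constant is explicit in `A`, unlike in `exists_weight`. With `A` the norm of a
frequency, it becomes the subexponential growth factor of the Dirac-side estimate. -/
theorem exists_weight_le {s h A : ℝ} (hs : 0 < s) (hh : 0 < h) (hA : 0 ≤ A) :
    ∃ w : ℕ → ℝ, (∀ m, h ^ m * (m.factorial : ℝ) ^ s ≤ w m) ∧ (∀ m, A * w m ≤ w (m + 1)) ∧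
      ∀ m, w m ≤ Real.exp (s * (A / h) ^ (1 / s)) * (h ^ m * (m.factorial : ℝ) ^ s) := by
  set v : ℕ → ℝ := fun m => h ^ m * (m.factorial : ℝ) ^ s with hv
  -- The least sequence meeting both lower bounds. Unfolded, `w m = A ^ (m - k) v k` for some `k ≤
  -- m`, and `(m - k)! k! ≤ m!` compares it with `v m`.
  set w : ℕ → ℝ := fun m => Nat.rec 1 (fun m y => max (v (m + 1)) (A * y)) m with hw
  have hw1 : ∀ m, w (m + 1) = max (v (m + 1)) (A * w m) := fun m => rfl
  have hex : ∀ m, ∃ k ≤ m, w m = A ^ (m - k) * v k := by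
    intro m
    induction m with
    | zero => exact ⟨0, le_rfl, by simp [hw, hv]⟩
    | succ m ih =>
      rcases max_choice (v (m + 1)) (A * w m) with h1 | h1
      · exact ⟨m + 1, le_rfl, by rw [hw1, h1]; simp⟩
      · obtain ⟨k, hk, e⟩ := ih
        refine ⟨k, hk.trans (Nat.le_succ m), ?_⟩
        rw [hw1, h1, e, Nat.succ_sub hk, pow_succ']
        ring
  refine ⟨w, fun m => ?_, fun m => ?_, fun m => ?_⟩
  · cases m with
    | zero => simp [hw]
    | succ m => exact le_max_left _ _
  · rw [hw1]; exact le_max_right _ _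
  · obtain ⟨k, hk, e⟩ := hex m
    rw [e]
    have h1 := pow_le_factorial_rpow_mul_exp hs hh hA (m - k)
    have h2 : (((m - k).factorial : ℝ)) ^ s * (k.factorial : ℝ) ^ s ≤ (m.factorial : ℝ) ^ s := by
      rw [← Real.mul_rpow (Nat.cast_nonneg _) (Nat.cast_nonneg _)]
      refine Real.rpow_le_rpow (by positivity) ?_ hs.le
      have := Nat.le_of_dvd m.factorial_pos (Nat.factorial_mul_factorial_dvd_factorial hk)
      rw [mul_comm]
      exact_mod_cast this
    have h3 : h ^ m = h ^ (m - k) * h ^ k := by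
      rw [← pow_add]; congr 1; omega
    calc A ^ (m - k) * (h ^ k * (k.factorial : ℝ) ^ s)
        ≤ (h ^ (m - k) * ((m - k).factorial : ℝ) ^ s * Real.exp (s * (A / h) ^ (1 / s))) *
          (h ^ k * (k.factorial : ℝ) ^ s) := by gcongr
      _ = Real.exp (s * (A / h) ^ (1 / s)) * (h ^ m *
          ((((m - k).factorial : ℝ)) ^ s * (k.factorial : ℝ) ^ s)) := by rw [h3]; ring
      _ ≤ _ := by gcongr

/-- Derivatives at the origin of the shifted window see the window at `-x`, which gives the decay in
`x`. The modulation costs `exp (ε |ξ| ^ (1/s))`, and the smallness of the coefficients absorbs the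
remaining factor `(2h) ^ |α| α! ^ s`, however large `h` is. -/
theorem exists_stft_diracSeries_le {t s : ℝ} (ht : 0 < t) (hs : 0 < s) {c : MIdx d → ℂ}
    (hc : SmallCoeff s c) {u : GSDual d t s} (hu : IsDiracSeries c u) (ψ : GS d t s) {r ε : ℝ}
    (hr : 0 < r) (hε : 0 < ε) : ∃ C, 0 ≤ C ∧ ∀ x ξ, ‖stft ht hs ψ u x ξ‖ ≤
      C * Real.exp (-r * ‖x‖ ^ (1 / t) + ε * ‖ξ‖ ^ (1 / s)) := by
  obtain ⟨h, hh1, hR⟩ := exists_radius d hs hε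
  have hh : 0 < h := by linarith
  obtain ⟨B, hB, hψ⟩ := ψ.mderiv_decay ht hh hr
  refine ⟨B * coeffNorm s (2 * h) c,
    mul_nonneg hB (coeffNorm_nonneg s (by positivity) c), fun x ξ => ?_⟩
  obtain ⟨w, hw1, hw2, hw3⟩ := exists_weight_le hs hh (norm_nonneg ξ)
  have hv0 : ∀ m : ℕ, 0 ≤ h ^ m * (m.factorial : ℝ) ^ s := fun m => by positivity
  have hw0 : ∀ m, 0 ≤ w m := fun m => (hv0 m).trans (hw1 m)
  set φ := tfShift ht hs x ξ ψ
  set b : ℝ := B * Real.exp (-r * ‖x‖ ^ (1 / t)) with hb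
  have hb0 : 0 ≤ b := by positivity
  have htr : ContDiff ℝ ∞ (translate x ψ.fn) :=
    ψ.contDiff.comp (contDiff_id.sub contDiff_const)
  have hD : ∀ α, ‖Dop α φ.fn 0‖ ≤ 2 ^ deg α * b *
      (Real.exp (ε * ‖ξ‖ ^ (1 / s)) * (h ^ deg α * mfact α ^ s)) := by
    intro α
    have e1 : mderiv α φ.fn = modulate ξ (listQ ξ (List.finRange d) α (translate x ψ.fn)) :=
      listDeriv_modulate ξ _ α htr
    rw [norm_Dop, e1, norm_modulate]
    have h1 := listQ_bound ξ 0 1 zero_le_one w hw0 hw2 b (translate x ψ.fn) htr (fun γ => by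
      have e2 : mderiv γ (translate x ψ.fn) 0 = mderiv γ ψ.fn (0 - x) :=
        congrFun (listDeriv_translate _ x γ ψ.fn) 0
      rw [one_mul, e2]
      refine (hψ γ (0 - x)).trans ?_
      rw [zero_sub, norm_neg, ← prod_weight, mul_right_comm]
      refine mul_le_mul_of_nonneg_left ?_ hb0
      exact Finset.prod_le_prod (fun i _ => hv0 _) fun i _ => hw1 _) hb0 α
    rw [one_mul] at h1
    refine h1.trans ?_
    have h2 : ∏ i, w (α i) ≤ Real.exp (ε * ‖ξ‖ ^ (1 / s)) * (h ^ deg α * mfact α ^ s) := by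
      refine (Finset.prod_le_prod (fun i _ => hw0 _) fun i _ => hw3 (α i)).trans ?_
      rw [Finset.prod_mul_distrib, prod_weight, Finset.prod_const, Finset.card_univ,
        Fintype.card_fin, ← Real.exp_nat_mul]
      have := hR h le_rfl ‖ξ‖ (norm_nonneg ξ)
      have := Real.rpow_nonneg (mfact_pos α).le s
      gcongr
    exact mul_le_mul_of_nonneg_left h2 (by positivity)
  have h1 : ‖u φ‖ ≤ coeffNorm s (2 * h) c * (b * Real.exp (ε * ‖ξ‖ ^ (1 / s))) := by
    rw [← (hu φ).tsum_eq, coeffNorm, ← tsum_mul_right]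
    refine tsum_of_norm_bounded ((hc (2 * h) (by positivity)).mul_right _).hasSum fun α => ?_
    rw [norm_mul, RCLike.norm_conj]
    refine (mul_le_mul_of_nonneg_left (hD α) (norm_nonneg _)).trans (le_of_eq ?_)
    rw [mul_pow]
    ring
  have h2 : ‖stft ht hs ψ u x ξ‖ ≤ ‖u φ‖ := by
    have e : stft ht hs ψ u x ξ = (fourierConst d : ℂ) * u φ := rfl
    rw [e, norm_mul, Complex.norm_real, Real.norm_of_nonneg (fourierConst_pos d).le]
    exact mul_le_of_le_one_left (norm_nonneg _) (fourierConst_le_one d)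
  refine h2.trans (h1.trans (le_of_eq ?_))
  rw [Real.exp_add, hb]
  ring

/-! ### Microlocal decay at a point of phase space -/

/-- `N (λ ^ s x, λ ^ t ξ) = O(exp (-r λ))` for all `r > 0`, uniformly near `(x₀, ξ₀)`. -/
def LocDecay (s t : ℝ) (N : E d → E d → ℂ) (x₀ ξ₀ : E d) : Prop :=
  ∃ δ > 0, ∀ r : ℝ, 0 < r → ∃ C : ℝ, ∀ l : ℝ, 0 < l → ∀ x ∈ Metric.ball x₀ δ,
    ∀ ξ ∈ Metric.ball ξ₀ δ, Real.exp (r * l) * ‖N (l ^ s • x) (l ^ t • ξ)‖ ≤ C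

theorem mem_WF_iff {t s : ℝ} (ht : 0 < t) (hs : 0 < s) (ψ : GS d t s) (u : GSDual d t s)
    (z : E d × E d) : z ∈ WF ht hs ψ u ↔ z ≠ 0 ∧ ¬LocDecay t s (stft ht hs ψ u) z.1 z.2 := by
  refine and_congr_right fun hz => not_congr ⟨?_, ?_⟩
  · rintro ⟨U, hU, -, hzU, H⟩
    obtain ⟨δ, hδ, hb⟩ := Metric.isOpen_iff.1 hU z hzU
    refine ⟨δ, hδ, fun r hr => ?_⟩
    obtain ⟨C, hC⟩ := H r hr
    refine ⟨C, fun l hl x hx ξ hξ => hC l hl (x, ξ) (hb ?_)⟩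
    rw [← ball_prod_same]
    exact ⟨hx, hξ⟩
  · rintro ⟨δ, hδ, H⟩
    refine ⟨(Metric.ball z.1 δ ×ˢ Metric.ball z.2 δ) ∩ {0}ᶜ,
      (Metric.isOpen_ball.prod Metric.isOpen_ball).inter isOpen_compl_singleton,
      Set.inter_subset_right, ⟨⟨Metric.mem_ball_self hδ, Metric.mem_ball_self hδ⟩, hz⟩,
      fun r hr => ?_⟩
    obtain ⟨C, hC⟩ := H r hr
    exact ⟨C, fun l hl p hp => hC l hl p.1 hp.1.1 p.2 hp.1.2⟩

theorem norm_rpow_le_of_mem_ball {p δ : ℝ} (hp : 0 ≤ p) {x₀ x : E d}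
    (hx : x ∈ Metric.ball x₀ δ) : ‖x‖ ^ p ≤ (‖x₀‖ + δ) ^ p := by
  refine Real.rpow_le_rpow (norm_nonneg _) ?_ hp
  have h1 := norm_add_le x₀ (x - x₀)
  rw [add_sub_cancel, ← dist_eq_norm] at h1
  linarith [Metric.mem_ball.1 hx]

/-- Near `ξ₀ ≠ 0` the decay exponent is at least a fixed multiple of `λ`, with an arbitrarily large
rate in front, while the growth exponent in `x` is at most a multiple of `λ`. -/
theorem LocDecay.of_ne_zero {s t : ℝ} (hs : 0 < s) (ht : 0 < t) {N : E d → E d → ℂ}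
    (hN : ∀ r ε : ℝ, 0 < r → 0 < ε → ∃ C, 0 ≤ C ∧ ∀ x ξ, ‖N x ξ‖ ≤
      C * Real.exp (-r * ‖ξ‖ ^ (1 / t) + ε * ‖x‖ ^ (1 / s))) (x₀ : E d) {ξ₀ : E d}
    (hξ₀ : ξ₀ ≠ 0) : LocDecay s t N x₀ ξ₀ := by
  have hn : 0 < ‖ξ₀‖ := norm_pos_iff.2 hξ₀
  refine ⟨‖ξ₀‖ / 2, by positivity, fun r hr => ?_⟩
  set a : ℝ := (‖ξ₀‖ / 2) ^ (1 / t)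
  have ha : 0 < a := Real.rpow_pos_of_pos (by positivity) _
  set M : ℝ := (‖x₀‖ + ‖ξ₀‖ / 2) ^ (1 / s)
  have hM : 0 ≤ M := Real.rpow_nonneg (by positivity) _
  obtain ⟨C, hC0, hC⟩ := hN ((r + M) / a) 1 (by positivity) one_pos
  refine ⟨C, fun l hl x hx ξ hξ => ?_⟩
  have h1 : a ≤ ‖ξ‖ ^ (1 / t) := by
    refine Real.rpow_le_rpow (by positivity) ?_ (by positivity)
    have h1 := norm_add_le ξ (ξ₀ - ξ)
    rw [add_sub_cancel, ← dist_eq_norm, dist_comm] at h1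
    linarith [Metric.mem_ball.1 hξ]
  have h2 : ‖x‖ ^ (1 / s) ≤ M := norm_rpow_le_of_mem_ball (by positivity) hx
  have h3 := hC (l ^ s • x) (l ^ t • ξ)
  rw [norm_rpow_smul_rpow hs hl, norm_rpow_smul_rpow ht hl] at h3
  calc Real.exp (r * l) * ‖N (l ^ s • x) (l ^ t • ξ)‖
      ≤ Real.exp (r * l) * (C * Real.exp (-((r + M) / a) * (l * ‖ξ‖ ^ (1 / t)) +
        1 * (l * ‖x‖ ^ (1 / s)))) := by gcongr
    _ = C * Real.exp (r * l + (-((r + M) / a) * (l * ‖ξ‖ ^ (1 / t)) +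
        1 * (l * ‖x‖ ^ (1 / s)))) := by
      rw [Real.exp_add (r * l)]; ring
    _ ≤ C * Real.exp 0 := by
      gcongr
      have e1 : (r + M) * l ≤ (r + M) / a * (l * ‖ξ‖ ^ (1 / t)) := by
        calc (r + M) * l = (r + M) / a * (l * a) := by field_simp
          _ ≤ _ := by gcongr
      have e2 : l * ‖x‖ ^ (1 / s) ≤ l * M := by gcongr
      linarith
    _ = C := by simp

theorem SuperExpDecay.comp_sub {s : ℝ} (hs : 1 < s) {ρ : E d → ℂ} (hρ : SuperExpDecay s ρ)
    (a : E d) : SuperExpDecay s fun y => ρ (y - a) where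
  continuous := hρ.continuous.comp (continuous_id.sub continuous_const)
  bound r hr := by
    obtain ⟨C, hC0, hC⟩ := hρ.bound r hr
    refine ⟨C * Real.exp (r * ‖a‖ ^ (1 / s)), by positivity, fun x => (hC _).trans ?_⟩
    rw [mul_assoc, ← Real.exp_add]
    have := norm_rpow_le_add hs x a
    gcongr
    nlinarith

theorem norm_windowedFourier_le_integral (f ρ : E d → ℂ) (x ξ : E d) :
    ‖windowedFourier f ρ x ξ‖ ≤ ∫ y, ‖f y‖ * ‖ρ (y - x)‖ := by
  refine (norm_fourier_le_integral _ ξ).trans (le_of_eq ?_)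
  simp

/-- The frequency plays no role: the windowed transform is bounded by the integral of `|f|` against
the translated window, split according to whether `y` lies within `λ ^ s δ` of `λ ^ s x`. -/
theorem LocDecay.of_decay {s t : ℝ} (hs : 1 < s) {f ρ : E d → ℂ} (hf : SubExpGrowth s f)
    (hρ : SuperExpDecay s ρ) {x₀ : E d} {U : Set (E d)} (hU : IsOpen U) (hx₀ : x₀ ∈ U)
    (H : ∀ r : ℝ, 0 < r → ∃ C : ℝ, ∀ x ∈ U, ∀ l : ℝ, 0 < l →
      Real.exp (r * l) * ‖f (l ^ s • x)‖ ≤ C) (ξ₀ : E d) :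
    LocDecay s t (windowedFourier f ρ) x₀ ξ₀ := by
  have hs0 : 0 < s := by linarith
  obtain ⟨δ', hδ', hb⟩ := Metric.isOpen_iff.1 hU x₀ hx₀
  set δ : ℝ := δ' / 2 with hδdef
  have hδ : 0 < δ := half_pos hδ'
  refine ⟨δ, hδ, fun r hr => ?_⟩
  set M : ℝ := (‖x₀‖ + δ) ^ (1 / s)
  have hM : 0 ≤ M := Real.rpow_nonneg (by positivity) _
  set a : ℝ := δ ^ (1 / s) with ha'
  have ha : 0 < a := Real.rpow_pos_of_pos hδ _
  obtain ⟨C₁, hC₁⟩ := H r hr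
  obtain ⟨C₂, hC₂0, hC₂⟩ := hρ.bound 1 one_pos
  obtain ⟨C₃, hC₃0, hC₃⟩ := hf.bound 1 one_pos
  -- Away from the centre, the part `(r + M) / a` beats `exp (r λ)` and the growth at the centre,
  -- one unit pays for the growth of `f` over the displacement, and one unit is left for
  -- integrability.
  obtain ⟨C₄, hC₄0, hC₄⟩ := hρ.bound ((r + M) / a + 2) (by positivity)
  set C : ℝ := max (C₁ * C₂) (C₃ * C₄) with hC
  have hint : Integrable fun y : E d => Real.exp (-1 * ‖y‖ ^ (1 / s)) :=
    integrable_exp_neg_rpow (by positivity) one_pos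
  refine ⟨C * ∫ y : E d, Real.exp (-1 * ‖y‖ ^ (1 / s)), fun l hl x hx ξ _ => ?_⟩
  have hxM : ‖x‖ ^ (1 / s) ≤ M := norm_rpow_le_of_mem_ball (by positivity) hx
  have hls : 0 < l ^ s := Real.rpow_pos_of_pos hl _
  have key : ∀ y, Real.exp (r * l) * (‖f y‖ * ‖ρ (y - l ^ s • x)‖) ≤
      C * Real.exp (-1 * ‖y - l ^ s • x‖ ^ (1 / s)) := by
    intro y
    rcases lt_or_ge ‖y - l ^ s • x‖ (l ^ s * δ) with h | h
    -- Near the centre, `y` is itself a dilate of a point of `U`, where `f` decays by assumption.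
    · have e1 : l ^ s • ((l ^ s)⁻¹ • y) = y := by
        rw [smul_smul, mul_inv_cancel₀ hls.ne', one_smul]
      have hmem : (l ^ s)⁻¹ • y ∈ U := by
        refine hb ?_
        have e2 : (l ^ s)⁻¹ • y - x = (l ^ s)⁻¹ • (y - l ^ s • x) := by
          rw [smul_sub, smul_smul, inv_mul_cancel₀ hls.ne', one_smul]
        have e3 : dist ((l ^ s)⁻¹ • y) x < δ := by
          rw [dist_eq_norm, e2, norm_smul, norm_inv, Real.norm_of_nonneg hls.le,
            inv_mul_lt_iff₀ hls]
          exact h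
        have := dist_triangle ((l ^ s)⁻¹ • y) x x₀
        have := Metric.mem_ball.1 hx
        rw [Metric.mem_ball]
        linarith
      have h1 := hC₁ _ hmem l hl
      rw [e1] at h1
      rw [← mul_assoc]
      have hC₁0 : 0 ≤ C₁ := le_trans (by positivity) h1
      refine (mul_le_mul h1 (hC₂ _) (norm_nonneg _) hC₁0).trans ?_
      rw [← mul_assoc]
      exact mul_le_mul_of_nonneg_right (le_max_left _ _) (Real.exp_pos _).le
    · set q : ℝ := ‖y - l ^ s • x‖ ^ (1 / s) with hq
      have h1 : l * a ≤ q := by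
        have := Real.rpow_le_rpow (by positivity) h (by positivity : 0 ≤ 1 / s)
        rwa [Real.mul_rpow hls.le hδ.le, ← Real.rpow_mul hl.le, mul_one_div_cancel hs0.ne',
          Real.rpow_one] at this
      have h2 : ‖y‖ ^ (1 / s) ≤ l * M + q := by
        refine (norm_rpow_le_add hs y (l ^ s • x)).trans ?_
        rw [norm_rpow_smul_rpow hs0 hl]
        gcongr
      have h3 : (r + M) * l ≤ (r + M) / a * q := by
        calc (r + M) * l = (r + M) / a * (l * a) := by field_simp
          _ ≤ _ := by gcongr
      calc Real.exp (r * l) * (‖f y‖ * ‖ρ (y - l ^ s • x)‖)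
          ≤ Real.exp (r * l) * ((C₃ * Real.exp (1 * ‖y‖ ^ (1 / s))) *
            (C₄ * Real.exp (-((r + M) / a + 2) * q))) := by
            gcongr
            · exact hC₃ y
            · exact hC₄ _
        _ = C₃ * C₄ * Real.exp (r * l + 1 * ‖y‖ ^ (1 / s) + -((r + M) / a + 2) * q) := by
            rw [Real.exp_add, Real.exp_add]; ring
        _ ≤ C * Real.exp (-1 * q) := by
            gcongr
            · exact le_max_right _ _
            · linarith
  have h1 := mul_le_mul_of_nonneg_left (norm_windowedFourier_le_integral f ρ (l ^ s • x)
    (l ^ t • ξ)) (Real.exp_pos (r * l)).le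
  refine h1.trans ?_
  rw [← integral_sub_right_eq_self (fun y : E d => Real.exp (-1 * ‖y‖ ^ (1 / s))) (l ^ s • x),
    ← integral_const_mul, ← integral_const_mul]
  exact integral_mono_of_nonneg (Filter.Eventually.of_forall fun y => by
      simp only [Pi.zero_apply]; positivity)
    ((hint.comp_sub_right (l ^ s • x)).const_mul C) (Filter.Eventually.of_forall key)

/-- Inverting the Fourier transform in `ξ` at `λ ^ s x + z₀`, where the translated window has the
nonzero value `ρ z₀`, bounds `f` there by an integral over frequencies. Low frequencies are
controlled by the local decay, high ones by the a priori bound. -/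
theorem LocDecay.decay {s t : ℝ} (hs : 1 < s) (ht : 0 < t) {f ρ : E d → ℂ}
    (hf : SubExpGrowth s f) (hρ : SuperExpDecay s ρ) {z₀ : E d} (hz₀ : ρ z₀ ≠ 0)
    (hN : ∀ r ε : ℝ, 0 < r → 0 < ε → ∃ C, 0 ≤ C ∧ ∀ x ξ, ‖windowedFourier f ρ x ξ‖ ≤
      C * Real.exp (-r * ‖ξ‖ ^ (1 / t) + ε * ‖x‖ ^ (1 / s))) {x₀ : E d} (hx₀ : x₀ ≠ 0)
    (H : LocDecay s t (windowedFourier f ρ) x₀ 0) :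
    ∃ U : Set (E d), IsOpen U ∧ U ⊆ {0}ᶜ ∧ x₀ ∈ U ∧ ∀ r : ℝ, 0 < r → ∃ C : ℝ, ∀ x ∈ U,
      ∀ l : ℝ, 0 < l → Real.exp (r * l) * ‖f (l ^ s • x)‖ ≤ C := by
  have hs0 : 0 < s := by linarith
  obtain ⟨δ, hδ, H⟩ := H
  set M : ℝ := (‖x₀‖ + δ) ^ (1 / s)
  have hM : 0 ≤ M := Real.rpow_nonneg (by positivity) _
  set a : ℝ := δ ^ (1 / t) with ha'
  have ha : 0 < a := Real.rpow_pos_of_pos hδ _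
  have hint : Integrable fun ξ : E d => Real.exp (-1 * ‖ξ‖ ^ (1 / t)) :=
    integrable_exp_neg_rpow (by positivity) one_pos
  have hρz : 0 < ‖ρ z₀‖ := norm_pos_iff.2 hz₀
  have shifted : ∀ r : ℝ, 0 < r → ∃ C : ℝ, 0 ≤ C ∧ ∀ x ∈ Metric.ball x₀ δ, ∀ l : ℝ, 0 < l →
      Real.exp (r * l) * ‖f (l ^ s • x + z₀)‖ ≤ C := by
    intro r hr
    -- The extra rate `a` yields the integrable factor: on `|ξ| < λ ^ t δ` one has `|ξ| ^ (1/t) ≤ λ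
    -- a`.
    obtain ⟨C₁, hC₁⟩ := H (r + a) (by positivity)
    obtain ⟨C₂, hC₂0, hC₂⟩ := hN ((r + M) / a + 1) 1 (by positivity) one_pos
    set C : ℝ := max C₁ C₂ with hC
    have hC0 : 0 ≤ C := hC₂0.trans (le_max_right _ _)
    set I : ℝ := ∫ ξ : E d, Real.exp (-1 * ‖ξ‖ ^ (1 / t)) with hI
    have hI0 : 0 ≤ I := integral_nonneg fun x => (Real.exp_pos _).le
    refine ⟨C * I / ‖ρ z₀‖, by positivity, fun x hx l hl => ?_⟩
    have hxM : ‖x‖ ^ (1 / s) ≤ M := norm_rpow_le_of_mem_ball (by positivity) hx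
    have hlt : 0 < l ^ t := Real.rpow_pos_of_pos hl _
    have hb : ∀ ξ, ‖windowedFourier f ρ (l ^ s • x) ξ‖ ≤
        C * Real.exp (-(r * l)) * Real.exp (-1 * ‖ξ‖ ^ (1 / t)) := by
      intro ξ
      set q : ℝ := ‖ξ‖ ^ (1 / t) with hq
      have e0 : (l ^ t * δ) ^ (1 / t) = l * a := by
        rw [Real.mul_rpow hlt.le hδ.le, ← Real.rpow_mul hl.le, mul_one_div_cancel ht.ne',
          Real.rpow_one]
      rcases lt_or_ge ‖ξ‖ (l ^ t * δ) with h | h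
      · have e1 : l ^ t • ((l ^ t)⁻¹ • ξ) = ξ := by
          rw [smul_smul, mul_inv_cancel₀ hlt.ne', one_smul]
        have hmem : (l ^ t)⁻¹ • ξ ∈ Metric.ball (0 : E d) δ := by
          rw [mem_ball_zero_iff, norm_smul, norm_inv, Real.norm_of_nonneg hlt.le,
            inv_mul_lt_iff₀ hlt]
          exact h
        have h1 := hC₁ l hl x hx _ hmem
        rw [e1] at h1
        have h2 : q ≤ l * a := by
          rw [← e0]
          exact Real.rpow_le_rpow (norm_nonneg _) h.le (by positivity)
        have h3 : ‖windowedFourier f ρ (l ^ s • x) ξ‖ ≤ C * Real.exp (-((r + a) * l)) := by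
          rw [Real.exp_neg, ← div_eq_mul_inv, le_div_iff₀ (Real.exp_pos _), mul_comm]
          exact h1.trans (le_max_left _ _)
        refine h3.trans ?_
        rw [mul_assoc, ← Real.exp_add]
        gcongr
        linarith
      · have h1 : l * a ≤ q := by
          rw [← e0]
          exact Real.rpow_le_rpow (by positivity) h (by positivity)
        have h2 := hC₂ (l ^ s • x) ξ
        rw [norm_rpow_smul_rpow hs0 hl] at h2
        refine h2.trans ?_
        rw [mul_assoc, ← Real.exp_add]
        have h3 : (r + M) * l ≤ (r + M) / a * q := by
          calc (r + M) * l = (r + M) / a * (l * a) := by field_simp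
            _ ≤ _ := by gcongr
        have h4 : l * ‖x‖ ^ (1 / s) ≤ l * M := by gcongr
        refine mul_le_mul (le_max_right _ _) (Real.exp_le_exp.2 ?_) (Real.exp_pos _).le hC0
        rw [← hq]
        linarith
    have hk := hf.mul_decay (hρ.comp_sub hs (l ^ s • x)).conj
    have h1 := norm_le_integral_of_fourier_le hk.continuous (hk.integrable hs0)
      (hint.const_mul _) hb (l ^ s • x + z₀)
    rw [norm_mul, RCLike.norm_conj, add_sub_cancel_left, integral_const_mul, ← hI] at h1
    rw [le_div_iff₀ hρz, mul_assoc]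
    refine (mul_le_mul_of_nonneg_left h1 (Real.exp_pos _).le).trans (le_of_eq ?_)
    rw [mul_assoc, mul_left_comm, ← mul_assoc (Real.exp (r * l)), ← Real.exp_add, add_neg_cancel,
      Real.exp_zero, one_mul]
  refine ⟨Metric.ball x₀ (δ / 2) ∩ {0}ᶜ, Metric.isOpen_ball.inter isOpen_compl_singleton,
    Set.inter_subset_right, ⟨Metric.mem_ball_self (by positivity), hx₀⟩, fun r hr => ?_⟩
  obtain ⟨C₁, hC₁0, hC₁⟩ := shifted r hr
  obtain ⟨C₃, hC₃0, hC₃⟩ := hf.bound 1 one_pos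
  -- For `λ > L` the displacement by `z₀` is less than `δ / 2` after rescaling, so it can be undone
  -- inside the larger ball. For `λ ≤ L` everything is bounded.
  set L : ℝ := (2 * ‖z₀‖ / δ) ^ (1 / s) with hL
  refine ⟨C₁ + Real.exp (r * L) * (C₃ * Real.exp (L * M)), fun y hy l hl => ?_⟩
  have hls : 0 < l ^ s := Real.rpow_pos_of_pos hl _
  rcases lt_or_ge ‖z₀‖ (l ^ s * (δ / 2)) with h | h
  · have hmem : y - (l ^ s)⁻¹ • z₀ ∈ Metric.ball x₀ δ := by
      have h1 : ‖(l ^ s)⁻¹ • z₀‖ < δ / 2 := by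
        rw [norm_smul, norm_inv, Real.norm_of_nonneg hls.le, inv_mul_lt_iff₀ hls]
        exact h
      have h2 := Metric.mem_ball.1 hy.1
      rw [dist_eq_norm] at h2
      rw [Metric.mem_ball, dist_eq_norm, sub_right_comm]
      linarith [norm_sub_le (y - x₀) ((l ^ s)⁻¹ • z₀)]
    have h1 := hC₁ _ hmem l hl
    rw [smul_sub, smul_smul, mul_inv_cancel₀ hls.ne', one_smul, sub_add_cancel] at h1
    refine h1.trans (le_add_of_nonneg_right (by positivity))
  · have h1 : l ≤ L := by
      have h2 : l ^ s ≤ 2 * ‖z₀‖ / δ := by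
        rw [le_div_iff₀ hδ]; linarith
      have := Real.rpow_le_rpow hls.le h2 (by positivity : 0 ≤ 1 / s)
      rwa [← Real.rpow_mul hl.le, mul_one_div_cancel hs0.ne', Real.rpow_one] at this
    have h2 : ‖y‖ ^ (1 / s) ≤ M :=
      norm_rpow_le_of_mem_ball (by positivity) (Metric.ball_subset_ball (by linarith) hy.1)
    have h3 := hC₃ (l ^ s • y)
    rw [norm_rpow_smul_rpow hs0 hl, one_mul] at h3
    refine le_trans ?_ (le_add_of_nonneg_left hC₁0)
    have h4 : l * ‖y‖ ^ (1 / s) ≤ L * M :=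
      mul_le_mul h1 h2 (Real.rpow_nonneg (norm_nonneg _) _) (hl.le.trans h1)
    have h5 : ‖f (l ^ s • y)‖ ≤ C₃ * Real.exp (L * M) := h3.trans (by gcongr)
    gcongr

theorem not_locDecay_windowedFourier_iff {s t : ℝ} (hs : 1 < s) (ht : 0 < t) {f ρ : E d → ℂ}
    (hf : SubExpGrowth s f) (hρ : SuperExpDecay s ρ) {z₀ : E d} (hz₀ : ρ z₀ ≠ 0)
    (hN : ∀ r ε : ℝ, 0 < r → 0 < ε → ∃ C, 0 ≤ C ∧ ∀ x ξ, ‖windowedFourier f ρ x ξ‖ ≤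
      C * Real.exp (-r * ‖ξ‖ ^ (1 / t) + ε * ‖x‖ ^ (1 / s))) {x₀ ξ₀ : E d}
    (h : x₀ ≠ 0 ∨ ξ₀ ≠ 0) :
    ¬LocDecay s t (windowedFourier f ρ) x₀ ξ₀ ↔ x₀ ∈ nonDecay s f ∧ ξ₀ = 0 := by
  by_cases hξ : ξ₀ = 0
  · subst hξ
    have hx : x₀ ≠ 0 := h.resolve_right (not_not.2 rfl)
    simp only [and_true]
    refine ⟨fun H => ⟨hx, fun ⟨U, hU, _, hxU, hd⟩ => H (.of_decay hs hf hρ hU hxU hd 0)⟩,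
      fun H hd => H.2 (hd.decay hs ht hf hρ hz₀ hN hx)⟩
  · exact ⟨fun H => (H (.of_ne_zero (by linarith) ht hN x₀ hξ)).elim, fun H => (hξ H.2).elim⟩

/-! ### The two wave front sets -/

theorem norm_stft_of_hasFourier {t s : ℝ} (ht : 0 < t) (hs : 0 < s) {u : GSDual d t s}
    {g : E d → ℂ} (hg : HasFourier u g) (ψ : GS d t s) (x ξ : E d) :
    ‖stft ht hs ψ u x ξ‖ = ‖windowedFourier g (fourier ψ.fn) ξ (-x)‖ := by
  have e : stft ht hs ψ u x ξ = (fourierConst d : ℂ) * u (tfShift ht hs x ξ ψ) := rfl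
  have e2 := pairing_tfShift g ψ.fn x ξ
  rw [e, (hg.2 _).2]
  change ‖(fourierConst d : ℂ) *
    ∫ η, g η * starRingEnd ℂ (fourier (modulate ξ (translate x ψ.fn)) η)‖ = _
  rw [e2, norm_mul, norm_exp_neg_I_mul, one_mul]
  rfl

theorem stft_of_isFunction {s t : ℝ} (hs : 0 < s) (ht : 0 < t) {F : GSDual d s t} {f : E d → ℂ}
    (hF : IsFunction F f) (ψ : GS d s t) : stft hs ht ψ F = windowedFourier f ψ.fn := by
  funext x ξ
  have e : stft hs ht ψ F x ξ = (fourierConst d : ℂ) * F (tfShift hs ht x ξ ψ) := rfl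
  rw [e, (hF _).2, windowedFourier, fourier_def]
  congr 2
  funext y
  change f y * starRingEnd ℂ (Complex.exp (Complex.I * ((inner ℝ y ξ : ℝ) : ℂ)) *
    ψ.fn (y - x)) = _
  rw [map_mul, ← Complex.exp_conj, map_mul, Complex.conj_I, Complex.conj_ofReal]
  ring

/-- The windowed-transform criterion is applied to û with window ψ̂ at `(ξ, -x)`. The a priori bound
comes from the direct estimate of the Dirac series, so only the super-exponential decay of ψ̂ itself
is needed, not bounds on its derivatives. -/
theorem WF_diracSeries {t s : ℝ} (ht : 0 < t) (hs : 1 < s) (hs0 : 0 < s) {c : MIdx d → ℂ}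
    (hc : SmallCoeff s c) {u : GSDual d t s} (hu : IsDiracSeries c u) {ψ : GS d t s}
    (hψ : ψ ≠ 0) : WF ht hs0 ψ u = {0} ×ˢ nonDecay s (powerSeriesSum c) := by
  have hκ : (fourierConst d : ℂ) ≠ 0 := by exact_mod_cast (fourierConst_pos d).ne'
  have hF := hasFourier_of_isDiracSeries ht hs hc hu
  obtain ⟨η, hη⟩ := ψ.fourier_ne_zero ht hψ
  have hst := norm_stft_of_hasFourier ht hs0 hF ψ
  have hg : SubExpGrowth s fun ξ => (fourierConst d : ℂ) * powerSeriesSum c ξ := by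
    refine ⟨hF.1, fun ε hε => ?_⟩
    obtain ⟨C, hC0, hC⟩ := (hc.subExpGrowth hs).bound ε hε
    refine ⟨C, hC0, fun x => ?_⟩
    rw [norm_mul, Complex.norm_real, Real.norm_of_nonneg (fourierConst_pos d).le]
    exact (mul_le_of_le_one_left (norm_nonneg _) (fourierConst_le_one d)).trans (hC x)
  rw [← nonDecay_const_mul hκ (powerSeriesSum c)]
  ext ⟨x, ξ⟩
  -- Exchanging position and frequency also exchanges the two dilation exponents; the reflection `x
  -- ↦ -x` maps balls to balls.
  have hloc : LocDecay t s (stft ht hs0 ψ u) x ξ ↔ LocDecay s t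
      (windowedFourier (fun ξ => (fourierConst d : ℂ) * powerSeriesSum c ξ) (fourier ψ.fn))
      ξ (-x) := by
    have hball : ∀ {y : E d} {δ : ℝ}, y ∈ Metric.ball x δ ↔ -y ∈ Metric.ball (-x) δ :=
      fun {y δ} => by simp [Metric.mem_ball, dist_neg_neg]
    refine exists_congr fun δ => and_congr_right fun _ => forall₂_congr fun r _ =>
      exists_congr fun C => forall₂_congr fun l _ => ⟨fun H y hy ζ hζ => ?_, fun H y hy ζ hζ => ?_⟩
    · have h1 := H (-ζ) (hball.2 (by rwa [neg_neg])) y hy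
      rwa [hst, smul_neg, neg_neg] at h1
    · have h1 := H ζ hζ (-y) (hball.1 hy)
      rwa [smul_neg, ← hst] at h1
  rw [mem_WF_iff, Set.mem_prod, Set.mem_singleton_iff, hloc]
  have hcrit : ((x, ξ) : E d × E d) ≠ 0 → (¬LocDecay s t
      (windowedFourier (fun ξ => (fourierConst d : ℂ) * powerSeriesSum c ξ) (fourier ψ.fn))
      ξ (-x) ↔ ξ ∈ nonDecay s (fun ξ => (fourierConst d : ℂ) * powerSeriesSum c ξ) ∧ -x = 0) :=
    fun hz => not_locDecay_windowedFourier_iff hs ht hg (ψ.superExpDecay_fourier ht hs0) hη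
      (fun r ε hr hε => by
        obtain ⟨C, hC0, hC⟩ := exists_stft_diracSeries_le ht hs0 hc hu ψ hr hε
        refine ⟨C, hC0, fun y ζ => ?_⟩
        have h1 := hC (-ζ) y
        rwa [hst, neg_neg, norm_neg] at h1)
      (by
        by_contra! h0
        exact hz (Prod.ext (by simpa using h0.2) h0.1))
  constructor
  · rintro ⟨hz, h⟩
    obtain ⟨h1, h2⟩ := (hcrit hz).1 h
    exact ⟨neg_eq_zero.1 h2, h1⟩
  · rintro ⟨h1, h2⟩
    have hz : ((x, ξ) : E d × E d) ≠ 0 := fun h0 => h2.1 (congrArg Prod.snd h0)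
    exact ⟨hz, (hcrit hz).2 ⟨h2, neg_eq_zero.2 h1⟩⟩

theorem WF_powerSeries {s t : ℝ} (hs : 1 < s) (hs0 : 0 < s) (ht : 0 < t) {c : MIdx d → ℂ}
    (hc : SmallCoeff s c) {F : GSDual d s t} (hF : IsFunction F (powerSeriesSum c))
    {ψ : GS d s t} (hψ : ψ ≠ 0) : WF hs0 ht ψ F = nonDecay s (powerSeriesSum c) ×ˢ {0} := by
  obtain ⟨y, hy⟩ : ∃ y, ψ.fn y ≠ 0 := by
    by_contra! h
    exact hψ (GS.ext_fn (funext h))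
  ext ⟨x, ξ⟩
  rw [mem_WF_iff, Set.mem_prod, Set.mem_singleton_iff, stft_of_isFunction hs0 ht hF]
  have hcrit : ((x, ξ) : E d × E d) ≠ 0 →
      (¬LocDecay s t (windowedFourier (powerSeriesSum c) ψ.fn) x ξ ↔
        x ∈ nonDecay s (powerSeriesSum c) ∧ ξ = 0) := fun hz =>
    not_locDecay_windowedFourier_iff hs ht (hc.subExpGrowth hs) (ψ.superExpDecay hs0) hy
      (fun _ _ hr hε => exists_windowedFourier_le hs ht hc ψ hr hε)
      (by
        by_contra! h0
        exact hz (Prod.ext h0.1 h0.2))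
  constructor
  · rintro ⟨hz, h⟩
    exact (hcrit hz).1 h
  · intro h
    have hz : ((x, ξ) : E d × E d) ≠ 0 := fun h0 => h.1.1 (congrArg Prod.fst h0)
    exact ⟨hz, (hcrit hz).2 h⟩

end GelfandShilov

end

open GelfandShilov in
theorem proposition7p4 (d : ℕ) (s t : ℝ) (hs : 1 < s) (ht : 0 < t)
    (c : MIdx d → ℂ)
    (hc : ∀ r : ℝ, 0 < r → Summable fun α => ‖c α‖ * r ^ deg α * mfact α ^ s) :
    (∀ x : E d, Summable fun α => c α * (mono x α : ℂ)) ∧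
    ∃ (u : GSDual d t s) (F : GSDual d s t),
      IsDiracSeries c u ∧
      IsPowerSeries c F ∧ IsFunction F (powerSeriesSum c) ∧
      V u = nonDecay s (powerSeriesSum c) ∧
      (∀ ψ : GS d t s, ψ ≠ 0 → WF ht (zero_lt_one.trans hs) ψ u = {0} ×ˢ V u) ∧
      (∀ ψ : GS d s t, ψ ≠ 0 → WF (zero_lt_one.trans hs) ht ψ F = V u ×ˢ {0}) := by
  have hs0 : 0 < s := zero_lt_one.trans hs
  have hc' : SmallCoeff s c := hc
  have hu := isDiracSeries_diracSeries t hc'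
  have hF := isFunction_functionDual t hs0 (hc'.subExpGrowth hs)
  have hV : V (diracSeries t hc') = nonDecay s (powerSeriesSum c) := by
    rw [V_eq_nonDecay ht hs.le (hasFourier_of_isDiracSeries ht hs hc' hu)]
    exact nonDecay_const_mul (by exact_mod_cast (fourierConst_pos d).ne') _
  refine ⟨hc'.summable hs0, diracSeries t hc', functionDual t hs0 (hc'.subExpGrowth hs), hu,
    isPowerSeries_of_isFunction hs hc' hF, hF, hV, fun ψ hψ => ?_, fun ψ hψ => ?_⟩
  · rw [hV]
    exact WF_diracSeries ht hs hs0 hc' hu hψ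
  · rw [hV]
    exact WF_powerSeries hs hs0 ht hc' hF hψ
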